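/- Let $d\ge 1$, and let $M,K,\zeta,s_0>0$. Write $|\cdot|$ for the Euclidean norm on $\mathbb{R}^d$, $\hat x=x/|x|$, $\mathbb{T}^d=(\mathbb{R}/2\pi\mathbb{Z})^d$ (identified with $[-\pi,\pi]^d$), $\hat f(k)=\sum_{x\in\mathbb{Z}^d}f(x)e^{-ik\cdot x}$ for $f:\mathbb{Z}^d\to\mathbb{R}$, and $\|\cdot\|_p$ for the norm of $\ell^p(\mathbb{Z}^d)$. Let $\mathcal{Q}_{M,K,\zeta}$ be the set of pairs $(Q,g)$ of functions $\mathbb{Z}^d\to\mathbb{R}$ with $$\|Q(y)\|_1,\ \big\||y|^{2+\zeta}Q(y)\big\|_1\le M,\qquad \mathrm{Re}[\hat Q(0)-\hat Q(k)]\ge K|k|^2\quad(k\in\mathbb{T}^d),$$ $$\|g(y)\|_1,\ \big\||y|^{\zeta}g(y)\big\|_1,\ \big\||y|^2g(y)\big\|_{p_d\wedge 2}\le M,$$ where $p_1=2$ and $p_d=\frac{d}{d-2+(\zeta\wedge 2)}$ for $d\ge2$, and, if $d\ge4$, additionally $$\big\||y|^{d-1}Q(y)\big\|_{\frac d3\wedge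 2},\ \big\||y|^{d-1}g(y)\big\|_2\le M.$$ For such $Q$ let $\eta_j=\sum_y y_jQ(y)$ and $\Lambda_{jl}=\sum_y y_jy_lQ(y)$. For $t>0$ let $$\rho_t(x;\eta,\Lambda)=\frac{1}{\sqrt{\det\Lambda}\,(2\pi t)^{d/2}}\exp\Big\{-\frac1{2t}(x-t\eta)\cdot\Lambda^{-1}(x-t\eta)\Big\},\qquad C(x;\eta,\Lambda)=\int_0^\infty\rho_t(x;\eta,\Lambda)\,dt .$$ Then there are $\varepsilon>0$, $A>0$ and $R>0$, depending only on $d,\zeta,M,K,s_0$, such that the following holds for all $(Q,g)\in\mathcal{Q}_{M,K,\zeta}$ and all nonzero $x\in\mathbb{Z}^d$ with $\eta=|\eta|\hat x$ ($\eta=0$ is permitted), subject, if $d\le 2$, to the further condition $|x||\eta|\ge s_0$. The integrals over $t$ in $C(x;\eta,\Lambda)$ and in $$G_Q(x)=\int_0^\infty dt\int_{\mathbb{T}^d}\frac{dk}{(2\pi)^d}\,e^{ik\cdot x}\hat g(k)e^{-t[\hat Q(0)-\hat Q(k)]}$$ (an iterated integral) converge absolutely, and if $|x|\ge R$ then $$G_Q(x)=C(x;\eta,\Lambda)\big[\hat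 g(0)+r\big]\qquad\text{with } |r|\le A|x|^{-\varepsilon}.$$ -/

import Mathlib

open MeasureTheory

noncomputable section

namespace GaussianLemma

/-- The lattice point `x ∈ ℤ^d` as a vector of Euclidean space `ℝ^d`. -/
def vec {d : ℕ} (x : Fin d → ℤ) : EuclideanSpace ℝ (Fin d) :=
  WithLp.toLp 2 (fun j => (x j : ℝ))

/-- The fundamental domain `[-π, π]^d` of the torus `𝕋^d = (ℝ / 2πℤ)^d`. -/
def torusCube (d : ℕ) : Set (EuclideanSpace ℝ (Fin d)) :=
  {k | ∀ j, k j ∈ Set.Icc (-Real.pi) Real.pi}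

/-- The Fourier transform `f̂(k) = ∑_{x ∈ ℤ^d} f(x) e^{-i k·x}` of `f : ℤ^d → ℝ`. -/
def latticeFourier {d : ℕ} (f : (Fin d → ℤ) → ℝ) (k : EuclideanSpace ℝ (Fin d)) : ℂ :=
  ∑' x : Fin d → ℤ, (f x : ℂ) * Complex.exp (-(Complex.I * ((inner ℝ k (vec x) : ℝ) : ℂ)))

/-- The extended-real-valued norm `‖ |y|^a f(y) ‖_p` in `ℓ^p(ℤ^d)`. -/
def weightedNorm {d : ℕ} (a p : ℝ) (f : (Fin d → ℤ) → ℝ) : ENNReal :=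
  eLpNorm (fun y : Fin d → ℤ => ‖vec y‖ ^ a * f y) (ENNReal.ofReal p) Measure.count

/-- The exponent `p_d`: it is `2` for `d = 1` and `d / (d - 2 + (ζ ∧ 2))` for `d ≥ 2`. -/
def pExp (d : ℕ) (ζ : ℝ) : ℝ :=
  if d = 1 then 2 else (d : ℝ) / ((d : ℝ) - 2 + min ζ 2)

/-- The class `𝒬_{M,K,ζ}` of pairs `(Q, g)` of real functions on `ℤ^d`. -/
structure IsClassQ (d : ℕ) (M K ζ : ℝ) (Q g : (Fin d → ℤ) → ℝ) : Prop where
  Q_norm : weightedNorm 0 1 Q ≤ ENNReal.ofReal M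
  Q_moment : weightedNorm (2 + ζ) 1 Q ≤ ENNReal.ofReal M
  infrared : ∀ k ∈ torusCube d, K * ‖k‖ ^ 2 ≤ (latticeFourier Q 0 - latticeFourier Q k).re
  g_norm : weightedNorm 0 1 g ≤ ENNReal.ofReal M
  g_moment : weightedNorm ζ 1 g ≤ ENNReal.ofReal M
  g_second : weightedNorm 2 (min (pExp d ζ) 2) g ≤ ENNReal.ofReal M
  Q_high : 4 ≤ d → weightedNorm ((d : ℝ) - 1) (min ((d : ℝ) / 3) 2) Q ≤ ENNReal.ofReal M
  g_high : 4 ≤ d → weightedNorm ((d : ℝ) - 1) 2 g ≤ ENNReal.ofReal M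

/-- The first moment `η_j = ∑_y y_j Q(y)`. -/
def firstMoment {d : ℕ} (Q : (Fin d → ℤ) → ℝ) : EuclideanSpace ℝ (Fin d) :=
  WithLp.toLp 2 (fun j => ∑' y : Fin d → ℤ, (y j : ℝ) * Q y)

/-- The matrix of second moments `Λ_{jl} = ∑_y y_j y_l Q(y)`. -/
def secondMoment {d : ℕ} (Q : (Fin d → ℤ) → ℝ) : Matrix (Fin d) (Fin d) ℝ :=
  Matrix.of (fun j l => ∑' y : Fin d → ℤ, (y j : ℝ) * (y l : ℝ) * Q y)

/-- The heat kernel `ρ_t(x; η, Λ)` of Brownian motion on `ℝ^d` with drift `η` and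
covariance `Λ`. -/
def heatKernel {d : ℕ} (η : EuclideanSpace ℝ (Fin d)) (Λ : Matrix (Fin d) (Fin d) ℝ)
    (t : ℝ) (x : EuclideanSpace ℝ (Fin d)) : ℝ :=
  (1 / Real.sqrt Λ.det) * (1 / (2 * Real.pi * t) ^ ((d : ℝ) / 2)) *
    Real.exp (-(1 / (2 * t)) * ((x - t • η).ofLp ⬝ᵥ (Λ⁻¹.mulVec (x - t • η).ofLp)))

/-- The Brownian Green function `C(x; η, Λ) = ∫_0^∞ ρ_t(x; η, Λ) dt`. -/
def brownianGreen {d : ℕ} (x η : EuclideanSpace ℝ (Fin d))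
    (Λ : Matrix (Fin d) (Fin d) ℝ) : ℝ :=
  ∫ t in Set.Ioi (0 : ℝ), heatKernel η Λ t x

/-- The inner integral
`I_t(x) = ∫_{𝕋^d} e^{i k·x} ĝ(k) e^{-t [Q̂(0) - Q̂(k)]} dk / (2π)^d`. -/
def torusIntegral {d : ℕ} (Q g : (Fin d → ℤ) → ℝ) (t : ℝ) (x : Fin d → ℤ) : ℂ :=
  ∫ k in torusCube d,
    Complex.exp (Complex.I * ((inner ℝ k (vec x) : ℝ) : ℂ)) * latticeFourier g k *
      Complex.exp (-(t : ℂ) * (latticeFourier Q 0 - latticeFourier Q k)) / ((2 * Real.pi : ℝ) : ℂ) ^ d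

/-- `G_Q(x) = ∫_0^∞ I_t(x) dt`. -/
def latticeGreen {d : ℕ} (Q g : (Fin d → ℤ) → ℝ) (x : Fin d → ℤ) : ℂ :=
  ∫ t in Set.Ioi (0 : ℝ), torusIntegral Q g t x

end GaussianLemma

end

/-!
Write `n = |x|`, `h = |η|`, `I_t` for the inner integral `torusIntegral Q g t x`, `ρ_t` for the heat
kernel and `e_t = |I_t - ĝ(0) ρ_t|`. The theorem says that `∫ e_t dt` is smaller than
`C = ∫ ρ_t dt` by a factor `n^{-ε}`. As `η` points in the direction of `x`, one has
`|x - tη| = |n - t h|`, and the error is controlled by two kinds of bounds.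

* The local limit theorem `e_t ≤ c t^{-d/2 - z/2}` with `z = ζ ∧ 1`
  (`norm_torusIntegral_sub_heatKernel_le`), from the Taylor expansion of `Q̂(0) - Q̂(k)` and `ĝ(k)`
  at `k = 0` and the infrared bound.
* Moment bounds such as `|x - tη|² |I_t| ≤ c t^{1 - d/2}` for `t ≥ 1`, and for `d ≥ 3` also
  `|x - tη|^{d-1} |I_t| ≤ c t^{-1/2}` (`torusIntegral_moment`). They hold without differentiability
  of `Q̂` of the corresponding order, by the argument of Fuk and Nagaev for large deviations of
  heavy-tailed sums, which also works for signed `Q`. Truncate the jumps at a length `R` which is a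
  small multiple of `|x - tη|`. The kernel with truncated jumps may be tilted exponentially
  (`torusCoeff_exp_tilt`), and a tilt of order `log(R / √t) / R` makes it smaller than any power of
  `√t / |x - tη|` (`norm_shortHeat_le`). In the difference of the two kernels a single long jump
  factors out; it is paid for by the moment of `Q`, while the other factor is below a Gaussian in
  Fourier space, so that Hölder's inequality in the form `tsum_mul_le_of_sup_sq` applies
  (`norm_latticeHeat_sub_short_le`, `latticeHeat_moment`).

The weights `1/4` and `3/4` in the geometric mean of the local limit theorem and the second moment
bound give `|n - t h|^{3/2} e_t ≤ c t^{3/4 - d/2 - z/8}`, which gains a power of `t` and still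
decays integrably away from the time `t₀ = n / h` at which the drift reaches `x`; the fluctuations
of that time have size `√t₀ / h`. If `n h ≥ s₀`, this bounds the integral over `t ≥ t₀ / 2` by
`t₀^{-z/8} t₀^{1/2 - d/2} / h` (`late_integral`). Earlier times are treated in the same way for
`d ≤ 2` (`early_integral_low`). For `d ≥ 3`, the moment of order `d - 1` is used up to the time
`n^{2-δ}`, and the local limit theorem thereafter (`early_integral_high`); if `n h ≤ s₀` and
`n` is large, these two already cover all times; here any constant `s₀` will do. In the other
direction, `C` is at least a multiple of `t₀^{1/2 - d/2} / h` if `n h ≥ s₀`, and of `n^{2-d}` if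
`n h ≤ s₀` (`le_brownianGreen`).
-/

namespace GaussianLemma

variable {d : ℕ}

/-! ### Fourier coefficients on the torus -/

/-- The character `k ↦ e^{i k·x}` of the torus attached to the lattice point `x`. -/
noncomputable def latChar (x : Fin d → ℤ) (k : EuclideanSpace ℝ (Fin d)) : ℂ :=
  Complex.exp (Complex.I * ((inner ℝ k (vec x) : ℝ) : ℂ))

/-- The inverse Fourier transform `(2π)^{-d} ∫_{𝕋^d} e^{i k·x} F(k) dk`. -/
noncomputable def torusCoeff (F : EuclideanSpace ℝ (Fin d) → ℂ) (x : Fin d → ℤ) : ℂ :=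
  (∫ k in torusCube d, latChar x k * F k) / ((2 * Real.pi : ℝ) : ℂ) ^ d

lemma vec_add (x y : Fin d → ℤ) : vec (x + y) = vec x + vec y := by
  ext j; simp [vec]

lemma vec_neg (x : Fin d → ℤ) : vec (-x) = -vec x := by
  ext j; simp [vec]

lemma vec_sub (x y : Fin d → ℤ) : vec (x - y) = vec x - vec y := by
  ext j; simp [vec]

lemma vec_zero : vec (0 : Fin d → ℤ) = 0 := by
  ext j; simp [vec]

lemma one_le_norm_vec {x : Fin d → ℤ} (hx : x ≠ 0) : 1 ≤ ‖vec x‖ := by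
  obtain ⟨j, hj⟩ := Function.ne_iff.mp hx
  have h1 : (1 : ℝ) ≤ |(x j : ℝ)| := by exact_mod_cast Int.one_le_abs hj
  have h2 := PiLp.norm_apply_le (vec x) j
  simp only [vec, Real.norm_eq_abs] at h2
  exact h1.trans h2

lemma latChar_add (x y : Fin d → ℤ) (k : EuclideanSpace ℝ (Fin d)) :
    latChar (x + y) k = latChar x k * latChar y k := by
  simp only [latChar, vec_add, inner_add_right, Complex.ofReal_add, mul_add, Complex.exp_add]

lemma norm_latChar (x : Fin d → ℤ) (k : EuclideanSpace ℝ (Fin d)) : ‖latChar x k‖ = 1 := by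
  rw [latChar, mul_comm, Complex.norm_exp_ofReal_mul_I]

lemma continuous_latChar (x : Fin d → ℤ) : Continuous (latChar x) := by
  unfold latChar; fun_prop

lemma conj_latChar (x : Fin d → ℤ) (k : EuclideanSpace ℝ (Fin d)) :
    (starRingEnd ℂ) (latChar x k) = latChar (-x) k := by
  simp [latChar, ← Complex.exp_conj, vec_neg]

lemma latticeFourier_eq (f : (Fin d → ℤ) → ℝ) (k : EuclideanSpace ℝ (Fin d)) :
    latticeFourier f k = ∑' y, (f y : ℂ) * latChar (-y) k := by
  simp [latticeFourier, latChar, vec_neg]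

lemma torusCube_eq_preimage :
    torusCube d = WithLp.ofLp ⁻¹' (Set.univ.pi fun _ : Fin d => Set.Icc (-Real.pi) Real.pi) := by
  ext k; simp [torusCube, Pi.le_def, forall_and]

lemma measurableSet_torusCube : MeasurableSet (torusCube d) := by
  rw [torusCube_eq_preimage]
  exact (PiLp.volume_preserving_ofLp (Fin d)).measurable
    (MeasurableSet.univ_pi fun _ => measurableSet_Icc)

lemma volume_torusCube : volume (torusCube d) = ENNReal.ofReal ((2 * Real.pi) ^ d) := by
  rw [torusCube_eq_preimage, (PiLp.volume_preserving_ofLp (Fin d)).measure_preimage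
    (MeasurableSet.univ_pi fun _ => measurableSet_Icc).nullMeasurableSet, volume_pi_pi]
  simp only [Real.volume_Icc, Finset.prod_const, Finset.card_univ, Fintype.card_fin]
  rw [← ENNReal.ofReal_pow (by linarith [Real.pi_pos])]
  congr 2; ring

instance isFiniteMeasure_torusCube :
    IsFiniteMeasure ((volume : Measure (EuclideanSpace ℝ (Fin d))).restrict (torusCube d)) :=
  ⟨by rw [Measure.restrict_apply_univ, volume_torusCube]; exact ENNReal.ofReal_lt_top⟩

lemma mem_torusCube_of_norm_le {k : EuclideanSpace ℝ (Fin d)} (hk : ‖k‖ ≤ Real.pi) :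
    k ∈ torusCube d := fun j =>
  abs_le.mp ((Real.norm_eq_abs _ ▸ PiLp.norm_apply_le k j).trans hk)

lemma integral_exp_int (n : ℤ) :
    ∫ s in Set.Icc (-Real.pi) Real.pi, Complex.exp (Complex.I * ((s * n : ℝ) : ℂ)) =
      if n = 0 then ((2 * Real.pi : ℝ) : ℂ) else 0 := by
  rw [integral_Icc_eq_integral_Ioc, ← intervalIntegral.integral_of_le (by linarith [Real.pi_pos])]
  split_ifs with hn
  · simp only [hn, Int.cast_zero, mul_zero, Complex.ofReal_zero, Complex.exp_zero,
      intervalIntegral.integral_const, Complex.real_smul, mul_one]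
    congr 1; ring
  · have hc : (Complex.I * n : ℂ) ≠ 0 := mul_ne_zero Complex.I_ne_zero (by exact_mod_cast hn)
    have h1 : ∀ s : ℝ, Complex.exp (Complex.I * ((s * n : ℝ) : ℂ)) =
        Complex.exp (Complex.I * n * s) := fun s => by push_cast; ring_nf
    simp only [h1]
    rw [integral_exp_mul_complex hc, div_eq_zero_iff]
    left
    rw [sub_eq_zero, Complex.exp_eq_exp_iff_exists_int]
    exact ⟨n, by push_cast; ring⟩

lemma integral_latChar (x : Fin d → ℤ) :
    ∫ k in torusCube d, latChar x k = if x = 0 then ((2 * Real.pi : ℝ) : ℂ) ^ d else 0 := by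
  have h1 : ∀ k : EuclideanSpace ℝ (Fin d), latChar x k =
      (fun p : Fin d → ℝ => ∏ j, Complex.exp (Complex.I * ((p j * x j : ℝ) : ℂ))) k.ofLp := by
    intro k
    simp only [latChar, ← Complex.exp_sum, ← Finset.mul_sum, ← Complex.ofReal_sum]
    congr 3
    simp [vec, PiLp.inner_apply, mul_comm]
  simp only [h1]
  rw [torusCube_eq_preimage,
    (PiLp.volume_preserving_ofLp (Fin d)).setIntegral_preimage_emb
      (MeasurableEquiv.toLp 2 (Fin d → ℝ)).symm.measurableEmbedding
      (fun p : Fin d → ℝ => ∏ j, Complex.exp (Complex.I * ((p j * x j : ℝ) : ℂ)))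
      (Set.univ.pi fun _ : Fin d => Set.Icc (-Real.pi) Real.pi),
    volume_pi, Measure.restrict_pi_pi,
    integral_fintype_prod_eq_prod (fun j (s : ℝ) => Complex.exp (Complex.I * ((s * x j : ℝ) : ℂ)))]
  simp only [integral_exp_int]
  split_ifs with h
  · simp [h]
  · obtain ⟨j, hj⟩ := Function.ne_iff.mp h
    exact Finset.prod_eq_zero (Finset.mem_univ j) (if_neg hj)

lemma torusCoeff_one (x : Fin d → ℤ) :
    torusCoeff (fun _ => 1) x = if x = 0 then 1 else 0 := by
  simp only [torusCoeff, mul_one, integral_latChar]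
  split_ifs
  · refine div_self (pow_ne_zero _ ?_)
    exact_mod_cast (by positivity : (2 * Real.pi : ℝ) ≠ 0)
  · simp

lemma one_le_two_pi_pow : (1 : ℝ) ≤ ((2 * Real.pi) ^ d) :=
  one_le_pow₀ (by linarith [Real.pi_gt_three])

lemma norm_two_pi_pow : ‖((2 * Real.pi : ℝ) : ℂ) ^ d‖ = (2 * Real.pi) ^ d := by
  rw [norm_pow, Complex.norm_real, Real.norm_of_nonneg (by positivity)]

lemma norm_torusCoeff_le (F : EuclideanSpace ℝ (Fin d) → ℂ) (x : Fin d → ℤ) :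
    ‖torusCoeff F x‖ ≤ ∫ k in torusCube d, ‖F k‖ := by
  rw [torusCoeff, norm_div, norm_two_pi_pow]
  refine (div_le_self (norm_nonneg _) one_le_two_pi_pow).trans ?_
  refine (norm_integral_le_integral_norm _).trans_eq ?_
  simp [norm_latChar]

lemma integrableOn_of_norm_le {F : EuclideanSpace ℝ (Fin d) → ℂ} (hF : Measurable F) {B : ℝ}
    (hB : ∀ k ∈ torusCube d, ‖F k‖ ≤ B) : IntegrableOn F (torusCube d) :=
  Measure.integrableOn_of_bounded
    (by rw [volume_torusCube]; exact ENNReal.ofReal_ne_top) hF.aestronglyMeasurable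
    ((ae_restrict_iff' measurableSet_torusCube).mpr (Filter.Eventually.of_forall hB))

/-- Bessel's inequality for the characters of the torus. -/
lemma bessel {F : EuclideanSpace ℝ (Fin d) → ℂ} (hF : Measurable F) {B : ℝ}
    (hB : ∀ k ∈ torusCube d, ‖F k‖ ≤ B) :
    Summable (fun x => ‖torusCoeff F x‖ ^ 2) ∧
      ∑' x, ‖torusCoeff F x‖ ^ 2 ≤ ∫ k in torusCube d, ‖F k‖ ^ 2 := by
  set μ := (volume : Measure (EuclideanSpace ℝ (Fin d))).restrict (torusCube d) with hμ
  set c : ℝ := (Real.sqrt ((2 * Real.pi) ^ d))⁻¹ with hc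
  have hpos : (0 : ℝ) < (2 * Real.pi) ^ d := by positivity
  have hc2 : c ^ 2 * (2 * Real.pi) ^ d = 1 := by
    rw [hc, inv_pow, Real.sq_sqrt hpos.le, inv_mul_cancel₀ hpos.ne']
  have hmem : ∀ x : Fin d → ℤ, MemLp (fun k => (c : ℂ) * latChar (-x) k) 2 μ := fun x =>
    MemLp.of_bound (by have := continuous_latChar (-x); fun_prop) |c|
      (Filter.Eventually.of_forall fun k => by simp [norm_latChar])
  have hFm : MemLp F 2 μ := MemLp.of_bound hF.aestronglyMeasurable B
    ((ae_restrict_iff' measurableSet_torusCube).mpr (Filter.Eventually.of_forall hB))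
  have hin : ∀ x, ∀ {G : EuclideanSpace ℝ (Fin d) → ℂ} (hG : MemLp G 2 μ),
      inner ℂ ((hmem x).toLp _) (hG.toLp G) = (c : ℂ) * ∫ k, latChar x k * G k ∂μ := by
    intro x G hG
    rw [L2.inner_def, ← integral_const_mul]
    refine integral_congr_ae ?_
    filter_upwards [(hmem x).coeFn_toLp, hG.coeFn_toLp] with k h1 h2
    rw [h1, h2]
    simp only [RCLike.inner_apply, map_mul, Complex.conj_ofReal, conj_latChar, neg_neg]
    ring
  have hcC : (c : ℂ) ^ 2 * ((2 * Real.pi : ℝ) : ℂ) ^ d = 1 := by exact_mod_cast hc2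
  have horth : Orthonormal ℂ (fun x => (hmem x).toLp _) := by
    rw [orthonormal_iff_ite]
    intro x y
    rw [hin x (hmem y)]
    have h1 : ∀ k, latChar x k * ((c : ℂ) * latChar (-y) k) = c * latChar (x - y) k := by
      intro k; rw [sub_eq_add_neg, latChar_add]; ring
    simp only [h1]
    rw [integral_const_mul, integral_latChar]
    simp only [sub_eq_zero]
    split_ifs
    · linear_combination hcC
    · simp
  have hcoef : ∀ x, ‖torusCoeff F x‖ ^ 2 ≤
      ‖inner ℂ ((hmem x).toLp _) (hFm.toLp F)‖ ^ 2 := by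
    intro x
    rw [hin x hFm, torusCoeff, norm_div, norm_mul, norm_two_pi_pow, Complex.norm_real,
      div_pow, mul_pow ‖c‖, Real.norm_eq_abs, sq_abs, div_le_iff₀ (by positivity)]
    have h2 : c ^ 2 * ((2 * Real.pi) ^ d) ^ 2 = (2 * Real.pi) ^ d := by
      linear_combination ((2 * Real.pi) ^ d) * hc2
    have h3 := one_le_two_pi_pow (d := d)
    calc _ ≤ ‖∫ k in torusCube d, latChar x k * F k‖ ^ 2 * (2 * Real.pi) ^ d :=
          le_mul_of_one_le_right (by positivity) h3
      _ = ‖∫ k in torusCube d, latChar x k * F k‖ ^ 2 *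
            (c ^ 2 * ((2 * Real.pi) ^ d) ^ 2) := by rw [h2]
      _ = _ := by rw [hμ]; ring
  have hs := horth.inner_products_summable (hFm.toLp F)
  have hsum : Summable (fun x => ‖torusCoeff F x‖ ^ 2) :=
    Summable.of_nonneg_of_le (fun _ => by positivity) hcoef hs
  refine ⟨hsum, (hsum.tsum_le_tsum hcoef hs).trans ((horth.tsum_inner_products_le _).trans_eq ?_)⟩
  have h5 : ((‖hFm.toLp F‖ ^ 2 : ℝ) : ℂ) = ((∫ k in torusCube d, ‖F k‖ ^ 2 : ℝ) : ℂ) := by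
    have := inner_self_eq_norm_sq_to_K (𝕜 := ℂ) (hFm.toLp F)
    rw [Complex.ofReal_pow]
    refine Eq.trans this.symm ?_
    rw [L2.inner_def, ← integral_complex_ofReal]
    refine integral_congr_ae ?_
    filter_upwards [hFm.coeFn_toLp] with k h1
    rw [h1, inner_self_eq_norm_sq_to_K]; simp
  exact_mod_cast h5

lemma norm_term_eq (f : (Fin d → ℤ) → ℝ) (y x : Fin d → ℤ) (k : EuclideanSpace ℝ (Fin d)) :
    ‖(f y : ℂ) * latChar x k‖ = |f y| := by
  rw [norm_mul, norm_latChar, mul_one, Complex.norm_real, Real.norm_eq_abs]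

lemma summable_latticeFourier {f : (Fin d → ℤ) → ℝ} (hf : Summable fun y => |f y|)
    (k : EuclideanSpace ℝ (Fin d)) : Summable fun y => (f y : ℂ) * latChar (-y) k :=
  Summable.of_norm (by simpa only [norm_term_eq] using hf)

lemma norm_latticeFourier_le {f : (Fin d → ℤ) → ℝ} (hf : Summable fun y => |f y|)
    (k : EuclideanSpace ℝ (Fin d)) : ‖latticeFourier f k‖ ≤ ∑' y, |f y| := by
  rw [latticeFourier_eq]
  exact tsum_of_norm_bounded hf.hasSum fun y => (norm_term_eq f y (-y) k).le

lemma continuous_latticeFourier {f : (Fin d → ℤ) → ℝ} (hf : Summable fun y => |f y|) :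
    Continuous (latticeFourier f) := by
  have : latticeFourier f = fun k => ∑' y, (f y : ℂ) * latChar (-y) k :=
    funext fun k => latticeFourier_eq f k
  rw [this]
  exact continuous_tsum (fun y => continuous_const.mul (continuous_latChar _)) hf
    fun y k => (norm_term_eq f y (-y) k).le

/-- Multiplication by `f̂` on the torus is convolution with `f` on the lattice. -/
lemma hasSum_torusCoeff_mul {f : (Fin d → ℤ) → ℝ} (hf : Summable fun y => |f y|)
    {F : EuclideanSpace ℝ (Fin d) → ℂ} (hF : IntegrableOn F (torusCube d)) (x : Fin d → ℤ) :
    HasSum (fun y => (f y : ℂ) * torusCoeff F (x - y))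
      (torusCoeff (fun k => latticeFourier f k * F k) x) := by
  have hint : ∀ z, IntegrableOn (fun k => latChar z k * F k) (torusCube d) := fun z =>
    hF.bdd_mul (c := 1) (continuous_latChar z).aestronglyMeasurable
      (Filter.Eventually.of_forall fun k => (norm_latChar z k).le)
  have key := hasSum_integral_of_summable_integral_norm
    (μ := volume.restrict (torusCube d))
    (F := fun y k => (f y : ℂ) * (latChar (x - y) k * F k))
    (fun y => (hint _).const_mul _) (by
      simp only [norm_mul, norm_latChar, one_mul, Complex.norm_real, Real.norm_eq_abs,
        integral_const_mul]
      exact hf.mul_right _)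
  have h1 : ∀ k, ∑' y, (f y : ℂ) * (latChar (x - y) k * F k) =
      latChar x k * (latticeFourier f k * F k) := by
    intro k
    rw [latticeFourier_eq, ← tsum_mul_right, ← tsum_mul_left]
    refine tsum_congr fun y => ?_
    rw [sub_eq_add_neg, latChar_add]; ring
  simp only [h1, integral_const_mul] at key
  have := key.div_const (((2 * Real.pi : ℝ) : ℂ) ^ d)
  simpa only [torusCoeff, mul_div_assoc] using this

/-- Exponential tilting commutes with convolution powers. -/
lemma torusCoeff_pow_tilt {a : (Fin d → ℤ) → ℝ} (ha : Summable fun y => |a y|)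
    (θ : EuclideanSpace ℝ (Fin d))
    (hb : Summable fun y => |Real.exp (inner ℝ θ (vec y)) * a y|) (n : ℕ) (x : Fin d → ℤ) :
    torusCoeff (fun k => latticeFourier (fun y => Real.exp (inner ℝ θ (vec y)) * a y) k ^ n) x =
      Real.exp (inner ℝ θ (vec x)) * torusCoeff (fun k => latticeFourier a k ^ n) x := by
  induction n generalizing x with
  | zero =>
    simp only [pow_zero, torusCoeff_one]
    split_ifs with h
    · simp [h, vec_zero]
    · simp
  | succ n ih =>
    have hint : ∀ {f : (Fin d → ℤ) → ℝ}, (Summable fun y => |f y|) →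
        IntegrableOn (fun k => latticeFourier f k ^ n) (torusCube d) := fun {f} hf =>
      integrableOn_of_norm_le ((continuous_latticeFourier hf).pow n).measurable
        (B := (∑' y, |f y|) ^ n) fun k _ => by
          rw [norm_pow]; exact pow_le_pow_left₀ (norm_nonneg _) (norm_latticeFourier_le hf k) n
    simp only [pow_succ']
    rw [← (hasSum_torusCoeff_mul hb (hint hb) x).tsum_eq,
      ← (hasSum_torusCoeff_mul ha (hint ha) x).tsum_eq, ← tsum_mul_left]
    refine tsum_congr fun y => ?_
    rw [ih, vec_sub, inner_sub_right, Real.exp_sub]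
    push_cast
    have : (Complex.exp (inner ℝ θ (vec y) : ℝ)) ≠ 0 := Complex.exp_ne_zero _
    field_simp

lemma hasSum_torusCoeff_exp {f : (Fin d → ℤ) → ℝ} (hf : Summable fun y => |f y|) (t : ℝ)
    (x : Fin d → ℤ) :
    HasSum (fun n : ℕ => (t : ℂ) ^ n / n.factorial * torusCoeff (fun k => latticeFourier f k ^ n) x)
      (torusCoeff (fun k => Complex.exp (t * latticeFourier f k)) x) := by
  have hc := continuous_latticeFourier hf
  set S := ∑' y, |f y|
  have hb : ∀ n k, ‖latChar x k * latticeFourier f k ^ n‖ ≤ S ^ n := fun n k => by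
    rw [norm_mul, norm_latChar, one_mul, norm_pow]
    exact pow_le_pow_left₀ (norm_nonneg _) (norm_latticeFourier_le hf k) n
  have hint : ∀ n, IntegrableOn (fun k => latChar x k * latticeFourier f k ^ n) (torusCube d) :=
    fun n => integrableOn_of_norm_le ((continuous_latChar x).mul (hc.pow n)).measurable
      fun k _ => hb n k
  have key := hasSum_integral_of_summable_integral_norm
    (μ := volume.restrict (torusCube d))
    (F := fun (n : ℕ) k => (t : ℂ) ^ n / n.factorial * (latChar x k * latticeFourier f k ^ n))
    (fun n => (hint n).const_mul _) (by
      refine Summable.of_nonneg_of_le (fun n => integral_nonneg fun k => norm_nonneg _) (fun n => ?_)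
        ((Real.summable_pow_div_factorial (|t| * S)).mul_left ((2 * Real.pi) ^ d))
      simp only [norm_mul _ (latChar x _ * _)]
      rw [integral_const_mul]
      have h1 : ∫ k in torusCube d, ‖latChar x k * latticeFourier f k ^ n‖ ≤
          (2 * Real.pi) ^ d * S ^ n := by
        refine (integral_mono_of_nonneg (Filter.Eventually.of_forall fun k => norm_nonneg _)
          (integrable_const (S ^ n)) (Filter.Eventually.of_forall fun k => hb n k)).trans_eq ?_
        rw [integral_const, smul_eq_mul, measureReal_restrict_apply_univ, Measure.real,
          volume_torusCube, ENNReal.toReal_ofReal (by positivity)]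
      have h2 : ‖(t : ℂ) ^ n / n.factorial‖ = |t| ^ n / n.factorial := by simp
      rw [h2, mul_pow]
      calc _ ≤ |t| ^ n / n.factorial * ((2 * Real.pi) ^ d * S ^ n) := by gcongr
        _ = _ := by ring)
  have h1 : ∀ k, ∑' n : ℕ, (t : ℂ) ^ n / n.factorial * (latChar x k * latticeFourier f k ^ n) =
      latChar x k * Complex.exp (t * latticeFourier f k) := by
    intro k
    rw [Complex.exp_eq_exp_ℂ, NormedSpace.exp_eq_tsum_div, ← tsum_mul_left]
    refine tsum_congr fun n => ?_
    rw [mul_pow]; ring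
  simp only [h1, integral_const_mul] at key
  have := key.div_const (((2 * Real.pi : ℝ) : ℂ) ^ d)
  simpa only [torusCoeff, mul_div_assoc] using this

/-- The kernel with Fourier transform `exp (t â)` and the one with `a` replaced by its exponential
tilt `e^{θ·y} a(y)` differ by the factor `e^{θ·x}`. This replaces a shift of the contour of
integration to `k + iθ`. -/
lemma torusCoeff_exp_tilt {a : (Fin d → ℤ) → ℝ} (ha : Summable fun y => |a y|)
    (θ : EuclideanSpace ℝ (Fin d))
    (hb : Summable fun y => |Real.exp (inner ℝ θ (vec y)) * a y|) (t : ℝ) (x : Fin d → ℤ) :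
    torusCoeff (fun k => Complex.exp
        (t * latticeFourier (fun y => Real.exp (inner ℝ θ (vec y)) * a y) k)) x =
      Real.exp (inner ℝ θ (vec x)) *
        torusCoeff (fun k => Complex.exp (t * latticeFourier a k)) x := by
  rw [← (hasSum_torusCoeff_exp hb t x).tsum_eq, ← (hasSum_torusCoeff_exp ha t x).tsum_eq,
    ← tsum_mul_left]
  refine tsum_congr fun n => ?_
  rw [torusCoeff_pow_tilt ha θ hb]; ring

/-! ### Weighted summability on the lattice -/

/-- `‖ |y|^a f(y) ‖_p ≤ M`, in terms of real-valued sums. -/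
def LpBound (a p M : ℝ) (f : (Fin d → ℤ) → ℝ) : Prop :=
  Summable (fun y => (‖vec y‖ ^ a * |f y|) ^ p) ∧ ∑' y, (‖vec y‖ ^ a * |f y|) ^ p ≤ M ^ p

/-- `‖ |y|^a f(y) ‖_1 ≤ M`, in terms of real-valued sums. -/
def MomBound (a M : ℝ) (f : (Fin d → ℤ) → ℝ) : Prop :=
  Summable (fun y => ‖vec y‖ ^ a * |f y|) ∧ ∑' y, ‖vec y‖ ^ a * |f y| ≤ M

lemma lpBound_of_weightedNorm {a p M : ℝ} (hp : 0 < p) (hM : 0 ≤ M) {f : (Fin d → ℤ) → ℝ}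
    (h : weightedNorm a p f ≤ ENNReal.ofReal M) : LpBound a p M f := by
  unfold weightedNorm at h
  rw [eLpNorm_eq_lintegral_rpow_enorm_toReal (by simpa using hp) ENNReal.ofReal_ne_top,
    ENNReal.toReal_ofReal hp.le, one_div, ENNReal.rpow_inv_le_iff hp, lintegral_count,
    ENNReal.ofReal_rpow_of_nonneg hM hp.le] at h
  have h1 : ∀ y : Fin d → ℤ, ‖‖vec y‖ ^ a * f y‖ₑ ^ p =
      ENNReal.ofReal ((‖vec y‖ ^ a * |f y|) ^ p) := by
    intro y
    rw [← ENNReal.ofReal_rpow_of_nonneg (by positivity) hp.le, ← ofReal_norm, norm_mul,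
      Real.norm_of_nonneg (by positivity : 0 ≤ ‖vec y‖ ^ a), Real.norm_eq_abs]
  simp only [h1] at h
  have hs : Summable (fun y => (‖vec y‖ ^ a * |f y|) ^ p) := by
    refine (ENNReal.summable_toReal (h.trans_lt ENNReal.ofReal_lt_top).ne).congr fun y => ?_
    exact ENNReal.toReal_ofReal (by positivity)
  refine ⟨hs, ?_⟩
  rw [← ENNReal.ofReal_tsum_of_nonneg (fun y => by positivity) hs] at h
  exact (ENNReal.ofReal_le_ofReal_iff (by positivity)).mp h

lemma LpBound.momBound {a M : ℝ} {f : (Fin d → ℤ) → ℝ} (h : LpBound a 1 M f) :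
    MomBound a M f := by
  simpa [LpBound, MomBound] using h

lemma MomBound.lpBound {a M : ℝ} {f : (Fin d → ℤ) → ℝ} (h : MomBound a M f) :
    LpBound a 1 M f := by
  simpa [LpBound, MomBound] using h

lemma MomBound.tsum_le {E : Type*} [NormedAddCommGroup E] [CompleteSpace E] {a M C : ℝ}
    {f : (Fin d → ℤ) → ℝ} (h : MomBound a M f) (hC : 0 ≤ C) {G : (Fin d → ℤ) → E}
    (hG : ∀ y, ‖G y‖ ≤ C * (‖vec y‖ ^ a * |f y|)) : Summable G ∧ ‖∑' y, G y‖ ≤ C * M := by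
  refine ⟨Summable.of_norm_bounded (h.1.mul_left C) hG, ?_⟩
  refine (tsum_of_norm_bounded (h.1.mul_left C).hasSum hG).trans ?_
  rw [tsum_mul_left]
  exact mul_le_mul_of_nonneg_left h.2 hC

/-- Nonzero lattice points have norm at least one, so a moment of higher order controls every
moment of lower positive order. -/
lemma norm_vec_rpow_le {a b : ℝ} (ha : 0 < a) (hab : a ≤ b) (y : Fin d → ℤ) :
    ‖vec y‖ ^ a ≤ ‖vec y‖ ^ b := by
  rcases eq_or_ne y 0 with rfl | hy
  · simp [vec_zero, Real.zero_rpow ha.ne', Real.zero_rpow (ha.trans_le hab).ne']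
  · exact Real.rpow_le_rpow_of_exponent_le (one_le_norm_vec hy) hab

lemma MomBound.mono {a b M : ℝ} {f : (Fin d → ℤ) → ℝ} (ha : 0 < a) (hab : a ≤ b)
    (h : MomBound b M f) : MomBound a M f := by
  have h1 : ∀ y, ‖vec y‖ ^ a * |f y| ≤ ‖vec y‖ ^ b * |f y| := fun y =>
    mul_le_mul_of_nonneg_right (norm_vec_rpow_le ha hab y) (abs_nonneg _)
  have hs : Summable (fun y => ‖vec y‖ ^ a * |f y|) :=
    Summable.of_nonneg_of_le (fun y => by positivity) h1 h.1
  exact ⟨hs, (hs.tsum_le_tsum h1 h.1).trans h.2⟩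

lemma MomBound.summable_abs {M : ℝ} {f : (Fin d → ℤ) → ℝ} (h : MomBound 0 M f) :
    Summable fun y => |f y| := by simpa using h.1

lemma MomBound.tsum_abs_le {M : ℝ} {f : (Fin d → ℤ) → ℝ} (h : MomBound 0 M f) :
    ∑' y, |f y| ≤ M := by simpa using h.2

/-- A form of Hölder's inequality for `1 ≤ p ≤ 2`: here `w` is bounded by `B β` and has
`ℓ²` norm at most `B β^{1/2}`, so that its `ℓ^{p'}` norm is at most `B β^{1/p}`. -/
lemma tsum_mul_le_of_sup_sq {ι : Type*} {f w : ι → ℝ} {p M B β : ℝ} (hp1 : 1 ≤ p) (hp2 : p ≤ 2)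
    (hM : 0 < M) (hB : 0 < B) (hβ : 0 < β) (hf : ∀ i, 0 ≤ f i) (hw : ∀ i, 0 ≤ w i)
    (hfs : Summable fun i => f i ^ p) (hfM : ∑' i, f i ^ p ≤ M ^ p)
    (hwB : ∀ i, w i ≤ B * β) (hws : Summable fun i => w i ^ 2) (hw2 : ∑' i, w i ^ 2 ≤ B ^ 2 * β) :
    Summable (fun i => f i * w i) ∧ ∑' i, f i * w i ≤ 3 * M * B * β ^ (1 / p) := by
  have hp0 : 0 < p := by linarith
  set q := β ^ (1 / p) with hq
  have hqpos : 0 < q := Real.rpow_pos_of_pos hβ _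
  have hqp : q ^ p = β := by
    rw [hq, ← Real.rpow_mul hβ.le, one_div_mul_cancel hp0.ne', Real.rpow_one]
  set l := M * q with hl
  have hlpos : 0 < l := by positivity
  set m := B / M * (β / q) with hm
  have hmpos : 0 < m := by positivity
  have hlp : ∀ r, l ^ (r - p) = l ^ r / (M ^ p * β) := fun r => by
    have h1 : l ^ p = M ^ p * β := by rw [hl, Real.mul_rpow hM.le hqpos.le, hqp]
    rw [Real.rpow_sub hlpos, h1]
  -- The threshold `l` separates the large values of `f`, where `w` is bounded uniformly, from the
  -- small ones, where the inequality `2 a b ≤ m a² + b² / m` is used.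
  have key : ∀ i, f i * w i ≤ (B * q / M ^ p * M + m * (l ^ 2 / (M ^ p * β))) * f i ^ p
      + 1 / m * w i ^ 2 := by
    intro i
    have hfp : 0 ≤ f i ^ p := Real.rpow_nonneg (hf i) p
    rcases le_or_gt l (f i) with h | h
    · have hfi : 0 < f i := hlpos.trans_le h
      have h1 : f i ≤ f i ^ p * l ^ (1 - p) := by
        have : f i ^ (1 - p) ≤ l ^ (1 - p) :=
          Real.rpow_le_rpow_of_nonpos hlpos h (by linarith)
        calc f i = f i ^ p * f i ^ (1 - p) := by rw [← Real.rpow_add hfi]; simp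
          _ ≤ _ := by gcongr
      have h2 : f i * w i ≤ (f i ^ p * l ^ (1 - p)) * (B * β) :=
        mul_le_mul h1 (hwB i) (hw i) (by positivity)
      have h3 : (f i ^ p * l ^ (1 - p)) * (B * β) = B * q / M ^ p * M * f i ^ p := by
        rw [hlp, Real.rpow_one, hl]
        have : M ^ p ≠ 0 := (Real.rpow_pos_of_pos hM p).ne'
        field_simp
      have h4 : 0 ≤ m * (l ^ 2 / (M ^ p * β)) * f i ^ p := by positivity
      have h5 : 0 ≤ 1 / m * w i ^ 2 := by positivity
      linarith
    · have h1 : f i ^ 2 ≤ f i ^ p * l ^ (2 - p) := by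
        rcases (hf i).eq_or_lt with h0 | h0
        · rw [← h0, Real.zero_rpow hp0.ne']; simp
        · have : f i ^ (2 - p) ≤ l ^ (2 - p) :=
            Real.rpow_le_rpow (hf i) h.le (by linarith)
          calc f i ^ 2 = f i ^ p * f i ^ (2 - p) := by
                rw [← Real.rpow_add h0, ← Real.rpow_natCast]; congr 1; push_cast; ring
            _ ≤ _ := by gcongr
      rw [hlp, show l ^ (2 : ℝ) = l ^ 2 by exact_mod_cast Real.rpow_natCast l 2] at h1
      have h2 : f i * w i ≤ m * f i ^ 2 + 1 / m * w i ^ 2 := by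
        have h6 : m * f i ^ 2 + 1 / m * w i ^ 2 - 2 * (f i * w i) = (m * f i - w i) ^ 2 / m := by
          field_simp; ring
        have h7 : 0 ≤ (m * f i - w i) ^ 2 / m := by positivity
        have h8 : 0 ≤ f i * w i := mul_nonneg (hf i) (hw i)
        linarith
      have h3 := mul_le_mul_of_nonneg_left h1 hmpos.le
      have h4 : 0 ≤ B * q / M ^ p * M * f i ^ p := by positivity
      nlinarith
  have hs2 := (hfs.mul_left (B * q / M ^ p * M + m * (l ^ 2 / (M ^ p * β)))).add
    (hws.mul_left (1 / m))
  have hs := Summable.of_nonneg_of_le (fun i => mul_nonneg (hf i) (hw i)) key hs2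
  refine ⟨hs, (hs.tsum_le_tsum key hs2).trans ?_⟩
  rw [(hfs.mul_left _).tsum_add (hws.mul_left _), tsum_mul_left, tsum_mul_left]
  have hMp : 0 < M ^ p := Real.rpow_pos_of_pos hM p
  calc _ ≤ (B * q / M ^ p * M + m * (l ^ 2 / (M ^ p * β))) * M ^ p + 1 / m * (B ^ 2 * β) := by
        gcongr
    _ = 3 * M * B * q := by rw [hm, hl]; field_simp; ring

/-! ### Gaussian integrals -/

lemma integrable_gaussian {b : ℝ} (hb : 0 < b) :
    Integrable fun k : EuclideanSpace ℝ (Fin d) => Real.exp (-b * ‖k‖ ^ 2) := by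
  have := (GaussianFourier.integrable_cexp_neg_mul_sq_norm_add (b := (b : ℂ)) (by simpa using hb) 0
    (0 : EuclideanSpace ℝ (Fin d))).norm
  refine this.congr (Filter.Eventually.of_forall fun k => ?_)
  simp only [Complex.norm_exp]
  congr 1
  simp [← Complex.ofReal_pow, ← Complex.ofReal_mul]

lemma integral_gaussian_scaled {a t : ℝ} (ha : 0 < a) (ht : 0 < t) :
    ∫ k : EuclideanSpace ℝ (Fin d), Real.exp (-(a * t) * ‖k‖ ^ 2) =
      (Real.pi / a) ^ ((d : ℝ) / 2) * t ^ (-((d : ℝ) / 2)) := by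
  rw [GaussianFourier.integral_rexp_neg_mul_sq_norm (by positivity), finrank_euclideanSpace_fin,
    Real.rpow_neg ht.le, ← div_div, Real.div_rpow (by positivity) ht.le, div_eq_mul_inv]

/-- On the torus the Gaussian integral is also bounded for small `t`. -/
lemma setIntegral_gaussian_le (d : ℕ) {a : ℝ} (ha : 0 < a) :
    ∃ c > 0, ∀ t > 0, ∫ k in torusCube d, Real.exp (-(a * t) * ‖k‖ ^ 2) ≤
      c * max t 1 ^ (-((d : ℝ) / 2)) := by
  refine ⟨(Real.pi / a) ^ ((d : ℝ) / 2) + (2 * Real.pi) ^ d, by positivity, fun t ht => ?_⟩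
  rcases le_total 1 t with h | h
  · rw [max_eq_left h]
    have h1 : ∫ k in torusCube d, Real.exp (-(a * t) * ‖k‖ ^ 2) ≤
        (Real.pi / a) ^ ((d : ℝ) / 2) * t ^ (-((d : ℝ) / 2)) := by
      rw [← integral_gaussian_scaled ha ht]
      exact setIntegral_le_integral (integrable_gaussian (by positivity))
        (Filter.Eventually.of_forall fun k => (Real.exp_pos _).le)
    refine h1.trans ?_
    gcongr
    linarith [(by positivity : 0 ≤ (2 * Real.pi) ^ d)]
  · rw [max_eq_right h, Real.one_rpow, mul_one]
    have h1 : ∫ k in torusCube d, Real.exp (-(a * t) * ‖k‖ ^ 2) ≤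
        ∫ _k in torusCube d, (1 : ℝ) := by
      refine integral_mono_of_nonneg (Filter.Eventually.of_forall fun k => (Real.exp_pos _).le)
        (integrable_const _) (Filter.Eventually.of_forall fun k => ?_)
      rw [Real.exp_le_one_iff]
      nlinarith [mul_pos ha ht, sq_nonneg ‖k‖]
    have h2 : ∫ _k in torusCube d, (1 : ℝ) = (2 * Real.pi) ^ d := by
      rw [integral_const, smul_eq_mul, mul_one, measureReal_restrict_apply_univ, Measure.real,
        volume_torusCube, ENNReal.toReal_ofReal (by positivity)]
    have h3 : 0 ≤ (Real.pi / a) ^ ((d : ℝ) / 2) := by positivity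
    linarith

/-! ### The lattice heat kernel and its tilted truncations -/

/-- The properties of `Q` on which the estimates rest: bounds on the moments of order `0`, `1`, `2`
and `2 + z`, where `0 < z ≤ 1`, and the infrared bound. -/
structure IsCore (M K z : ℝ) (Q : (Fin d → ℤ) → ℝ) : Prop where
  z_pos : 0 < z
  z_le : z ≤ 1
  mom_zero : MomBound 0 M Q
  mom_one : MomBound 1 M Q
  mom_two : MomBound 2 M Q
  mom_high : MomBound (2 + z) M Q
  infrared : ∀ k ∈ torusCube d, K * ‖k‖ ^ 2 ≤ (latticeFourier Q 0 - latticeFourier Q k).re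

/-- The Fourier transform `exp (-t (Q̂(0) - Q̂(k)))` of the lattice heat kernel. -/
noncomputable def heatSymbol (Q : (Fin d → ℤ) → ℝ) (t : ℝ) (k : EuclideanSpace ℝ (Fin d)) : ℂ :=
  Complex.exp (-(t : ℂ) * (latticeFourier Q 0 - latticeFourier Q k))

/-- The lattice heat kernel: the signed continuous-time walk with jump rates `Q` at time `t`. -/
noncomputable def latticeHeat (Q : (Fin d → ℤ) → ℝ) (t : ℝ) (x : Fin d → ℤ) : ℂ :=
  torusCoeff (heatSymbol Q t) x

/-- The restriction of `Q` to jumps of length at most `R`. -/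
noncomputable def shortJumps (R : ℝ) (Q : (Fin d → ℤ) → ℝ) (y : Fin d → ℤ) : ℝ :=
  if ‖vec y‖ ≤ R then Q y else 0

/-- The restriction of `Q` to jumps of length more than `R`. -/
noncomputable def longJumps (R : ℝ) (Q : (Fin d → ℤ) → ℝ) (y : Fin d → ℤ) : ℝ :=
  if ‖vec y‖ ≤ R then 0 else Q y

lemma abs_shortJumps_le (R : ℝ) (Q : (Fin d → ℤ) → ℝ) (y : Fin d → ℤ) :
    |shortJumps R Q y| ≤ |Q y| := by
  unfold shortJumps; split_ifs <;> simp

lemma abs_longJumps_le (R : ℝ) (Q : (Fin d → ℤ) → ℝ) (y : Fin d → ℤ) :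
    |longJumps R Q y| ≤ |Q y| := by
  unfold longJumps; split_ifs <;> simp

lemma shortJumps_add_longJumps (R : ℝ) (Q : (Fin d → ℤ) → ℝ) (y : Fin d → ℤ) :
    shortJumps R Q y + longJumps R Q y = Q y := by
  unfold shortJumps longJumps; split_ifs <;> simp

lemma summable_shortJumps {Q : (Fin d → ℤ) → ℝ} (hQ : Summable fun y => |Q y|) (R : ℝ) :
    Summable fun y => |shortJumps R Q y| :=
  Summable.of_nonneg_of_le (fun _ => abs_nonneg _) (abs_shortJumps_le R Q) hQ

lemma summable_longJumps {Q : (Fin d → ℤ) → ℝ} (hQ : Summable fun y => |Q y|) (R : ℝ) :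
    Summable fun y => |longJumps R Q y| :=
  Summable.of_nonneg_of_le (fun _ => abs_nonneg _) (abs_longJumps_le R Q) hQ

lemma latticeFourier_split {Q : (Fin d → ℤ) → ℝ} (hQ : Summable fun y => |Q y|) (R : ℝ)
    (k : EuclideanSpace ℝ (Fin d)) :
    latticeFourier Q k =
      latticeFourier (shortJumps R Q) k + latticeFourier (longJumps R Q) k := by
  simp only [latticeFourier_eq]
  rw [← (summable_latticeFourier (summable_shortJumps hQ R) k).tsum_add
    (summable_latticeFourier (summable_longJumps hQ R) k)]
  refine tsum_congr fun y => ?_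
  rw [← add_mul, ← Complex.ofReal_add, shortJumps_add_longJumps]

lemma summable_tilt_shortJumps {Q : (Fin d → ℤ) → ℝ} (hQ : Summable fun y => |Q y|) {R : ℝ}
    (θ : EuclideanSpace ℝ (Fin d)) :
    Summable fun y => |Real.exp (inner ℝ θ (vec y)) * shortJumps R Q y| := by
  refine Summable.of_nonneg_of_le (fun _ => abs_nonneg _) (fun y => ?_)
    (hQ.mul_left (Real.exp (‖θ‖ * R)))
  unfold shortJumps
  split_ifs with h
  · rw [abs_mul, Real.abs_exp]
    gcongr
    exact (real_inner_le_norm _ _).trans (mul_le_mul_of_nonneg_left h (norm_nonneg _))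
  · rw [mul_zero, abs_zero]; positivity

lemma re_latChar_neg (y : Fin d → ℤ) (k : EuclideanSpace ℝ (Fin d)) :
    (latChar (-y) k).re = Real.cos (inner ℝ k (vec y)) := by
  rw [latChar, vec_neg, inner_neg_right, mul_comm, Complex.exp_ofReal_mul_I_re, Real.cos_neg]

lemma re_latticeFourier {f : (Fin d → ℤ) → ℝ} (hf : Summable fun y => |f y|)
    (k : EuclideanSpace ℝ (Fin d)) :
    HasSum (fun y => f y * Real.cos (inner ℝ k (vec y))) (latticeFourier f k).re := by
  rw [latticeFourier_eq]
  have := Complex.hasSum_re (summable_latticeFourier hf k).hasSum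
  simpa only [Complex.re_ofReal_mul, re_latChar_neg] using this

lemma inner_firstMoment {M : ℝ} {Q : (Fin d → ℤ) → ℝ} (h : MomBound 1 M Q)
    (θ : EuclideanSpace ℝ (Fin d)) :
    HasSum (fun y => Q y * inner ℝ θ (vec y)) (inner ℝ θ (firstMoment Q)) := by
  have h1 : ∀ j, HasSum (fun y : Fin d → ℤ => θ j * ((y j : ℝ) * Q y))
      (θ j * firstMoment Q j) := by
    intro j
    have := (h.tsum_le (C := 1) zero_le_one (G := fun y => (y j : ℝ) * Q y) (fun y => by
      rw [one_mul, Real.rpow_one, norm_mul, Real.norm_eq_abs (Q y)]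
      gcongr
      exact PiLp.norm_apply_le (vec y) j)).1.hasSum
    exact this.mul_left _
  have h2 := hasSum_sum (s := Finset.univ) fun j _ => h1 j
  convert h2 using 1
  · ext y
    simp only [PiLp.inner_apply, vec, RCLike.inner_apply, conj_trivial, Finset.mul_sum]
    exact Finset.sum_congr rfl fun j _ => by ring
  · simp only [PiLp.inner_apply, RCLike.inner_apply, conj_trivial]
    exact Finset.sum_congr rfl fun j _ => by ring

lemma norm_firstMoment_le {M : ℝ} (hM : 0 ≤ M) {Q : (Fin d → ℤ) → ℝ} (h : MomBound 1 M Q) :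
    ‖firstMoment Q‖ ≤ M := by
  have h1 := inner_firstMoment h (firstMoment Q)
  rw [real_inner_self_eq_norm_sq] at h1
  have h2 := (h.tsum_le (C := ‖firstMoment Q‖) (norm_nonneg _)
    (G := fun y => Q y * inner ℝ (firstMoment Q) (vec y)) (fun y => by
      rw [Real.rpow_one, norm_mul, Real.norm_eq_abs (Q y)]
      calc _ ≤ |Q y| * (‖firstMoment Q‖ * ‖vec y‖) := by
            gcongr; exact norm_inner_le_norm _ _
        _ = _ := by ring)).2
  rw [h1.tsum_eq, Real.norm_of_nonneg (by positivity)] at h2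
  rcases (norm_nonneg (firstMoment Q)).eq_or_lt with h0 | h0
  · rw [← h0]; exact hM
  · nlinarith

lemma abs_exp_sub_one_le (u : ℝ) : |Real.exp u - 1| ≤ |u| * Real.exp |u| := by
  have := Complex.norm_exp_sub_sum_le_norm_mul_exp (u : ℂ) 1
  simp only [Finset.sum_range_one, pow_zero, Nat.factorial_zero, Nat.cast_one, div_one, pow_one,
    Complex.norm_real, Real.norm_eq_abs] at this
  rwa [← Complex.ofReal_exp, ← Complex.ofReal_one, ← Complex.ofReal_sub, Complex.norm_real] at this

lemma abs_exp_sub_one_sub_le (u : ℝ) : |Real.exp u - 1 - u| ≤ u ^ 2 * Real.exp |u| := by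
  have := Complex.norm_exp_sub_sum_le_norm_mul_exp (u : ℂ) 2
  simp only [Finset.sum_range_succ, Finset.sum_range_zero, zero_add, pow_zero, Nat.factorial_zero,
    Nat.cast_one, div_one, pow_one, Nat.factorial_one, Complex.norm_real, Real.norm_eq_abs,
    sq_abs] at this
  rwa [← Complex.ofReal_exp, ← Complex.ofReal_one, ← Complex.ofReal_add, ← Complex.ofReal_sub,
    Complex.norm_real, Real.norm_eq_abs, ← sub_sub] at this

lemma one_sub_cos_le_abs (a : ℝ) : 1 - Real.cos a ≤ |a| := by
  have h1 := Real.one_sub_sq_div_two_le_cos (x := a)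
  have h2 := Real.neg_one_le_cos a
  rcases le_total |a| 2 with h | h
  · nlinarith [abs_nonneg a, sq_abs a]
  · linarith

/-- The pointwise estimate behind `re_tilt_ge`, for one jump `y` with `u = θ·y` and `a = k·y`. -/
lemma tilt_error_le {R ℓ s κ u a : ℝ} (hR : 0 < R) (hℓ : 0 ≤ ℓ) (hs : 0 ≤ s)
    (hu : |u| ≤ ℓ / R * s) (ha : |a| ≤ κ * s) :
    |(1 - (if s ≤ R then Real.exp u else 0) * Real.cos a) - (1 - Real.cos a) + u| ≤
      ((ℓ / R) ^ 2 * Real.exp ℓ + κ * (ℓ / R) * Real.exp ℓ + (1 + ℓ) / R ^ 2) * s ^ 2 := by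
  have hlR : 0 ≤ ℓ / R := by positivity
  have hκs : 0 ≤ κ * s := (abs_nonneg a).trans ha
  split_ifs with h
  · have hul : |u| ≤ ℓ := hu.trans (by
      calc ℓ / R * s ≤ ℓ / R * R := by gcongr
        _ = ℓ := by field_simp)
    have he : Real.exp |u| ≤ Real.exp ℓ := Real.exp_le_exp.mpr hul
    have h1 : |Real.exp u - 1 - u| ≤ (ℓ / R * s) ^ 2 * Real.exp ℓ :=
      (abs_exp_sub_one_sub_le u).trans (by
        rw [← sq_abs u]; gcongr)
    have h2 : |(1 - Real.cos a) * (Real.exp u - 1)| ≤ κ * s * (ℓ / R * s * Real.exp ℓ) := by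
      rw [abs_mul, abs_of_nonneg (by linarith [Real.cos_le_one a] : 0 ≤ 1 - Real.cos a)]
      have := abs_exp_sub_one_le u
      have h3 : |Real.exp u - 1| ≤ ℓ / R * s * Real.exp ℓ := this.trans (by gcongr)
      exact mul_le_mul ((one_sub_cos_le_abs a).trans ha) h3 (abs_nonneg _) hκs
    have h4 : (1 - Real.exp u * Real.cos a) - (1 - Real.cos a) + u =
        -(Real.exp u - 1 - u) + (1 - Real.cos a) * (Real.exp u - 1) := by ring
    rw [h4]
    refine (abs_add_le _ _).trans ?_
    rw [abs_neg]
    have h5 : 0 ≤ (1 + ℓ) / R ^ 2 * s ^ 2 := by positivity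
    calc _ ≤ (ℓ / R * s) ^ 2 * Real.exp ℓ + κ * s * (ℓ / R * s * Real.exp ℓ) := add_le_add h1 h2
      _ ≤ (ℓ / R * s) ^ 2 * Real.exp ℓ + κ * s * (ℓ / R * s * Real.exp ℓ)
          + (1 + ℓ) / R ^ 2 * s ^ 2 := by linarith
      _ = _ := by ring
  · push Not at h
    have hsR : 1 ≤ s / R := by rw [one_le_div hR]; exact h.le
    have h1 : (1 - 0 * Real.cos a) - (1 - Real.cos a) + u = Real.cos a + u := by ring
    rw [h1]
    have h2 : |Real.cos a + u| ≤ 1 + ℓ * (s / R) := by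
      refine (abs_add_le _ _).trans (add_le_add (Real.abs_cos_le_one a) (hu.trans_eq ?_))
      ring
    have h3 : 1 + ℓ * (s / R) ≤ (1 + ℓ) * (s / R) ^ 2 := by
      have h6 : s / R ≤ (s / R) ^ 2 := le_self_pow₀ hsR two_ne_zero
      have h7 := mul_le_mul_of_nonneg_left h6 hℓ
      linarith
    have h4 : 0 ≤ ((ℓ / R) ^ 2 * Real.exp ℓ) * s ^ 2 := by positivity
    have h5 : 0 ≤ κ * s * (ℓ / R * s * Real.exp ℓ) := by positivity
    calc _ ≤ (1 + ℓ) * (s / R) ^ 2 := h2.trans h3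
      _ ≤ (1 + ℓ) * (s / R) ^ 2 + ((ℓ / R) ^ 2 * Real.exp ℓ) * s ^ 2
          + κ * s * (ℓ / R * s * Real.exp ℓ) := by linarith
      _ = _ := by ring

/-- Lower bound on the real part of the exponent of the tilted, truncated heat kernel. -/
lemma re_tilt_ge {M K z : ℝ} {Q : (Fin d → ℤ) → ℝ} (hQ : IsCore M K z Q)
    {R ℓ : ℝ} (hR : 0 < R) (hℓ : 0 ≤ ℓ) {θ : EuclideanSpace ℝ (Fin d)} (hθ : ‖θ‖ ≤ ℓ / R)
    {k : EuclideanSpace ℝ (Fin d)} (hk : k ∈ torusCube d) :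
    K * ‖k‖ ^ 2 - inner ℝ θ (firstMoment Q) -
      ((ℓ / R) ^ 2 * Real.exp ℓ + ‖k‖ * (ℓ / R) * Real.exp ℓ + (1 + ℓ) / R ^ 2) * M ≤
      (latticeFourier Q 0 - latticeFourier
        (fun y => Real.exp (inner ℝ θ (vec y)) * shortJumps R Q y) k).re := by
  have hs := hQ.mom_zero.summable_abs
  have hb := summable_tilt_shortJumps hs (R := R) θ
  set E := (ℓ / R) ^ 2 * Real.exp ℓ + ‖k‖ * (ℓ / R) * Real.exp ℓ + (1 + ℓ) / R ^ 2 with hE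
  have h0 : HasSum Q (latticeFourier Q 0).re := by
    simpa using re_latticeFourier hs 0
  have h1 := h0.sub (re_latticeFourier hb k)
  have h2 := h0.sub (re_latticeFourier hs k)
  have h3 := (h1.sub h2).add (inner_firstMoment hQ.mom_one θ)
  rw [← Complex.sub_re, ← Complex.sub_re] at h3
  have h4 := (hQ.mom_two.tsum_le (C := E) (by positivity) (G := fun y =>
    (Q y - Real.exp (inner ℝ θ (vec y)) * shortJumps R Q y * Real.cos (inner ℝ k (vec y))
      - (Q y - Q y * Real.cos (inner ℝ k (vec y))) + Q y * inner ℝ θ (vec y))) (fun y => by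
    have h5 := tilt_error_le (u := inner ℝ θ (vec y)) (a := inner ℝ k (vec y)) (κ := ‖k‖)
      (s := ‖vec y‖) hR hℓ (norm_nonneg _)
      ((abs_real_inner_le_norm _ _).trans (by gcongr)) (abs_real_inner_le_norm _ _)
    have h6 : (Q y - Real.exp (inner ℝ θ (vec y)) * shortJumps R Q y *
        Real.cos (inner ℝ k (vec y)) - (Q y - Q y * Real.cos (inner ℝ k (vec y))) +
        Q y * inner ℝ θ (vec y)) = Q y * ((1 - (if ‖vec y‖ ≤ R then
          Real.exp (inner ℝ θ (vec y)) else 0) * Real.cos (inner ℝ k (vec y))) -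
          (1 - Real.cos (inner ℝ k (vec y))) + inner ℝ θ (vec y)) := by
      unfold shortJumps; split_ifs <;> ring
    rw [h6, norm_mul, Real.norm_eq_abs, Real.norm_eq_abs]
    calc _ ≤ |Q y| * (E * ‖vec y‖ ^ 2) := by gcongr
      _ = _ := by
        rw [show ‖vec y‖ ^ (2 : ℝ) = ‖vec y‖ ^ 2 by exact_mod_cast Real.rpow_natCast _ 2]
        ring)).2
  rw [h3.tsum_eq, Real.norm_eq_abs] at h4
  have h7 := (abs_le.mp h4).1
  have h8 := hQ.infrared k hk
  linarith

lemma log_le_self_sqrt {σ : ℝ} (hσ : 1 ≤ σ) : Real.log σ ≤ σ :=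
  (Real.log_le_sub_one_of_pos (by linarith)).trans (by linarith)

/-- Gaussian bound for the symbol of the tilted truncated heat kernel. The truncation is at
`σ² √τ`, and the tilt of size `log σ / (σ² √τ)`: this is the balance which keeps the second-order
term `t |θ|² e^{|θ| R}` bounded. -/
lemma norm_tilt_symbol_le {M K z : ℝ} (hM : 0 < M) (hK : 0 < K) {Q : (Fin d → ℤ) → ℝ}
    (hQ : IsCore M K z Q) {t σ : ℝ} (ht : 0 < t) (hσ : 1 ≤ σ)
    {θ : EuclideanSpace ℝ (Fin d)}
    (hθ : ‖θ‖ ≤ Real.log σ / (σ ^ 2 * Real.sqrt (max t 1)))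
    {k : EuclideanSpace ℝ (Fin d)} (hk : k ∈ torusCube d) :
    ‖Complex.exp (-(t : ℂ) * latticeFourier Q 0) * Complex.exp (t * latticeFourier
        (fun y => Real.exp (inner ℝ θ (vec y)) *
          shortJumps (σ ^ 2 * Real.sqrt (max t 1)) Q y) k)‖ ≤
      Real.exp (4 * M + M ^ 2 / (2 * K)) * Real.exp (t * inner ℝ θ (firstMoment Q)) *
        Real.exp (-(K / 2 * t) * ‖k‖ ^ 2) := by
  set τ := max t 1 with hτ
  have hτ1 : 1 ≤ τ := le_max_right _ _
  have htτ : t ≤ τ := le_max_left _ _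
  set r := Real.sqrt τ with hr
  have hr1 : 1 ≤ r := Real.one_le_sqrt.mpr hτ1
  have hr2 : r ^ 2 = τ := Real.sq_sqrt (by linarith)
  have hl := log_le_self_sqrt hσ
  have hl0 := Real.log_nonneg hσ
  set ℓ := Real.log σ with hℓ
  have hel : Real.exp ℓ = σ := Real.exp_log (by linarith)
  have hσ0 : 0 < σ := by linarith
  have hR : 0 < σ ^ 2 * r := by positivity
  have hre := re_tilt_ge hQ hR hl0 hθ hk
  set L := latticeFourier Q 0
  set Lb := latticeFourier (fun y => Real.exp (inner ℝ θ (vec y)) * shortJumps (σ ^ 2 * r) Q y) k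
  rw [← Complex.exp_add, Complex.norm_exp, ← Real.exp_add, ← Real.exp_add]
  apply Real.exp_le_exp.mpr
  have h1 : (-(t : ℂ) * L + t * Lb).re = -(t * (L - Lb).re) := by
    rw [show -(t : ℂ) * L + t * Lb = -((t : ℂ) * (L - Lb)) by ring, Complex.neg_re,
      Complex.re_ofReal_mul]
  rw [h1, hel] at *
  set st := Real.sqrt t with hst
  have hst2 : st ^ 2 = t := Real.sq_sqrt ht.le
  have hstr : st ≤ r := Real.sqrt_le_sqrt htτ
  have hst0 : 0 < st := Real.sqrt_pos.mpr ht
  -- the three parts of the error term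
  have e1 : t * ((ℓ / (σ ^ 2 * r)) ^ 2 * σ) ≤ 1 := by
    have : t * ((ℓ / (σ ^ 2 * r)) ^ 2 * σ) = (t / τ) * (ℓ / σ) ^ 2 * (1 / σ) := by
      rw [← hr2]; field_simp
    rw [this]
    have a1 : t / τ ≤ 1 := (div_le_one (by linarith)).mpr htτ
    have a2 : (ℓ / σ) ^ 2 ≤ 1 := pow_le_one₀ (by positivity) ((div_le_one hσ0).mpr hl)
    have a3 : 1 / σ ≤ 1 := (div_le_one hσ0).mpr hσ
    have a4 : t / τ * (ℓ / σ) ^ 2 ≤ 1 := mul_le_one₀ a1 (by positivity) a2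
    exact mul_le_one₀ a4 (by positivity) a3
  have e2 : t * (‖k‖ * (ℓ / (σ ^ 2 * r)) * σ) ≤ st * ‖k‖ := by
    have : t * (‖k‖ * (ℓ / (σ ^ 2 * r)) * σ) = st * ‖k‖ * ((st / r) * (ℓ / σ)) := by
      rw [← hst2]; field_simp
    rw [this]
    have a1 : st / r ≤ 1 := (div_le_one (by linarith)).mpr hstr
    have a2 : ℓ / σ ≤ 1 := (div_le_one hσ0).mpr hl
    exact mul_le_of_le_one_right (by positivity) (mul_le_one₀ a1 (by positivity) a2)
  have e3 : t * ((1 + ℓ) / (σ ^ 2 * r) ^ 2) ≤ 2 := by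
    have : t * ((1 + ℓ) / (σ ^ 2 * r) ^ 2) = (t / τ) * ((1 + ℓ) / σ ^ 4) := by
      rw [← hr2]; field_simp
    rw [this]
    have a1 : t / τ ≤ 1 := (div_le_one (by linarith)).mpr htτ
    have a2 : (1 + ℓ) / σ ^ 4 ≤ 2 := by
      rw [div_le_iff₀ (by positivity)]
      have : σ ≤ σ ^ 4 := le_self_pow₀ hσ (by norm_num)
      linarith
    calc _ ≤ 1 * 2 := mul_le_mul a1 a2 (by positivity) zero_le_one
      _ = 2 := by norm_num
  have e4 : M * (st * ‖k‖) ≤ K / 2 * t * ‖k‖ ^ 2 + M ^ 2 / (2 * K) := by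
    have : K / 2 * t * ‖k‖ ^ 2 + M ^ 2 / (2 * K) - M * (st * ‖k‖) =
        (K * (st * ‖k‖) - M) ^ 2 / (2 * K) := by
      rw [← hst2]; field_simp; ring
    have h9 : 0 ≤ (K * (st * ‖k‖) - M) ^ 2 / (2 * K) := by positivity
    linarith
  have h5 := mul_le_mul_of_nonneg_left hre ht.le
  have h6 : t * ((ℓ / (σ ^ 2 * r)) ^ 2 * σ + ‖k‖ * (ℓ / (σ ^ 2 * r)) * σ +
      (1 + ℓ) / (σ ^ 2 * r) ^ 2) * M ≤ (3 + st * ‖k‖) * M := by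
    gcongr; linarith
  nlinarith

lemma norm_heatSymbol_le {M K z : ℝ} {Q : (Fin d → ℤ) → ℝ} (hQ : IsCore M K z Q) {t : ℝ}
    (ht : 0 < t) {k : EuclideanSpace ℝ (Fin d)} (hk : k ∈ torusCube d) :
    ‖heatSymbol Q t k‖ ≤ Real.exp (-(K * t) * ‖k‖ ^ 2) := by
  rw [heatSymbol, Complex.norm_exp]
  apply Real.exp_le_exp.mpr
  rw [show -(t : ℂ) * (latticeFourier Q 0 - latticeFourier Q k) =
    -((t : ℂ) * (latticeFourier Q 0 - latticeFourier Q k)) by ring, Complex.neg_re,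
      Complex.re_ofReal_mul]
  nlinarith [hQ.infrared k hk]

lemma continuous_heatSymbol {Q : (Fin d → ℤ) → ℝ} (hQ : Summable fun y => |Q y|) (t : ℝ) :
    Continuous (heatSymbol Q t) := by
  have := continuous_latticeFourier hQ
  unfold heatSymbol; fun_prop

/-! ### Moment bounds for the lattice heat kernel -/

lemma torusCoeff_const_mul (c : ℂ) (F : EuclideanSpace ℝ (Fin d) → ℂ) (x : Fin d → ℤ) :
    torusCoeff (fun k => c * F k) x = c * torusCoeff F x := by
  simp only [torusCoeff, ← mul_div_assoc, ← integral_const_mul]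
  congr 2; ext k; ring

/-- A function on the torus below a Gaussian has Fourier coefficients bounded as those of the heat
kernel, both uniformly and in `ℓ²`. -/
lemma torusCoeff_bounds (d : ℕ) {a : ℝ} (ha : 0 < a) :
    ∃ c > 0, ∀ t > 0, ∀ D > 0, ∀ F : EuclideanSpace ℝ (Fin d) → ℂ, Measurable F →
      (∀ k ∈ torusCube d, ‖F k‖ ≤ D * Real.exp (-(a * t) * ‖k‖ ^ 2)) →
      (∀ x, ‖torusCoeff F x‖ ≤ c * D * max t 1 ^ (-((d : ℝ) / 2))) ∧
      Summable (fun x => ‖torusCoeff F x‖ ^ 2) ∧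
      ∑' x, ‖torusCoeff F x‖ ^ 2 ≤ (c * D) ^ 2 * max t 1 ^ (-((d : ℝ) / 2)) := by
  obtain ⟨c₁, hc₁, h₁⟩ := setIntegral_gaussian_le d ha
  obtain ⟨c₂, hc₂, h₂⟩ := setIntegral_gaussian_le d (a := 2 * a) (by positivity)
  refine ⟨c₁ + c₂ + 1, by positivity, fun t ht D hD F hF hFb => ?_⟩
  have hτ : 0 < max t 1 := lt_max_of_lt_left ht
  have hβ : 0 < max t 1 ^ (-((d : ℝ) / 2)) := Real.rpow_pos_of_pos hτ _
  have hgi : ∀ b : ℝ, 0 < b → IntegrableOn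
      (fun k : EuclideanSpace ℝ (Fin d) => Real.exp (-(b * t) * ‖k‖ ^ 2)) (torusCube d) :=
    fun b hb => (integrable_gaussian (by positivity)).integrableOn
  have hae : ∀ {P : EuclideanSpace ℝ (Fin d) → Prop}, (∀ k ∈ torusCube d, P k) →
      ∀ᵐ k ∂(volume.restrict (torusCube d)), P k := fun h =>
    (ae_restrict_iff' measurableSet_torusCube).mpr (Filter.Eventually.of_forall h)
  have hFD : ∀ k ∈ torusCube d, ‖F k‖ ≤ D := fun k hk => (hFb k hk).trans
    (mul_le_of_le_one_right hD.le (Real.exp_le_one_iff.mpr (by nlinarith [mul_pos ha ht, sq_nonneg ‖k‖])))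
  refine ⟨fun x => ?_, (bessel hF hFD).1, (bessel hF hFD).2.trans ?_⟩
  · refine (norm_torusCoeff_le F x).trans ?_
    have h3 : ∫ k in torusCube d, ‖F k‖ ≤ ∫ k in torusCube d,
        D * Real.exp (-(a * t) * ‖k‖ ^ 2) :=
      integral_mono_of_nonneg (Filter.Eventually.of_forall fun k => norm_nonneg _)
        ((hgi a ha).const_mul D) (hae hFb)
    rw [integral_const_mul] at h3
    calc _ ≤ D * (c₁ * max t 1 ^ (-((d : ℝ) / 2))) :=
          h3.trans (mul_le_mul_of_nonneg_left (h₁ t ht) hD.le)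
      _ = c₁ * D * max t 1 ^ (-((d : ℝ) / 2)) := by ring
      _ ≤ _ := by gcongr; linarith
  · have h3 : ∫ k in torusCube d, ‖F k‖ ^ 2 ≤ ∫ k in torusCube d,
        D ^ 2 * Real.exp (-(2 * a * t) * ‖k‖ ^ 2) := by
      refine integral_mono_of_nonneg (Filter.Eventually.of_forall fun k => by positivity)
        ((hgi (2 * a) (by positivity)).const_mul _) (hae fun k hk => ?_)
      calc ‖F k‖ ^ 2 ≤ (D * Real.exp (-(a * t) * ‖k‖ ^ 2)) ^ 2 :=
            pow_le_pow_left₀ (norm_nonneg _) (hFb k hk) 2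
        _ = _ := by rw [mul_pow, ← Real.exp_nat_mul]; congr 2; push_cast; ring
    rw [integral_const_mul] at h3
    calc _ ≤ D ^ 2 * (c₂ * max t 1 ^ (-((d : ℝ) / 2))) :=
          h3.trans (mul_le_mul_of_nonneg_left (h₂ t ht) (by positivity))
      _ = c₂ * D ^ 2 * max t 1 ^ (-((d : ℝ) / 2)) := by ring
      _ ≤ ((c₁ + c₂ + 1) ^ 2 * D ^ 2) * max t 1 ^ (-((d : ℝ) / 2)) := by gcongr; nlinarith
      _ = _ := by ring

/-- Hölder's inequality for the convolution of `|y|^N f(y)` with a kernel whose Fourier transform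
lies below a Gaussian. -/
lemma conv_le {a N p M : ℝ} (hp1 : 1 ≤ p) (hp2 : p ≤ 2) (hM : 0 < M) {f : (Fin d → ℤ) → ℝ}
    (hf : LpBound N p M f) {w : (Fin d → ℤ) → ℂ} (ha : 0 < a) {β : ℝ} (hβ : 0 < β)
    (hw : ∀ x, ‖w x‖ ≤ a * β) (hws : Summable fun x => ‖w x‖ ^ 2)
    (hw2 : ∑' x, ‖w x‖ ^ 2 ≤ a ^ 2 * β) (x : Fin d → ℤ) :
    Summable (fun y => (‖vec y‖ ^ N * |f y|) * ‖w (x - y)‖) ∧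
    ∑' y, (‖vec y‖ ^ N * |f y|) * ‖w (x - y)‖ ≤ 3 * M * a * β ^ (1 / p) :=
  tsum_mul_le_of_sup_sq hp1 hp2 hM ha hβ (fun y => by positivity) (fun y => norm_nonneg _)
    hf.1 hf.2 (fun y => hw (x - y)) ((Equiv.subLeft x).summable_iff.mpr hws)
    (((Equiv.subLeft x).tsum_eq fun y => ‖w y‖ ^ 2).trans_le hw2)

/-- The Fourier transform of the heat kernel whose jumps are truncated at `R`. -/
noncomputable def shortSymbol (Q : (Fin d → ℤ) → ℝ) (R t : ℝ) (k : EuclideanSpace ℝ (Fin d)) : ℂ :=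
  Complex.exp (-(t : ℂ) * latticeFourier Q 0) *
    Complex.exp (t * latticeFourier (shortJumps R Q) k)

lemma measurable_shortSymbol {Q : (Fin d → ℤ) → ℝ} (hQ : Summable fun y => |Q y|) (R t : ℝ) :
    Measurable (shortSymbol Q R t) := by
  have := continuous_latticeFourier (summable_shortJumps hQ R)
  apply Continuous.measurable
  unfold shortSymbol; fun_prop

/-- The truncated heat kernel decays faster than any power of `|x - tη| / √t`, up to the
truncation. -/
lemma norm_shortHeat_le (d : ℕ) {M K : ℝ} (hM : 0 < M) (hK : 0 < K) :
    ∃ c > 0, ∀ z, ∀ Q : (Fin d → ℤ) → ℝ, IsCore M K z Q → ∀ t > 0, ∀ σ ≥ 1, ∀ x : Fin d → ℤ,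
      ‖torusCoeff (shortSymbol Q (σ ^ 2 * Real.sqrt (max t 1)) t) x‖ ≤
        c * max t 1 ^ (-((d : ℝ) / 2)) *
          Real.exp (-(Real.log σ / (σ ^ 2 * Real.sqrt (max t 1)) *
            ‖vec x - t • firstMoment Q‖)) := by
  obtain ⟨c, hc, h⟩ := torusCoeff_bounds d (a := K / 2) (by positivity)
  refine ⟨c * Real.exp (4 * M + M ^ 2 / (2 * K)), by positivity, fun z Q hQ t ht σ hσ x => ?_⟩
  set R := σ ^ 2 * Real.sqrt (max t 1) with hR
  set ζ := vec x - t • firstMoment Q with hζ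
  have hR0 : 0 < R := by
    have : 0 < Real.sqrt (max t 1) := Real.sqrt_pos.mpr (lt_max_of_lt_left ht)
    positivity
  have hl := Real.log_nonneg hσ
  set θ : EuclideanSpace ℝ (Fin d) := (Real.log σ / R * ‖ζ‖⁻¹) • ζ with hθ
  have hθn : ‖θ‖ ≤ Real.log σ / R := by
    rw [hθ, norm_smul, Real.norm_of_nonneg (by positivity), mul_assoc]
    exact mul_le_of_le_one_right (by positivity) (inv_mul_le_one (a := ‖ζ‖))
  have hθζ : inner ℝ θ ζ = Real.log σ / R * ‖ζ‖ := by
    rw [hθ, real_inner_smul_left, real_inner_self_eq_norm_sq]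
    rcases eq_or_ne ‖ζ‖ 0 with h0 | h0
    · rw [h0]; simp
    · field_simp
  have hs := hQ.mom_zero.summable_abs
  have hb := summable_tilt_shortJumps hs (R := R) θ
  set D := Real.exp (4 * M + M ^ 2 / (2 * K)) * Real.exp (t * inner ℝ θ (firstMoment Q)) with hD
  have hmeas : Measurable (fun k => Complex.exp (-(t : ℂ) * latticeFourier Q 0) *
      Complex.exp (t * latticeFourier
        (fun y => Real.exp (inner ℝ θ (vec y)) * shortJumps R Q y) k)) := by
    have := continuous_latticeFourier hb
    apply Continuous.measurable; fun_prop
  have h1 := (h t ht D (by positivity) _ hmeas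
    (fun k hk => norm_tilt_symbol_le hM hK hQ ht hσ hθn hk)).1 x
  rw [torusCoeff_const_mul, torusCoeff_exp_tilt (summable_shortJumps hs R) θ hb, mul_left_comm,
    ← torusCoeff_const_mul, norm_mul, Complex.norm_real, Real.norm_of_nonneg (Real.exp_pos _).le]
    at h1
  have h2 : Real.exp (inner ℝ θ (vec x)) =
      Real.exp (t * inner ℝ θ (firstMoment Q)) * Real.exp (Real.log σ / R * ‖ζ‖) := by
    rw [← hθζ, ← Real.exp_add, hζ, inner_sub_right, real_inner_smul_right]; ring_nf
  change Real.exp (inner ℝ θ (vec x)) * ‖torusCoeff (shortSymbol Q R t) x‖ ≤ _ at h1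
  rw [h2] at h1
  rw [Real.exp_neg, ← div_eq_mul_inv, le_div_iff₀ (Real.exp_pos _)]
  have h3 := Real.exp_pos (t * inner ℝ θ (firstMoment Q))
  refine le_of_mul_le_mul_left ?_ h3
  calc _ = Real.exp (t * inner ℝ θ (firstMoment Q)) * Real.exp (Real.log σ / R * ‖ζ‖) *
        ‖torusCoeff (shortSymbol Q R t) x‖ := by ring
    _ ≤ _ := h1
    _ = _ := by rw [hD]; ring

/-- The entire function `(e^w - 1) / w`. -/
noncomputable def expQuot (w : ℂ) : ℂ := if w = 0 then 1 else (Complex.exp w - 1) / w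

lemma mul_expQuot (w : ℂ) : w * expQuot w = Complex.exp w - 1 := by
  unfold expQuot
  split_ifs with h
  · simp [h]
  · field_simp

lemma norm_expQuot_le (w : ℂ) : ‖expQuot w‖ ≤ Real.exp ‖w‖ := by
  unfold expQuot
  split_ifs with h
  · simp
  · rw [norm_div, div_le_iff₀ (norm_pos_iff.mpr h)]
    have := Complex.norm_exp_sub_sum_le_norm_mul_exp w 1
    simp only [Finset.sum_range_one, pow_zero, Nat.factorial_zero, Nat.cast_one, div_one, pow_one]
      at this
    linarith

lemma measurable_expQuot : Measurable expQuot := by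
  unfold expQuot
  exact Measurable.ite (measurableSet_singleton 0) measurable_const (by fun_prop)

lemma sum_longJumps_le {M K z : ℝ} {Q : (Fin d → ℤ) → ℝ} (hQ : IsCore M K z Q) {R : ℝ}
    (hR : 0 < R) : ∑' y, |longJumps R Q y| ≤ M / R ^ 2 := by
  have := (hQ.mom_two.tsum_le (C := 1 / R ^ 2) (by positivity) (G := fun y => |longJumps R Q y|)
    (fun y => ?_)).2
  · rw [Real.norm_of_nonneg (tsum_nonneg fun y => abs_nonneg _)] at this
    exact this.trans_eq (by ring)
  · rw [norm_abs_eq_norm, Real.norm_eq_abs]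
    unfold longJumps
    split_ifs with h
    · rw [abs_zero]; positivity
    · push Not at h
      rw [show ‖vec y‖ ^ (2 : ℝ) = ‖vec y‖ ^ 2 by exact_mod_cast Real.rpow_natCast _ 2,
        one_div_mul_eq_div, le_div_iff₀ (by positivity), mul_comm]
      gcongr

lemma abs_longJumps_le_rpow {N R : ℝ} (hN : 0 ≤ N) (hR : 0 < R) (Q : (Fin d → ℤ) → ℝ)
    (y : Fin d → ℤ) : |longJumps R Q y| ≤ R ^ (-N) * (‖vec y‖ ^ N * |Q y|) := by
  unfold longJumps
  split_ifs with h
  · rw [abs_zero]; positivity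
  · push Not at h
    rw [Real.rpow_neg hR.le, inv_mul_eq_div, le_div_iff₀ (by positivity), mul_comm]
    gcongr

/-- The contribution of trajectories with at least one jump longer than `R ≥ √τ`: exactly one of the
long jumps is singled out, and the remaining factor still has a Gaussian Fourier transform. -/
lemma norm_latticeHeat_sub_short_le (d : ℕ) {M K : ℝ} (hM : 0 < M) (hK : 0 < K) :
    ∃ c > 0, ∀ z N p, 0 ≤ N → 1 ≤ p → p ≤ 2 → ∀ Q : (Fin d → ℤ) → ℝ, IsCore M K z Q →
      LpBound N p M Q → ∀ t > 0, ∀ σ ≥ 1, ∀ x : Fin d → ℤ,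
      ‖latticeHeat Q t x - torusCoeff (shortSymbol Q (σ ^ 2 * Real.sqrt (max t 1)) t) x‖ ≤
        c * t * (max t 1 ^ (-((d : ℝ) / 2))) ^ (1 / p) *
          (σ ^ 2 * Real.sqrt (max t 1)) ^ (-N) := by
  obtain ⟨c, hc, h⟩ := torusCoeff_bounds d (a := K / 2) (by positivity)
  set D := Real.exp (4 * M + M ^ 2 / (2 * K)) * Real.exp M with hD
  have hD0 : 0 < D := by positivity
  refine ⟨3 * M * (c * D), by positivity,
    fun z N p hN hp1 hp2 Q hQ hQN t ht σ hσ x => ?_⟩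
  have hs := hQ.mom_zero.summable_abs
  set R := σ ^ 2 * Real.sqrt (max t 1) with hR
  have hr1 : 1 ≤ Real.sqrt (max t 1) := Real.one_le_sqrt.mpr (le_max_right _ _)
  have hR0 : 0 < R := by positivity
  have hRt : t ≤ R ^ 2 := by
    rw [hR, mul_pow, Real.sq_sqrt (by positivity)]
    have : (1 : ℝ) ≤ (σ ^ 2) ^ 2 := one_le_pow₀ (one_le_pow₀ hσ)
    calc t ≤ max t 1 := le_max_left _ _
      _ ≤ _ := le_mul_of_one_le_left (by positivity) this
  have hτ : 0 < max t 1 := lt_max_of_lt_left ht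
  have hβ : 0 < max t 1 ^ (-((d : ℝ) / 2)) := Real.rpow_pos_of_pos hτ _
  have hslong := summable_longJumps hs R
  have hcl := continuous_latticeFourier hslong
  set W : EuclideanSpace ℝ (Fin d) → ℂ := fun k =>
    shortSymbol Q R t k * expQuot (t * latticeFourier (longJumps R Q) k) with hW
  have hWm : Measurable W := (measurable_shortSymbol hs R t).mul
    (measurable_expQuot.comp (hcl.measurable.const_mul _))
  have hWb : ∀ k ∈ torusCube d, ‖W k‖ ≤ D * Real.exp (-(K / 2 * t) * ‖k‖ ^ 2) := by
    intro k hk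
    have h1 := norm_tilt_symbol_le hM hK hQ ht hσ (θ := 0)
      (by rw [norm_zero]; have := Real.log_nonneg hσ; positivity) hk
    simp only [inner_zero_left, Real.exp_zero, one_mul, mul_zero, mul_one] at h1
    have h2 : ‖expQuot (t * latticeFourier (longJumps R Q) k)‖ ≤ Real.exp M := by
      refine (norm_expQuot_le _).trans (Real.exp_le_exp.mpr ?_)
      rw [norm_mul, Complex.norm_real, Real.norm_of_nonneg ht.le]
      calc t * ‖latticeFourier (longJumps R Q) k‖ ≤ R ^ 2 * (M / R ^ 2) := by
            gcongr
            exact (norm_latticeFourier_le hslong k).trans (sum_longJumps_le hQ hR0)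
        _ = M := by field_simp
    rw [hW, norm_mul]
    calc _ ≤ (Real.exp (4 * M + M ^ 2 / (2 * K)) * Real.exp (-(K / 2 * t) * ‖k‖ ^ 2)) *
          Real.exp M := mul_le_mul h1 h2 (norm_nonneg _) (by positivity)
      _ = _ := by rw [hD]; ring
  obtain ⟨hw1, hw2, hw3⟩ := h t ht D hD0 W hWm hWb
  have hWi : IntegrableOn W (torusCube d) := integrableOn_of_norm_le hWm (B := D) fun k hk =>
    (hWb k hk).trans (mul_le_of_le_one_right hD0.le (Real.exp_le_one_iff.mpr (by
      nlinarith [mul_pos hK ht, sq_nonneg ‖k‖])))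
  -- the difference of the symbols is `t` times the product of `W` and the transform of long jumps
  have hsplit : ∀ k, heatSymbol Q t k - shortSymbol Q R t k =
      (t : ℂ) * (latticeFourier (longJumps R Q) k * W k) := by
    intro k
    have h3 : heatSymbol Q t k =
        shortSymbol Q R t k * Complex.exp (t * latticeFourier (longJumps R Q) k) := by
      rw [heatSymbol, shortSymbol, latticeFourier_split hs R k, ← Complex.exp_add,
        ← Complex.exp_add]
      congr 1; ring
    have h4 := mul_expQuot (t * latticeFourier (longJumps R Q) k)
    rw [h3, hW]
    linear_combination (-shortSymbol Q R t k) * h4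
  have hHi : IntegrableOn (fun k => latChar x k * heatSymbol Q t k) (torusCube d) :=
    integrableOn_of_norm_le (B := 1) ((continuous_latChar x).mul
      (continuous_heatSymbol hs t)).measurable fun k hk => by
        rw [norm_mul, norm_latChar, one_mul]
        exact (norm_heatSymbol_le hQ ht hk).trans (Real.exp_le_one_iff.mpr (by
          nlinarith [mul_pos hK ht, sq_nonneg ‖k‖]))
  have hSi : IntegrableOn (fun k => latChar x k * shortSymbol Q R t k) (torusCube d) := by
    have h5 : ∀ k, latChar x k * shortSymbol Q R t k = latChar x k * heatSymbol Q t k -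
        t * (latticeFourier (longJumps R Q) k * W k * latChar x k) := fun k => by
      linear_combination (-latChar x k) * hsplit k
    simp only [h5]
    refine hHi.sub (Integrable.const_mul ?_ _)
    refine Integrable.mul_bdd (c := 1) ?_ (continuous_latChar x).aestronglyMeasurable
      (Filter.Eventually.of_forall fun k => (norm_latChar x k).le)
    exact hWi.bdd_mul (c := ∑' y, |longJumps R Q y|) hcl.aestronglyMeasurable
      (Filter.Eventually.of_forall fun k => norm_latticeFourier_le hslong k)
  have hdiff : latticeHeat Q t x - torusCoeff (shortSymbol Q R t) x =
      t * torusCoeff (fun k => latticeFourier (longJumps R Q) k * W k) x := by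
    rw [← torusCoeff_const_mul, latticeHeat, torusCoeff, torusCoeff, torusCoeff, ← sub_div,
      ← integral_sub hHi hSi]
    congr 2; ext k
    rw [← hsplit]; ring
  rw [hdiff, norm_mul, Complex.norm_real, Real.norm_of_nonneg ht.le,
    ← (hasSum_torusCoeff_mul hslong hWi x).tsum_eq]
  obtain ⟨hc1, hc2⟩ := conv_le hp1 hp2 hM hQN (by positivity) hβ hw1 hw2 hw3 x
  have h6 : ‖∑' y, (longJumps R Q y : ℂ) * torusCoeff W (x - y)‖ ≤
      R ^ (-N) * ∑' y, (‖vec y‖ ^ N * |Q y|) * ‖torusCoeff W (x - y)‖ := by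
    refine tsum_of_norm_bounded (hc1.hasSum.mul_left (R ^ (-N))) fun y => ?_
    rw [norm_mul, Complex.norm_real, Real.norm_eq_abs, ← mul_assoc]
    exact mul_le_mul_of_nonneg_right (abs_longJumps_le_rpow hN hR0 Q y) (norm_nonneg _)
  calc _ ≤ t * (R ^ (-N) * (3 * M * (c * D) * (max t 1 ^ (-((d : ℝ) / 2))) ^ (1 / p))) := by
        gcongr
        exact h6.trans (by gcongr)
    _ = _ := by ring

/-- Uniform and `ℓ²` bounds for the lattice heat kernel. -/
lemma latticeHeat_bounds (d : ℕ) {K : ℝ} (hK : 0 < K) :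
    ∃ c > 0, ∀ M z, ∀ Q : (Fin d → ℤ) → ℝ, IsCore M K z Q → ∀ t > 0,
      (∀ x, ‖latticeHeat Q t x‖ ≤ c * max t 1 ^ (-((d : ℝ) / 2))) ∧
      Summable (fun x => ‖latticeHeat Q t x‖ ^ 2) ∧
      ∑' x, ‖latticeHeat Q t x‖ ^ 2 ≤ c ^ 2 * max t 1 ^ (-((d : ℝ) / 2)) := by
  obtain ⟨c, hc, h⟩ := torusCoeff_bounds d hK
  refine ⟨c, hc, fun M z Q hQ t ht => ?_⟩
  have := h t ht 1 one_pos (heatSymbol Q t)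
    (continuous_heatSymbol hQ.mom_zero.summable_abs t).measurable
    (fun k hk => by rw [one_mul]; exact norm_heatSymbol_le hQ ht hk)
  simpa [latticeHeat] using this

/-- Moment bound for the lattice heat kernel: the first term is the diffusive one, and the second
one comes from a single long jump. -/
lemma latticeHeat_moment (d : ℕ) {M K N p : ℝ} (hM : 0 < M) (hK : 0 < K) (hN : 0 < N)
    (hp1 : 1 ≤ p) (hp2 : p ≤ 2) :
    ∃ c > 0, ∀ z, ∀ Q : (Fin d → ℤ) → ℝ, IsCore M K z Q → LpBound N p M Q →
      ∀ t > 0, ∀ x : Fin d → ℤ,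
      ‖vec x - t • firstMoment Q‖ ^ N * ‖latticeHeat Q t x‖ ≤
        c * (max t 1 ^ (N / 2 - (d : ℝ) / 2) +
          t * (max t 1 ^ (-((d : ℝ) / 2))) ^ (1 / p)) := by
  obtain ⟨c₁, hc₁, h₁⟩ := norm_shortHeat_le d hM hK
  obtain ⟨c₂, hc₂, h₂⟩ := norm_latticeHeat_sub_short_le d hM hK
  obtain ⟨c₃, hc₃, h₃⟩ := latticeHeat_bounds d hK
  refine ⟨(2 * N) ^ N * (c₁ + c₂ + c₃), by positivity, fun z Q hQ hQN t ht x => ?_⟩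
  set τ := max t 1 with hτ
  have hτ0 : 0 < τ := lt_max_of_lt_left ht
  set r := Real.sqrt τ with hr
  have hr0 : 0 < r := Real.sqrt_pos.mpr hτ0
  set n := ‖vec x - t • firstMoment Q‖ with hn
  have hrN : r ^ N = τ ^ (N / 2) := by
    rw [hr, Real.sqrt_eq_rpow, ← Real.rpow_mul hτ0.le]; congr 1; ring
  have hτN : τ ^ (N / 2 - (d : ℝ) / 2) = r ^ N * τ ^ (-((d : ℝ) / 2)) := by
    rw [hrN, ← Real.rpow_add hτ0]; ring_nf
  have hβ : 0 < τ ^ (-((d : ℝ) / 2)) := Real.rpow_pos_of_pos hτ0 _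
  set β := τ ^ (-((d : ℝ) / 2)) with hβdef
  have hβp : 0 < β ^ (1 / p) := Real.rpow_pos_of_pos hβ _
  have h2N : (2 * N * r) ^ N = (2 * N) ^ N * r ^ N := Real.mul_rpow (by positivity) hr0.le
  have hA : 0 < (2 * N) ^ N := by positivity
  have hrNpos : 0 < r ^ N := by positivity
  rw [hτN]
  rcases le_or_gt n (2 * N * r) with hle | hgt
  · calc n ^ N * ‖latticeHeat Q t x‖ ≤ (2 * N * r) ^ N * (c₃ * β) :=
          mul_le_mul (Real.rpow_le_rpow (norm_nonneg _) hle hN.le) ((h₃ M z Q hQ t ht).1 x)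
            (norm_nonneg _) (by positivity)
      _ = (2 * N) ^ N * c₃ * (r ^ N * β) := by rw [h2N]; ring
      _ ≤ (2 * N) ^ N * (c₁ + c₂ + c₃) * (r ^ N * β + t * β ^ (1 / p)) := by
          gcongr
          · linarith
          · have : 0 ≤ t * β ^ (1 / p) := by positivity
            linarith
  · -- truncate at `|x - tη| / (2N)`, so that the tilt gains `σ^{-2N}`
    set σ := Real.sqrt (n / (2 * N * r)) with hσ
    have hq : 1 ≤ n / (2 * N * r) := (one_le_div (by positivity)).mpr hgt.le
    have hσ1 : 1 ≤ σ := Real.one_le_sqrt.mpr hq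
    have hσ0 : 0 < σ := by linarith
    have hσ2 : σ ^ 2 = n / (2 * N * r) := Real.sq_sqrt (by linarith)
    have hn0 : 0 < n := lt_trans (by positivity) hgt
    have hR : σ ^ 2 * r = n / (2 * N) := by rw [hσ2]; field_simp
    have hv := h₁ z Q hQ t ht σ hσ1 x
    have hd := h₂ z N p hN.le hp1 hp2 Q hQ hQN t ht σ hσ1 x
    rw [← hτ, ← hr, ← hβdef] at hv hd
    have he : Real.exp (-(Real.log σ / (σ ^ 2 * r) * n)) = (n / (2 * N * r)) ^ (-N) := by
      rw [hR, ← hσ2, ← Real.rpow_natCast, ← Real.rpow_mul hσ0.le,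
        Real.rpow_def_of_pos hσ0]
      congr 1; push_cast; field_simp
    rw [← hn, he] at hv
    have g1 : n ^ N * (n / (2 * N * r)) ^ (-N) = (2 * N) ^ N * r ^ N := by
      rw [Real.rpow_neg (by positivity), Real.div_rpow hn0.le (by positivity), h2N]
      field_simp
    have g2 : n ^ N * (σ ^ 2 * r) ^ (-N) = (2 * N) ^ N := by
      rw [hR, Real.rpow_neg (by positivity), Real.div_rpow hn0.le (by positivity)]
      field_simp
    set v := torusCoeff (shortSymbol Q (σ ^ 2 * r) t) x
    have htri : ‖latticeHeat Q t x‖ ≤ ‖v‖ + ‖latticeHeat Q t x - v‖ := by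
      have := norm_add_le v (latticeHeat Q t x - v)
      rwa [add_sub_cancel] at this
    calc n ^ N * ‖latticeHeat Q t x‖ ≤ n ^ N * (c₁ * β * (n / (2 * N * r)) ^ (-N) +
          c₂ * t * β ^ (1 / p) * (σ ^ 2 * r) ^ (-N)) := by
          gcongr; exact htri.trans (add_le_add hv hd)
      _ = c₁ * β * (n ^ N * (n / (2 * N * r)) ^ (-N)) +
          c₂ * (t * β ^ (1 / p)) * (n ^ N * (σ ^ 2 * r) ^ (-N)) := by ring
      _ = (2 * N) ^ N * (c₁ * (r ^ N * β) + c₂ * (t * β ^ (1 / p))) := by rw [g1, g2]; ring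
      _ ≤ (2 * N) ^ N * ((c₁ + c₂ + c₃) * (r ^ N * β) + (c₁ + c₂ + c₃) * (t * β ^ (1 / p))) := by
          gcongr <;> linarith
      _ = _ := by ring

/-! ### Moment bounds for the inner integral -/

lemma torusIntegral_eq (Q g : (Fin d → ℤ) → ℝ) (t : ℝ) (x : Fin d → ℤ) :
    torusIntegral Q g t x = torusCoeff (fun k => latticeFourier g k * heatSymbol Q t k) x := by
  rw [torusIntegral, integral_div, torusCoeff]
  simp only [latChar, heatSymbol, mul_assoc]

lemma integrableOn_heatSymbol {M K z : ℝ} (hK : 0 < K) {Q : (Fin d → ℤ) → ℝ}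
    (hQ : IsCore M K z Q) {t : ℝ} (ht : 0 < t) : IntegrableOn (heatSymbol Q t) (torusCube d) :=
  integrableOn_of_norm_le (continuous_heatSymbol hQ.mom_zero.summable_abs t).measurable (B := 1)
    fun k hk => (norm_heatSymbol_le hQ ht hk).trans (Real.exp_le_one_iff.mpr (by
      nlinarith [mul_pos hK ht, sq_nonneg ‖k‖]))

lemma hasSum_torusIntegral {M K z : ℝ} (hK : 0 < K) {Q g : (Fin d → ℤ) → ℝ}
    (hQ : IsCore M K z Q) (hg : Summable fun y => |g y|) {t : ℝ} (ht : 0 < t) (x : Fin d → ℤ) :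
    HasSum (fun y => (g y : ℂ) * latticeHeat Q t (x - y)) (torusIntegral Q g t x) := by
  rw [torusIntegral_eq]
  exact hasSum_torusCoeff_mul hg (integrableOn_heatSymbol hK hQ ht) x

lemma norm_torusIntegral_le (d : ℕ) {M K : ℝ} (hM : 0 < M) (hK : 0 < K) :
    ∃ c > 0, ∀ z, ∀ Q g : (Fin d → ℤ) → ℝ, IsCore M K z Q → MomBound 0 M g → ∀ t > 0, ∀ x,
      ‖torusIntegral Q g t x‖ ≤ c * max t 1 ^ (-((d : ℝ) / 2)) := by
  obtain ⟨c, hc, h⟩ := latticeHeat_bounds d hK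
  refine ⟨c * M, by positivity, fun z Q g hQ hg t ht x => ?_⟩
  have hτ : 0 < max t 1 := lt_max_of_lt_left ht
  have := (hg.tsum_le (C := c * max t 1 ^ (-((d : ℝ) / 2))) (by positivity)
    (G := fun y => (g y : ℂ) * latticeHeat Q t (x - y)) (fun y => by
      rw [norm_mul, Complex.norm_real, Real.norm_eq_abs, Real.rpow_zero, one_mul, mul_comm]
      gcongr
      exact (h M z Q hQ t ht).1 _)).2
  rw [(hasSum_torusIntegral hK hQ hg.summable_abs ht x).tsum_eq] at this
  exact this.trans_eq (by ring)

lemma torusIntegral_moment (d : ℕ) {M K N p q : ℝ} (hM : 0 < M) (hK : 0 < K) (hN : 0 < N)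
    (hp1 : 1 ≤ p) (hp2 : p ≤ 2) (hq1 : 1 ≤ q) (hq2 : q ≤ 2) :
    ∃ c > 0, ∀ z, ∀ Q g : (Fin d → ℤ) → ℝ, IsCore M K z Q → LpBound N p M Q → MomBound 0 M g →
      LpBound N q M g → ∀ t > 0, ∀ x : Fin d → ℤ,
      ‖vec x - t • firstMoment Q‖ ^ N * ‖torusIntegral Q g t x‖ ≤
        c * (max t 1 ^ (N / 2 - (d : ℝ) / 2) +
          t * (max t 1 ^ (-((d : ℝ) / 2))) ^ (1 / p) +
          (max t 1 ^ (-((d : ℝ) / 2))) ^ (1 / q)) := by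
  obtain ⟨c₁, hc₁, h₁⟩ := latticeHeat_moment d hM hK hN hp1 hp2
  obtain ⟨c₂, hc₂, h₂⟩ := latticeHeat_bounds d hK
  refine ⟨2 ^ N * (c₁ * M + 3 * M * c₂), by positivity, fun z Q g hQ hQN hg hgN t ht x => ?_⟩
  have hτ : 0 < max t 1 := lt_max_of_lt_left ht
  have hβ : 0 < max t 1 ^ (-((d : ℝ) / 2)) := Real.rpow_pos_of_pos hτ _
  set β := max t 1 ^ (-((d : ℝ) / 2))
  set X := max t 1 ^ (N / 2 - (d : ℝ) / 2) + t * β ^ (1 / p) with hX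
  have hX0 : 0 < X := by positivity
  obtain ⟨b1, b2, b3⟩ := h₂ M z Q hQ t ht
  obtain ⟨s1, s2⟩ := conv_le hq1 hq2 hM hgN hc₂ hβ b1 b2 b3 x
  set n := ‖vec x - t • firstMoment Q‖ with hn
  have hpt : ∀ y, ‖((n ^ N : ℝ) : ℂ) * ((g y : ℂ) * latticeHeat Q t (x - y))‖ ≤
      2 ^ N * (|g y| * (c₁ * X) + (‖vec y‖ ^ N * |g y|) * ‖latticeHeat Q t (x - y)‖) := by
    intro y
    rw [norm_mul, norm_mul, Complex.norm_real, Complex.norm_real, Real.norm_eq_abs (g y),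
      Real.norm_of_nonneg (by positivity)]
    have hsplit : n ^ N ≤ 2 ^ N *
        (‖vec (x - y) - t • firstMoment Q‖ ^ N + ‖vec y‖ ^ N) := by
      have h3 : n ≤ ‖vec (x - y) - t • firstMoment Q‖ + ‖vec y‖ := by
        rw [hn, vec_sub]
        have := norm_add_le (vec x - vec y - t • firstMoment Q) (vec y)
        rwa [show vec x - vec y - t • firstMoment Q + vec y =
          vec x - t • firstMoment Q by abel] at this
      have h4 : n ≤ 2 * max ‖vec (x - y) - t • firstMoment Q‖ ‖vec y‖ := by
        linarith [le_max_left ‖vec (x - y) - t • firstMoment Q‖ ‖vec y‖,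
          le_max_right ‖vec (x - y) - t • firstMoment Q‖ ‖vec y‖]
      refine (Real.rpow_le_rpow (norm_nonneg _) h4 hN.le).trans ?_
      rw [Real.mul_rpow (by norm_num) (by positivity)]
      gcongr
      rcases max_choice ‖vec (x - y) - t • firstMoment Q‖ ‖vec y‖ with h | h <;> rw [h]
      · linarith [(by positivity : 0 ≤ ‖vec y‖ ^ N)]
      · linarith [(by positivity : 0 ≤ ‖vec (x - y) - t • firstMoment Q‖ ^ N)]
    have h5 := h₁ z Q hQ hQN t ht (x - y)
    calc _ ≤ (2 ^ N * (‖vec (x - y) - t • firstMoment Q‖ ^ N + ‖vec y‖ ^ N)) *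
          (|g y| * ‖latticeHeat Q t (x - y)‖) := by gcongr
      _ = 2 ^ N * (|g y| * (‖vec (x - y) - t • firstMoment Q‖ ^ N * ‖latticeHeat Q t (x - y)‖) +
          (‖vec y‖ ^ N * |g y|) * ‖latticeHeat Q t (x - y)‖) := by ring
      _ ≤ _ := by gcongr
  have hsum := ((hg.summable_abs.mul_right (c₁ * X)).add s1).mul_left (2 ^ N)
  have hI := (hasSum_torusIntegral hK hQ hg.summable_abs ht x).mul_left ((n ^ N : ℝ) : ℂ)
  have h6 := tsum_of_norm_bounded hsum.hasSum hpt
  rw [hI.tsum_eq, tsum_mul_left, (hg.summable_abs.mul_right _).tsum_add s1, tsum_mul_right,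
    norm_mul, Complex.norm_real, Real.norm_of_nonneg (by positivity)] at h6
  have hgM := hg.tsum_abs_le
  calc _ ≤ _ := h6
    _ ≤ 2 ^ N * (M * (c₁ * X) + 3 * M * c₂ * β ^ (1 / q)) := by gcongr
    _ ≤ 2 ^ N * ((c₁ * M + 3 * M * c₂) * X + (c₁ * M + 3 * M * c₂) * β ^ (1 / q)) := by
        have e1 : M * (c₁ * X) ≤ (c₁ * M + 3 * M * c₂) * X := by
          have : 0 ≤ 3 * M * c₂ * X := by positivity
          linarith
        have e2 : 3 * M * c₂ * β ^ (1 / q) ≤ (c₁ * M + 3 * M * c₂) * β ^ (1 / q) := by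
          have : 0 ≤ c₁ * M * β ^ (1 / q) := by positivity
          linarith
        gcongr
    _ = _ := by ring

/-! ### Consequences of membership in the class -/

lemma IsClassQ.isCore {M K ζ : ℝ} (hM : 0 < M) (hζ : 0 < ζ) {Q g : (Fin d → ℤ) → ℝ}
    (h : IsClassQ d M K ζ Q g) : IsCore M K (min ζ 1) Q := by
  have h0 := (lpBound_of_weightedNorm one_pos hM.le h.Q_norm).momBound
  have h2 := (lpBound_of_weightedNorm one_pos hM.le h.Q_moment).momBound
  have hz : 0 < min ζ 1 := lt_min hζ one_pos
  exact ⟨hz, min_le_right _ _, h0, h2.mono one_pos (by linarith), h2.mono two_pos (by linarith),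
    h2.mono (by linarith) (by linarith [min_le_left ζ 1]), h.infrared⟩

lemma IsClassQ.g_mom_zero {M K ζ : ℝ} (hM : 0 < M) {Q g : (Fin d → ℤ) → ℝ}
    (h : IsClassQ d M K ζ Q g) : MomBound 0 M g :=
  (lpBound_of_weightedNorm one_pos hM.le h.g_norm).momBound

lemma IsClassQ.g_mom {M K ζ : ℝ} (hM : 0 < M) (hζ : 0 < ζ) {Q g : (Fin d → ℤ) → ℝ}
    (h : IsClassQ d M K ζ Q g) : MomBound (min ζ 1) M g :=
  (lpBound_of_weightedNorm one_pos hM.le h.g_moment).momBound.mono (lt_min hζ one_pos)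
    (min_le_left _ _)

lemma one_le_min_pExp (hd : 1 ≤ d) {ζ : ℝ} (hζ : 0 < ζ) : 1 ≤ min (pExp d ζ) 2 := by
  refine le_min ?_ one_le_two
  unfold pExp
  split_ifs with h
  · norm_num
  · have h2 : (2 : ℝ) ≤ d := by exact_mod_cast (by omega : 2 ≤ d)
    have h3 : 0 < min ζ 2 := lt_min hζ two_pos
    rw [one_le_div (by linarith)]
    linarith [min_le_right ζ 2]

/-- The exponent `p_d` is small enough for the second moment of `g` to be negligible. -/
lemma le_div_min_pExp (hd : 1 ≤ d) {ζ : ℝ} (hζ : 0 < ζ) :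
    (d : ℝ) / 2 - 1 ≤ (d : ℝ) / 2 * (1 / min (pExp d ζ) 2) := by
  have hd1 : (1 : ℝ) ≤ d := by exact_mod_cast hd
  unfold pExp
  split_ifs with h
  · subst h; norm_num
  · have h2 : (2 : ℝ) ≤ d := by exact_mod_cast (by omega : 2 ≤ d)
    have h3 : 0 < min ζ 2 := lt_min hζ two_pos
    have h5 : 0 < (d : ℝ) / (d - 2 + min ζ 2) := div_pos (by linarith) (by linarith)
    have h4 : 1 / ((d : ℝ) / (d - 2 + min ζ 2)) ≤ 1 / min ((d : ℝ) / (d - 2 + min ζ 2)) 2 :=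
      one_div_le_one_div_of_le (lt_min h5 two_pos) (min_le_left _ _)
    calc (d : ℝ) / 2 - 1 ≤ (d - 2 + min ζ 2) / 2 := by linarith
      _ = (d : ℝ) / 2 * (1 / ((d : ℝ) / (d - 2 + min ζ 2))) := by field_simp
      _ ≤ _ := by gcongr

lemma le_rpow_rpow {τ a b q : ℝ} (hτ : 1 ≤ τ) (h : b ≤ a * (1 / q)) :
    (τ ^ (-a)) ^ (1 / q) ≤ τ ^ (-b) := by
  rw [← Real.rpow_mul (by linarith)]
  exact Real.rpow_le_rpow_of_exponent_le hτ (by linarith)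

lemma torusIntegral_second_moment (hd : 1 ≤ d) {M K ζ : ℝ} (hM : 0 < M) (hK : 0 < K)
    (hζ : 0 < ζ) :
    ∃ c > 0, ∀ Q g : (Fin d → ℤ) → ℝ, IsClassQ d M K ζ Q g → ∀ t > 0, ∀ x : Fin d → ℤ,
      ‖vec x - t • firstMoment Q‖ ^ 2 * ‖torusIntegral Q g t x‖ ≤
        c * max t 1 ^ (1 - (d : ℝ) / 2) := by
  obtain ⟨c, hc, h⟩ := torusIntegral_moment d hM hK two_pos le_rfl one_le_two
    (one_le_min_pExp hd hζ) (min_le_right _ _)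
  refine ⟨c * 3, by positivity, fun Q g hQg t ht x => ?_⟩
  have hQ := hQg.isCore hM hζ
  have h1 := h _ Q g hQ hQ.mom_two.lpBound (hQg.g_mom_zero hM)
    (lpBound_of_weightedNorm (by linarith [one_le_min_pExp hd hζ]) hM.le hQg.g_second) t ht x
  rw [show ‖vec x - t • firstMoment Q‖ ^ (2 : ℝ) = ‖vec x - t • firstMoment Q‖ ^ 2 by
    exact_mod_cast Real.rpow_natCast _ 2] at h1
  refine h1.trans ?_
  have hτ : 1 ≤ max t 1 := le_max_right _ _
  have hτ0 : 0 < max t 1 := by linarith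
  have e2 : t * (max t 1 ^ (-((d : ℝ) / 2))) ^ (1 / (1 : ℝ)) ≤ max t 1 ^ (1 - (d : ℝ) / 2) := by
    rw [div_one, Real.rpow_one, sub_eq_add_neg, Real.rpow_add hτ0, Real.rpow_one]
    gcongr
    exact le_max_left _ _
  have e3 := le_rpow_rpow hτ (le_div_min_pExp hd hζ)
  rw [neg_sub] at e3
  rw [mul_assoc, show (2 : ℝ) / 2 = 1 by norm_num]
  gcongr
  linarith

lemma torusIntegral_high_moment (hd : 3 ≤ d) {M K ζ : ℝ} (hM : 0 < M) (hK : 0 < K)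
    (hζ : 0 < ζ) :
    ∃ c > 0, ∀ Q g : (Fin d → ℤ) → ℝ, IsClassQ d M K ζ Q g → ∀ t > 0, ∀ x : Fin d → ℤ,
      ‖vec x - t • firstMoment Q‖ ^ (d - 1) * ‖torusIntegral Q g t x‖ ≤
        c * max t 1 ^ (-(1 / 2) : ℝ) := by
  rcases hd.eq_or_lt with rfl | hd4
  · obtain ⟨c, hc, h⟩ := torusIntegral_second_moment (d := 3) (by norm_num) hM hK hζ
    refine ⟨c, hc, fun Q g hQg t ht x => (h Q g hQg t ht x).trans_eq ?_⟩
    norm_num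
  · have hd4' : (4 : ℝ) ≤ d := by exact_mod_cast hd4
    have hp1 : 1 ≤ min ((d : ℝ) / 3) 2 := le_min (by linarith) one_le_two
    obtain ⟨c, hc, h⟩ := torusIntegral_moment d (N := (d : ℝ) - 1) hM hK (by linarith) hp1
      (min_le_right _ _) one_le_two le_rfl
    refine ⟨c * 3, by positivity, fun Q g hQg t ht x => ?_⟩
    have h1 := h _ Q g (hQg.isCore hM hζ)
      (lpBound_of_weightedNorm (by linarith) hM.le (hQg.Q_high hd4)) (hQg.g_mom_zero hM)
      (lpBound_of_weightedNorm two_pos hM.le (hQg.g_high hd4)) t ht x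
    rw [show ‖vec x - t • firstMoment Q‖ ^ ((d : ℝ) - 1) =
        ‖vec x - t • firstMoment Q‖ ^ (d - 1) by
      rw [← Real.rpow_natCast, Nat.cast_sub (by omega), Nat.cast_one]] at h1
    refine h1.trans ?_
    have hτ : 1 ≤ max t 1 := le_max_right _ _
    have hτ0 : 0 < max t 1 := by linarith
    have e1 : ((d : ℝ) - 1) / 2 - d / 2 = -(1 / 2) := by ring
    have e2 : t * (max t 1 ^ (-((d : ℝ) / 2))) ^ (1 / min ((d : ℝ) / 3) 2) ≤
        max t 1 ^ (-(1 / 2) : ℝ) := by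
      have h3 : (3 / 2 : ℝ) ≤ (d : ℝ) / 2 * (1 / min ((d : ℝ) / 3) 2) := by
        calc (3 / 2 : ℝ) = (d : ℝ) / 2 * (1 / ((d : ℝ) / 3)) := by field_simp
          _ ≤ _ := by
            gcongr
            exact min_le_left _ _
      calc _ ≤ max t 1 * max t 1 ^ (-(3 / 2) : ℝ) :=
            mul_le_mul (le_max_left _ _) (le_rpow_rpow hτ h3) (by positivity) hτ0.le
        _ = max t 1 ^ (-(1 / 2) : ℝ) := by
            nth_rewrite 1 [← Real.rpow_one (max t 1)]
            rw [← Real.rpow_add hτ0]; norm_num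
    have e3 : (max t 1 ^ (-((d : ℝ) / 2))) ^ (1 / (2 : ℝ)) ≤ max t 1 ^ (-(1 / 2) : ℝ) :=
      le_rpow_rpow hτ (by linarith)
    rw [e1, mul_assoc]
    gcongr
    linarith

/-! ### The Gaussian with covariance `Λ` -/

open scoped MatrixOrder in
/-- Fourier transform of the Gaussian `exp (-t k·Ak / 2)`, by the substitution `u = B k`, where
`A = Bᵀ B`. -/
lemma integral_gaussian_posDef {A : Matrix (Fin d) (Fin d) ℝ} (hA : A.PosDef) {t : ℝ}
    (ht : 0 < t) (w : EuclideanSpace ℝ (Fin d)) :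
    ∫ k : EuclideanSpace ℝ (Fin d), Complex.exp (Complex.I * (inner ℝ k w : ℝ) -
        ((t / 2 * (k.ofLp ⬝ᵥ A.mulVec k.ofLp) : ℝ) : ℂ)) =
      ((1 / Real.sqrt A.det * (2 * Real.pi / t) ^ ((d : ℝ) / 2) *
        Real.exp (-(1 / (2 * t)) * (w.ofLp ⬝ᵥ A⁻¹.mulVec w.ofLp)) : ℝ) : ℂ) := by
  obtain ⟨B, hB⟩ := CStarAlgebra.nonneg_iff_eq_star_mul_self.mp hA.posSemidef.nonneg
  rw [Matrix.star_eq_conjTranspose, Matrix.conjTranspose_eq_transpose_of_trivial] at hB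
  have hdet : A.det = B.det ^ 2 := by rw [hB, Matrix.det_mul, Matrix.det_transpose, sq]
  have hB0 : B.det ≠ 0 := fun h => by
    have := hA.det_pos
    rw [hdet, h] at this; norm_num at this
  have hBu : IsUnit B.det := isUnit_iff_ne_zero.mpr hB0
  set T := Matrix.toEuclideanLin B with hT
  have hTdet : LinearMap.det T = B.det := LinearMap.det_toLpLin 2 B
  set v : EuclideanSpace ℝ (Fin d) := WithLp.toLp 2 (B⁻¹.transpose.mulVec w.ofLp) with hv
  have hin : ∀ k : EuclideanSpace ℝ (Fin d), (inner ℝ v (T k) : ℝ) = inner ℝ k w := by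
    intro k
    rw [EuclideanSpace.inner_eq_star_dotProduct, EuclideanSpace.inner_eq_star_dotProduct]
    simp only [star_trivial, hT, hv, Matrix.ofLp_toLpLin, Matrix.toLin'_apply]
    rw [Matrix.dotProduct_mulVec, Matrix.vecMul_transpose, Matrix.mulVec_mulVec,
      Matrix.nonsing_inv_mul _ hBu, Matrix.one_mulVec, dotProduct_comm]
  have hnorm : ∀ k : EuclideanSpace ℝ (Fin d), ‖T k‖ ^ 2 = k.ofLp ⬝ᵥ A.mulVec k.ofLp := by
    intro k
    rw [← real_inner_self_eq_norm_sq, EuclideanSpace.inner_eq_star_dotProduct]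
    simp only [star_trivial, hT, Matrix.ofLp_toLpLin, Matrix.toLin'_apply]
    rw [hB, ← Matrix.mulVec_mulVec, Matrix.dotProduct_mulVec k.ofLp, Matrix.vecMul_transpose]
  have hvn : ‖v‖ ^ 2 = w.ofLp ⬝ᵥ A⁻¹.mulVec w.ofLp := by
    rw [← real_inner_self_eq_norm_sq, EuclideanSpace.inner_eq_star_dotProduct]
    simp only [star_trivial, hv]
    rw [hB, Matrix.mul_inv_rev, ← Matrix.mulVec_mulVec, Matrix.dotProduct_mulVec w.ofLp,
      ← Matrix.transpose_nonsing_inv, Matrix.mulVec_transpose]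
  have hTm : Measurable T := T.continuous_of_finiteDimensional.measurable
  set G : EuclideanSpace ℝ (Fin d) → ℂ := fun u =>
    Complex.exp (-((t / 2 : ℝ) : ℂ) * (‖u‖ : ℂ) ^ 2 + Complex.I * (inner ℝ v u : ℝ)) with hG
  have hGc : Continuous G := by rw [hG]; fun_prop
  have h1 : ∀ k : EuclideanSpace ℝ (Fin d), Complex.exp (Complex.I * (inner ℝ k w : ℝ) -
      ((t / 2 * (k.ofLp ⬝ᵥ A.mulVec k.ofLp) : ℝ) : ℂ)) = G (T k) := by
    intro k
    rw [hG]
    simp only [hin, ← hnorm]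
    congr 1; push_cast; ring
  simp only [h1]
  rw [← integral_map hTm.aemeasurable hGc.aestronglyMeasurable,
    Measure.map_linearMap_addHaar_eq_smul_addHaar volume (by rw [hTdet]; exact hB0),
    integral_smul_measure, ENNReal.toReal_ofReal (abs_nonneg _), hG,
    GaussianFourier.integral_cexp_neg_mul_sq_norm_add (by simpa using ht), hTdet, Complex.real_smul,
    finrank_euclideanSpace_fin]
  have h2 : Real.sqrt A.det = |B.det| := by rw [hdet, Real.sqrt_sq_eq_abs]
  have h3 : ((Real.pi : ℂ) / ((t / 2 : ℝ) : ℂ)) ^ ((d : ℂ) / 2) =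
      (((2 * Real.pi / t) ^ ((d : ℝ) / 2) : ℝ) : ℂ) := by
    rw [Complex.ofReal_cpow (by positivity)]
    congr 1
    · push_cast; field_simp
    · push_cast; ring
  have h4 : Complex.I ^ 2 * (‖v‖ : ℂ) ^ 2 / (4 * ((t / 2 : ℝ) : ℂ)) =
      ((-(1 / (2 * t)) * (w.ofLp ⬝ᵥ A⁻¹.mulVec w.ofLp) : ℝ) : ℂ) := by
    rw [← hvn, Complex.I_sq]; push_cast; field_simp; ring
  rw [h3, h4, h2, abs_inv, ← Complex.ofReal_exp]
  push_cast; ring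

/-- A symmetric matrix between `a` and `b` in the sense of quadratic forms. -/
structure IsElliptic (a b : ℝ) (A : Matrix (Fin d) (Fin d) ℝ) : Prop where
  symm : A.IsHermitian
  lower : ∀ k : EuclideanSpace ℝ (Fin d), a * ‖k‖ ^ 2 ≤ k.ofLp ⬝ᵥ A.mulVec k.ofLp
  upper : ∀ k : EuclideanSpace ℝ (Fin d), k.ofLp ⬝ᵥ A.mulVec k.ofLp ≤ b * ‖k‖ ^ 2

lemma IsElliptic.posDef {a b : ℝ} (ha : 0 < a) {A : Matrix (Fin d) (Fin d) ℝ}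
    (h : IsElliptic a b A) : A.PosDef := by
  refine Matrix.PosDef.of_dotProduct_mulVec_pos h.symm fun x hx => ?_
  rw [star_trivial]
  refine lt_of_lt_of_le ?_ (h.lower (WithLp.toLp 2 x))
  have : 0 < ‖(WithLp.toLp 2 x : EuclideanSpace ℝ (Fin d))‖ :=
    norm_pos_iff.mpr fun h0 => hx (by simpa using h0)
  positivity

lemma dotProduct_eq_inner (v w : EuclideanSpace ℝ (Fin d)) : v.ofLp ⬝ᵥ w.ofLp = inner ℝ v w := by
  rw [EuclideanSpace.inner_eq_star_dotProduct, star_trivial, dotProduct_comm]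

lemma IsElliptic.inv_bounds {a b : ℝ} (ha : 0 < a) (hb : 0 < b)
    {A : Matrix (Fin d) (Fin d) ℝ} (h : IsElliptic a b A) (w : EuclideanSpace ℝ (Fin d)) :
    ‖w‖ ^ 2 / b ≤ w.ofLp ⬝ᵥ A⁻¹.mulVec w.ofLp ∧ w.ofLp ⬝ᵥ A⁻¹.mulVec w.ofLp ≤ ‖w‖ ^ 2 / a := by
  have hdet : IsUnit A.det := isUnit_iff_ne_zero.mpr (h.posDef ha).det_pos.ne'
  set v : EuclideanSpace ℝ (Fin d) := WithLp.toLp 2 (A⁻¹.mulVec w.ofLp) with hv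
  have hAv : A.mulVec v.ofLp = w.ofLp := by
    rw [hv]
    simp only [Matrix.mulVec_mulVec, Matrix.mul_nonsing_inv _ hdet, Matrix.one_mulVec]
  have hwv : w.ofLp ⬝ᵥ A⁻¹.mulVec w.ofLp = inner ℝ w v := dotProduct_eq_inner w v
  have hvAv : v.ofLp ⬝ᵥ A.mulVec v.ofLp = inner ℝ w v := by
    rw [hAv, dotProduct_eq_inner, real_inner_comm]
  have hvAw : v.ofLp ⬝ᵥ A.mulVec w.ofLp = ‖w‖ ^ 2 := by
    have hsym : A.transpose = A := by
      have := h.symm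
      rwa [Matrix.IsHermitian, Matrix.conjTranspose_eq_transpose_of_trivial] at this
    rw [Matrix.dotProduct_mulVec, ← hsym, Matrix.vecMul_transpose, hAv, dotProduct_eq_inner,
      real_inner_self_eq_norm_sq]
  rw [hwv]
  constructor
  · have h1 := h.upper w
    have h2 := h.lower (v - (1 / b) • w)
    have h3 : (v - (1 / b) • w).ofLp ⬝ᵥ A.mulVec (v - (1 / b) • w).ofLp =
        inner ℝ w v - 2 / b * ‖w‖ ^ 2 + 1 / b ^ 2 * (w.ofLp ⬝ᵥ A.mulVec w.ofLp) := by
      have h4 : w.ofLp ⬝ᵥ A.mulVec v.ofLp = ‖w‖ ^ 2 := by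
        rw [hAv, dotProduct_eq_inner, real_inner_self_eq_norm_sq]
      simp only [WithLp.ofLp_sub, WithLp.ofLp_smul, Matrix.mulVec_sub, Matrix.mulVec_smul,
        sub_dotProduct, dotProduct_sub, smul_dotProduct, dotProduct_smul, hvAw, h4, hvAv,
        smul_eq_mul]
      ring
    rw [h3] at h2
    have h5 : 0 ≤ a * ‖v - (1 / b) • w‖ ^ 2 := by positivity
    have h6 : 1 / b ^ 2 * (w.ofLp ⬝ᵥ A.mulVec w.ofLp) ≤ 1 / b * ‖w‖ ^ 2 := by
      calc _ ≤ 1 / b ^ 2 * (b * ‖w‖ ^ 2) := by gcongr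
        _ = _ := by field_simp
    have h7 : ‖w‖ ^ 2 / b = 2 / b * ‖w‖ ^ 2 - 1 / b * ‖w‖ ^ 2 := by ring
    linarith
  · have h1 := h.lower v
    rw [hvAv] at h1
    have h2 := real_inner_le_norm w v
    have h3 : a * ‖v‖ ≤ ‖w‖ := by
      rcases (norm_nonneg v).eq_or_lt with h0 | h0
      · rw [← h0]; simp
      · nlinarith
    rw [le_div_iff₀ ha]
    nlinarith [norm_nonneg w, norm_nonneg v]

lemma IsElliptic.det_bounds {a b : ℝ} (ha : 0 < a) (hb : 0 < b)
    {A : Matrix (Fin d) (Fin d) ℝ} (h : IsElliptic a b A) :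
    (1 / b) ^ ((d : ℝ) / 2) ≤ 1 / Real.sqrt A.det ∧
      1 / Real.sqrt A.det ≤ (1 / a) ^ ((d : ℝ) / 2) := by
  have h1 := integral_gaussian_posDef (h.posDef ha) one_pos 0
  simp only [inner_zero_right, Complex.ofReal_zero, mul_zero, zero_sub, WithLp.ofLp_zero,
    Matrix.mulVec_zero, dotProduct_zero, Real.exp_zero, mul_one, div_one] at h1
  have h2 : ∫ k : EuclideanSpace ℝ (Fin d), Real.exp (-(1 / 2 * (k.ofLp ⬝ᵥ A.mulVec k.ofLp))) =
      1 / Real.sqrt A.det * (2 * Real.pi) ^ ((d : ℝ) / 2) := by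
    have : ∀ k : EuclideanSpace ℝ (Fin d),
        Complex.exp (-((1 / 2 * (k.ofLp ⬝ᵥ A.mulVec k.ofLp) : ℝ) : ℂ)) =
        ((Real.exp (-(1 / 2 * (k.ofLp ⬝ᵥ A.mulVec k.ofLp))) : ℝ) : ℂ) := fun k => by push_cast; rfl
    simp only [this] at h1
    rw [integral_complex_ofReal] at h1
    exact_mod_cast h1
  have h2pi : (0 : ℝ) < (2 * Real.pi) ^ ((d : ℝ) / 2) := by positivity
  have hg : ∀ c : ℝ, 0 < c → ∫ k : EuclideanSpace ℝ (Fin d), Real.exp (-(c / 2) * ‖k‖ ^ 2) =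
      (1 / c) ^ ((d : ℝ) / 2) * (2 * Real.pi) ^ ((d : ℝ) / 2) := by
    intro c hc
    rw [GaussianFourier.integral_rexp_neg_mul_sq_norm (by positivity), finrank_euclideanSpace_fin,
      ← Real.mul_rpow (by positivity) (by positivity)]
    congr 1; field_simp
  have hcont : Continuous fun k : EuclideanSpace ℝ (Fin d) =>
      Real.exp (-(1 / 2 * (k.ofLp ⬝ᵥ A.mulVec k.ofLp))) := by
    have : Continuous fun k : EuclideanSpace ℝ (Fin d) => A.mulVec k.ofLp :=
      (Continuous.matrix_mulVec continuous_const (PiLp.continuous_ofLp 2 _))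
    exact Real.continuous_exp.comp ((continuous_const.mul
      ((PiLp.continuous_ofLp 2 _).dotProduct this)).neg)
  have hle : ∀ k : EuclideanSpace ℝ (Fin d), Real.exp (-(1 / 2 * (k.ofLp ⬝ᵥ A.mulVec k.ofLp))) ≤
      Real.exp (-(a / 2) * ‖k‖ ^ 2) := fun k =>
    Real.exp_le_exp.mpr (by linarith [h.lower k])
  have hge : ∀ k : EuclideanSpace ℝ (Fin d), Real.exp (-(b / 2) * ‖k‖ ^ 2) ≤
      Real.exp (-(1 / 2 * (k.ofLp ⬝ᵥ A.mulVec k.ofLp))) := fun k =>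
    Real.exp_le_exp.mpr (by linarith [h.upper k])
  have hint : Integrable fun k : EuclideanSpace ℝ (Fin d) =>
      Real.exp (-(1 / 2 * (k.ofLp ⬝ᵥ A.mulVec k.ofLp))) :=
    (integrable_gaussian (b := a / 2) (by positivity)).mono' hcont.aestronglyMeasurable
      (Filter.Eventually.of_forall fun k => by
        rw [Real.norm_of_nonneg (Real.exp_pos _).le]; exact hle k)
  constructor
  · have := integral_mono (integrable_gaussian (b := b / 2) (by positivity)) hint hge
    rw [hg b hb, h2] at this
    exact le_of_mul_le_mul_right this h2pi
  · have := integral_mono hint (integrable_gaussian (b := a / 2) (by positivity)) hle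
    rw [hg a ha, h2] at this
    exact le_of_mul_le_mul_right this h2pi

lemma two_pi_t_rpow {t : ℝ} (ht : 0 < t) :
    1 / (2 * Real.pi * t) ^ ((d : ℝ) / 2) =
      (2 * Real.pi) ^ (-((d : ℝ) / 2)) * t ^ (-((d : ℝ) / 2)) := by
  rw [one_div, ← Real.rpow_neg (by positivity), Real.mul_rpow (by positivity) ht.le]

lemma heatKernel_le (d : ℕ) {a b : ℝ} (ha : 0 < a) (hb : 0 < b) :
    ∃ c > 0, ∀ A : Matrix (Fin d) (Fin d) ℝ, IsElliptic a b A → ∀ η x, ∀ t > 0,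
      heatKernel η A t x ≤
        c * t ^ (-((d : ℝ) / 2)) * Real.exp (-(‖x - t • η‖ ^ 2 / (2 * b * t))) := by
  refine ⟨(1 / a) ^ ((d : ℝ) / 2) * (2 * Real.pi) ^ (-((d : ℝ) / 2)), by positivity,
    fun A hA η x t ht => ?_⟩
  rw [heatKernel, two_pi_t_rpow ht]
  have h1 := (hA.inv_bounds ha hb (x - t • η)).1
  have h2 : -(1 / (2 * t)) * ((x - t • η).ofLp ⬝ᵥ A⁻¹.mulVec (x - t • η).ofLp) ≤
      -(‖x - t • η‖ ^ 2 / (2 * b * t)) := by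
    have h3 : ‖x - t • η‖ ^ 2 / (2 * b * t) = 1 / (2 * t) * (‖x - t • η‖ ^ 2 / b) := by
      field_simp
    rw [h3, neg_mul, neg_le_neg_iff]
    gcongr
  have h4 := (hA.det_bounds ha hb).2
  calc _ ≤ (1 / a) ^ ((d : ℝ) / 2) * ((2 * Real.pi) ^ (-((d : ℝ) / 2)) * t ^ (-((d : ℝ) / 2))) *
        Real.exp (-(‖x - t • η‖ ^ 2 / (2 * b * t))) := by gcongr
    _ = _ := by ring

lemma le_heatKernel (d : ℕ) {a b : ℝ} (ha : 0 < a) (hb : 0 < b) :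
    ∃ c > 0, ∀ A : Matrix (Fin d) (Fin d) ℝ, IsElliptic a b A → ∀ η x, ∀ t > 0,
      c * t ^ (-((d : ℝ) / 2)) * Real.exp (-(‖x - t • η‖ ^ 2 / (2 * a * t))) ≤
        heatKernel η A t x := by
  refine ⟨(1 / b) ^ ((d : ℝ) / 2) * (2 * Real.pi) ^ (-((d : ℝ) / 2)), by positivity,
    fun A hA η x t ht => ?_⟩
  rw [heatKernel, two_pi_t_rpow ht]
  have h1 := (hA.inv_bounds ha hb (x - t • η)).2
  have h2 : -(‖x - t • η‖ ^ 2 / (2 * a * t)) ≤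
      -(1 / (2 * t)) * ((x - t • η).ofLp ⬝ᵥ A⁻¹.mulVec (x - t • η).ofLp) := by
    have h3 : ‖x - t • η‖ ^ 2 / (2 * a * t) = 1 / (2 * t) * (‖x - t • η‖ ^ 2 / a) := by
      field_simp
    rw [h3, neg_mul, neg_le_neg_iff]
    gcongr
  have h4 := (hA.det_bounds ha hb).1
  calc _ = (1 / b) ^ ((d : ℝ) / 2) * ((2 * Real.pi) ^ (-((d : ℝ) / 2)) * t ^ (-((d : ℝ) / 2))) *
        Real.exp (-(‖x - t • η‖ ^ 2 / (2 * a * t))) := by ring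
    _ ≤ _ := by gcongr

lemma heatKernel_nonneg (η : EuclideanSpace ℝ (Fin d)) (A : Matrix (Fin d) (Fin d) ℝ) {t : ℝ}
    (ht : 0 < t) (x : EuclideanSpace ℝ (Fin d)) : 0 ≤ heatKernel η A t x := by
  unfold heatKernel; positivity

lemma heatKernel_eq_integral {a b : ℝ} (ha : 0 < a) {A : Matrix (Fin d) (Fin d) ℝ}
    (hA : IsElliptic a b A) (η x : EuclideanSpace ℝ (Fin d)) {t : ℝ} (ht : 0 < t) :
    ((heatKernel η A t x : ℝ) : ℂ) = (∫ k : EuclideanSpace ℝ (Fin d),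
      Complex.exp (Complex.I * (inner ℝ k (x - t • η) : ℝ) -
        ((t / 2 * (k.ofLp ⬝ᵥ A.mulVec k.ofLp) : ℝ) : ℂ))) / ((2 * Real.pi : ℝ) : ℂ) ^ d := by
  rw [integral_gaussian_posDef (hA.posDef ha) ht, ← Complex.ofReal_pow, ← Complex.ofReal_div]
  congr 1
  rw [heatKernel]
  have h1 : 1 / (2 * Real.pi * t) ^ ((d : ℝ) / 2) =
      (2 * Real.pi / t) ^ ((d : ℝ) / 2) / (2 * Real.pi) ^ d := by
    rw [Real.mul_rpow (by positivity) ht.le, Real.div_rpow (by positivity) ht.le,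
      ← Real.rpow_natCast (2 * Real.pi) d]
    have h2 : (2 * Real.pi) ^ (d : ℝ) =
        (2 * Real.pi) ^ ((d : ℝ) / 2) * (2 * Real.pi) ^ ((d : ℝ) / 2) := by
      rw [← Real.rpow_add (by positivity)]; ring_nf
    rw [h2]
    have h3 : (0 : ℝ) < (2 * Real.pi) ^ ((d : ℝ) / 2) := by positivity
    field_simp
  rw [h1]; ring

/-! ### The local limit theorem -/

lemma quadForm_hasSum {M : ℝ} {Q : (Fin d → ℤ) → ℝ} (h : MomBound 2 M Q)
    (k : EuclideanSpace ℝ (Fin d)) :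
    HasSum (fun y => Q y * (inner ℝ k (vec y)) ^ 2)
      (k.ofLp ⬝ᵥ (secondMoment Q).mulVec k.ofLp) := by
  have h1 : ∀ i j, HasSum (fun y : Fin d → ℤ => k i * k j * ((y i : ℝ) * (y j : ℝ) * Q y))
      (k i * k j * secondMoment Q i j) := by
    intro i j
    have := (h.tsum_le (C := 1) zero_le_one (G := fun y => (y i : ℝ) * (y j : ℝ) * Q y)
      (fun y => by
        rw [one_mul, show ‖vec y‖ ^ (2 : ℝ) = ‖vec y‖ * ‖vec y‖ by
          rw [← sq]; exact_mod_cast Real.rpow_natCast _ 2, norm_mul, norm_mul,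
          Real.norm_eq_abs (Q y)]
        gcongr
        · exact PiLp.norm_apply_le (vec y) i
        · exact PiLp.norm_apply_le (vec y) j)).1.hasSum
    exact this.mul_left _
  have h2 := hasSum_sum (s := Finset.univ) fun i _ => hasSum_sum (s := Finset.univ)
    fun j _ => h1 i j
  convert h2 using 1
  · ext y
    have h3 : (inner ℝ k (vec y) : ℝ) = ∑ i, k i * (y i : ℝ) := by
      simp only [PiLp.inner_apply, vec, RCLike.inner_apply, conj_trivial]
      exact Finset.sum_congr rfl fun i _ => by ring
    rw [h3, sq, Finset.sum_mul_sum, Finset.mul_sum]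
    refine Finset.sum_congr rfl fun i _ => ?_
    rw [Finset.mul_sum]
    exact Finset.sum_congr rfl fun j _ => by ring
  · simp only [dotProduct, Matrix.mulVec, Finset.mul_sum]
    exact Finset.sum_congr rfl fun i _ => Finset.sum_congr rfl fun j _ => by ring

lemma norm_exp_taylor_le {z : ℝ} (hz : 0 < z) (hz1 : z ≤ 1) (a : ℝ) :
    ‖1 - Complex.exp (-(Complex.I * a)) - Complex.I * a - (a : ℂ) ^ 2 / 2‖ ≤
      4 * |a| ^ (2 + z) := by
  rcases le_total |a| 1 with h | h
  · have h1 := Complex.norm_exp_sub_sum_le_norm_mul_exp (-(Complex.I * a)) 3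
    simp only [Finset.sum_range_succ, Finset.sum_range_zero, zero_add, pow_zero,
      Nat.factorial_zero, Nat.cast_one, div_one, pow_one, Nat.factorial_one, Nat.factorial_two,
      Nat.cast_ofNat, norm_neg, norm_mul, Complex.norm_I, one_mul, Complex.norm_real,
      Real.norm_eq_abs] at h1
    have h2 : ‖1 - Complex.exp (-(Complex.I * a)) - Complex.I * a - (a : ℂ) ^ 2 / 2‖ =
        ‖Complex.exp (-(Complex.I * a)) -
          (1 + -(Complex.I * a) + (-(Complex.I * a)) ^ 2 / 2)‖ := by
      rw [← norm_neg]
      congr 1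
      rw [neg_sq, mul_pow, Complex.I_sq]; ring
    rw [h2]
    refine h1.trans ?_
    have h3 : Real.exp |a| ≤ 4 := (Real.exp_le_exp.mpr h).trans (by
      linarith [Real.exp_one_lt_d9])
    have h4 : |a| ^ 3 ≤ |a| ^ (2 + z) := by
      rw [← Real.rpow_natCast]
      exact Real.rpow_le_rpow_of_exponent_ge_of_imp (abs_nonneg a) h (by push_cast; linarith)
        (fun _ h => absurd h (by norm_num))
    calc |a| ^ 3 * Real.exp |a| ≤ |a| ^ (2 + z) * 4 := by gcongr
      _ = _ := mul_comm _ _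
  · have h1 : ‖Complex.exp (-(Complex.I * a))‖ = 1 := by
      rw [show -(Complex.I * a) = ((-a : ℝ) : ℂ) * Complex.I by push_cast; ring,
        Complex.norm_exp_ofReal_mul_I]
    have h2 : |a| ^ 2 ≤ |a| ^ (2 + z) := by
      rw [← Real.rpow_natCast]
      exact Real.rpow_le_rpow_of_exponent_le h (by push_cast; linarith)
    calc _ ≤ ‖(1 : ℂ)‖ + ‖Complex.exp (-(Complex.I * a))‖ + ‖Complex.I * (a : ℂ)‖ +
          ‖(a : ℂ) ^ 2 / 2‖ :=
          (norm_sub_le _ _).trans (add_le_add_left ((norm_sub_le _ _).trans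
            (add_le_add_left (norm_sub_le _ _) _)) _)
      _ = 1 + 1 + |a| + |a| ^ 2 / 2 := by rw [h1]; simp
      _ ≤ 4 * |a| ^ (2 + z) := by nlinarith

lemma norm_one_sub_exp_le {z : ℝ} (hz : 0 < z) (hz1 : z ≤ 1) (a : ℝ) :
    ‖Complex.exp (-(Complex.I * a)) - 1‖ ≤ 2 * |a| ^ z := by
  have h1 : ‖Complex.exp (-(Complex.I * a))‖ = 1 := by
    rw [show -(Complex.I * a) = ((-a : ℝ) : ℂ) * Complex.I by push_cast; ring,
      Complex.norm_exp_ofReal_mul_I]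
  rcases le_total |a| 1 with h | h
  · have h2 : |a| ≤ |a| ^ z := Real.self_le_rpow_of_le_one (abs_nonneg a) h hz1
    have := Complex.norm_exp_sub_one_le (x := -(Complex.I * a)) (by simpa using h)
    rw [norm_neg, norm_mul, Complex.norm_I, one_mul, Complex.norm_real, Real.norm_eq_abs] at this
    linarith
  · have h2 : 1 ≤ |a| ^ z := Real.one_le_rpow h hz.le
    refine (norm_sub_le _ _).trans ?_
    rw [h1, norm_one]; linarith

lemma latChar_neg_eq (y : Fin d → ℤ) (k : EuclideanSpace ℝ (Fin d)) :
    latChar (-y) k = Complex.exp (-(Complex.I * ((inner ℝ k (vec y) : ℝ) : ℂ))) := by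
  rw [latChar, vec_neg, inner_neg_right]; push_cast; ring_nf

lemma norm_latticeFourier_sub_zero_le {M z : ℝ} (hz : 0 < z) (hz1 : z ≤ 1)
    {g : (Fin d → ℤ) → ℝ} (hg : MomBound 0 M g) (hgz : MomBound z M g)
    (k : EuclideanSpace ℝ (Fin d)) :
    ‖latticeFourier g k - latticeFourier g 0‖ ≤ 2 * M * ‖k‖ ^ z := by
  have h1 := (summable_latticeFourier hg.summable_abs k).hasSum.sub
    (summable_latticeFourier hg.summable_abs 0).hasSum
  rw [← latticeFourier_eq, ← latticeFourier_eq] at h1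
  have h2 := (hgz.tsum_le (C := 2 * ‖k‖ ^ z) (by positivity)
    (G := fun y => (g y : ℂ) * latChar (-y) k - (g y : ℂ) * latChar (-y) 0) (fun y => by
      have h3 := norm_one_sub_exp_le hz hz1 (inner ℝ k (vec y))
      rw [← mul_sub, latChar_neg_eq, latChar_neg_eq, inner_zero_left, Complex.ofReal_zero, mul_zero,
        neg_zero, Complex.exp_zero, norm_mul, Complex.norm_real, Real.norm_eq_abs]
      calc _ ≤ |g y| * (2 * (‖k‖ * ‖vec y‖) ^ z) := by
            gcongr
            refine h3.trans ?_
            gcongr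
            exact abs_real_inner_le_norm _ _
        _ = _ := by rw [Real.mul_rpow (norm_nonneg _) (norm_nonneg _)]; ring)).2
  rw [h1.tsum_eq] at h2
  exact h2.trans_eq (by ring)

lemma norm_symbol_taylor_le {M K z : ℝ} {Q : (Fin d → ℤ) → ℝ} (hQ : IsCore M K z Q)
    (k : EuclideanSpace ℝ (Fin d)) :
    ‖latticeFourier Q 0 - latticeFourier Q k - Complex.I * (inner ℝ k (firstMoment Q) : ℝ) -
      ((1 / 2 * (k.ofLp ⬝ᵥ (secondMoment Q).mulVec k.ofLp) : ℝ) : ℂ)‖ ≤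
      4 * M * ‖k‖ ^ (2 + z) := by
  have hs := hQ.mom_zero.summable_abs
  have h1 := (((summable_latticeFourier hs 0).hasSum.sub
    (summable_latticeFourier hs k).hasSum).sub
    ((Complex.hasSum_ofReal.mpr (inner_firstMoment hQ.mom_one k)).mul_left Complex.I)).sub
    (Complex.hasSum_ofReal.mpr ((quadForm_hasSum hQ.mom_two k).mul_left (1 / 2)))
  rw [← latticeFourier_eq, ← latticeFourier_eq] at h1
  have h2 := (hQ.mom_high.tsum_le (C := 4 * ‖k‖ ^ (2 + z)) (by positivity)
    (G := fun y => (Q y : ℂ) * latChar (-y) 0 - (Q y : ℂ) * latChar (-y) k -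
      Complex.I * ((Q y * inner ℝ k (vec y) : ℝ) : ℂ) -
      ((1 / 2 * (Q y * (inner ℝ k (vec y)) ^ 2) : ℝ) : ℂ)) (fun y => by
      have h3 := norm_exp_taylor_le hQ.z_pos hQ.z_le (inner ℝ k (vec y))
      have h4 : (Q y : ℂ) * latChar (-y) 0 - (Q y : ℂ) * latChar (-y) k -
          Complex.I * ((Q y * inner ℝ k (vec y) : ℝ) : ℂ) -
          ((1 / 2 * (Q y * (inner ℝ k (vec y)) ^ 2) : ℝ) : ℂ) =
          (Q y : ℂ) * (1 - Complex.exp (-(Complex.I * ((inner ℝ k (vec y) : ℝ) : ℂ))) -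
            Complex.I * ((inner ℝ k (vec y) : ℝ) : ℂ) -
            ((inner ℝ k (vec y) : ℝ) : ℂ) ^ 2 / 2) := by
        rw [latChar_neg_eq, latChar_neg_eq, inner_zero_left, Complex.ofReal_zero, mul_zero,
          neg_zero, Complex.exp_zero]
        push_cast; ring
      rw [h4, norm_mul, Complex.norm_real, Real.norm_eq_abs]
      have hz2 : 0 ≤ 2 + z := by linarith [hQ.z_pos]
      calc _ ≤ |Q y| * (4 * (‖k‖ * ‖vec y‖) ^ (2 + z)) := by
            gcongr
            refine h3.trans ?_
            gcongr
            exact abs_real_inner_le_norm _ _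
        _ = _ := by rw [Real.mul_rpow (norm_nonneg _) (norm_nonneg _)]; ring)).2
  rw [h1.tsum_eq] at h2
  exact h2.trans_eq (by ring)

/-- The infrared bound makes the covariance matrix elliptic: compare both sides of the second-order
expansion of the symbol at `s k` as `s → 0`. -/
lemma IsCore.elliptic {M K z : ℝ} {Q : (Fin d → ℤ) → ℝ} (hQ : IsCore M K z Q) :
    IsElliptic (2 * K) M (secondMoment Q) := by
  refine ⟨?_, fun k => ?_, fun k => ?_⟩
  · ext i j
    simp only [Matrix.conjTranspose_apply, secondMoment, Matrix.of_apply, star_trivial]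
    exact tsum_congr fun y => by ring
  · set q := k.ofLp ⬝ᵥ (secondMoment Q).mulVec k.ofLp with hq
    have hz := hQ.z_pos
    have hev : ∀ᶠ s in nhdsWithin (0 : ℝ) (Set.Ioi 0),
        K * ‖k‖ ^ 2 ≤ 1 / 2 * q + 4 * M * ‖k‖ ^ (2 + z) * s ^ z := by
      have h1 : ∀ᶠ s in nhdsWithin (0 : ℝ) (Set.Ioi 0), s * ‖k‖ < Real.pi := by
        have : Filter.Tendsto (fun s : ℝ => s * ‖k‖) (nhdsWithin 0 (Set.Ioi 0)) (nhds 0) := by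
          have h0 : Filter.Tendsto (fun s : ℝ => s * ‖k‖) (nhds 0) (nhds (0 * ‖k‖)) :=
            (continuous_id.mul continuous_const).tendsto 0
          rw [zero_mul] at h0
          exact h0.mono_left nhdsWithin_le_nhds
        exact this.eventually_lt_const Real.pi_pos
      filter_upwards [h1, self_mem_nhdsWithin] with s hs1 hs0
      rw [Set.mem_Ioi] at hs0
      have hn : ‖s • k‖ = s * ‖k‖ := by rw [norm_smul, Real.norm_of_nonneg hs0.le]
      have h2 := hQ.infrared (s • k) (mem_torusCube_of_norm_le (by rw [hn]; exact hs1.le))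
      have h3 := (Complex.abs_re_le_norm _).trans (norm_symbol_taylor_le hQ (s • k))
      have h4 : (s • k).ofLp ⬝ᵥ (secondMoment Q).mulVec (s • k).ofLp = s ^ 2 * q := by
        rw [hq]
        simp only [WithLp.ofLp_smul, Matrix.mulVec_smul, smul_dotProduct, dotProduct_smul,
          smul_eq_mul]
        ring
      rw [h4, hn, Complex.sub_re, Complex.sub_re, Complex.ofReal_re, mul_comm Complex.I,
        Complex.re_ofReal_mul, Complex.I_re, mul_zero, sub_zero] at h3
      have h5 := (abs_le.mp h3).2
      rw [hn] at h2
      have h6 : (s * ‖k‖) ^ (2 + z) = s ^ 2 * (‖k‖ ^ (2 + z) * s ^ z) := by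
        rw [Real.mul_rpow hs0.le (norm_nonneg _), Real.rpow_add hs0]
        rw [show s ^ (2 : ℝ) = s ^ 2 by exact_mod_cast Real.rpow_natCast s 2]; ring
      rw [h6] at h5
      have h7 : s ^ 2 * (K * ‖k‖ ^ 2) ≤
          s ^ 2 * (1 / 2 * q + 4 * M * ‖k‖ ^ (2 + z) * s ^ z) := by nlinarith
      exact le_of_mul_le_mul_left h7 (by positivity)
    have hlim : Filter.Tendsto (fun s : ℝ => 1 / 2 * q + 4 * M * ‖k‖ ^ (2 + z) * s ^ z)
        (nhdsWithin 0 (Set.Ioi 0)) (nhds (1 / 2 * q)) := by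
      have h8 : Filter.Tendsto (fun s : ℝ => s ^ z) (nhds 0) (nhds (0 ^ z)) :=
        (Real.continuous_rpow_const hz.le).tendsto 0
      rw [Real.zero_rpow hz.ne'] at h8
      have h9 : Filter.Tendsto (fun s : ℝ => s ^ z) (nhdsWithin 0 (Set.Ioi 0)) (nhds 0) :=
        h8.mono_left nhdsWithin_le_nhds
      simpa using (h9.const_mul (4 * M * ‖k‖ ^ (2 + z))).const_add (1 / 2 * q)
    have := ge_of_tendsto hlim hev
    linarith
  · have h1 := quadForm_hasSum hQ.mom_two k
    have h2 := (hQ.mom_two.tsum_le (C := ‖k‖ ^ 2) (by positivity)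
      (G := fun y => Q y * (inner ℝ k (vec y)) ^ 2) (fun y => by
        rw [norm_mul, Real.norm_eq_abs, norm_pow, Real.norm_eq_abs,
          show ‖vec y‖ ^ (2 : ℝ) = ‖vec y‖ ^ 2 by exact_mod_cast Real.rpow_natCast _ 2]
        calc _ ≤ |Q y| * (‖k‖ * ‖vec y‖) ^ 2 := by
              gcongr; exact abs_real_inner_le_norm _ _
          _ = _ := by ring)).2
    rw [h1.tsum_eq, Real.norm_eq_abs] at h2
    linarith [le_abs_self (k.ofLp ⬝ᵥ (secondMoment Q).mulVec k.ofLp)]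

lemma norm_exp_sub_exp_le {a b : ℂ} {c : ℝ} (ha : a.re ≤ c) (hb : b.re ≤ c) :
    ‖Complex.exp a - Complex.exp b‖ ≤ Real.exp c * ‖a - b‖ :=
  Convex.norm_image_sub_le_of_norm_deriv_le (s := {w : ℂ | w.re ≤ c})
    (fun w _ => Complex.differentiable_exp w) (fun w hw => by
      rw [Complex.deriv_exp, Complex.norm_exp]
      exact Real.exp_le_exp.mpr hw) (convex_halfSpace_re_le c) hb ha

/-- Absorption of polynomial factors by half of a Gaussian. -/
lemma rpow_mul_exp_le {K z : ℝ} (hK : 0 < K) (hz : 0 < z) (hz1 : z ≤ 1) {t κ : ℝ} (ht : 0 < t)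
    (hκ : 0 ≤ κ) :
    κ ^ z * (1 + t * κ ^ 2) * Real.exp (-(K * t) * κ ^ 2) ≤
      (2 + 16 / K ^ 2) * t ^ (-(z / 2)) * Real.exp (-(K / 2 * t) * κ ^ 2) := by
  set s := t * κ ^ 2 with hs
  have hs0 : 0 ≤ s := by positivity
  have h1 : κ ^ z = t ^ (-(z / 2)) * s ^ (z / 2) := by
    rw [hs, Real.mul_rpow ht.le (by positivity), ← mul_assoc, ← Real.rpow_add ht,
      ← Real.rpow_natCast, ← Real.rpow_mul hκ, neg_add_cancel, Real.rpow_zero, one_mul]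
    congr 1; push_cast; ring
  have h2 : s ^ (z / 2) ≤ 1 + s := by
    rcases le_total s 1 with h | h
    · linarith [Real.rpow_le_one hs0 h (by linarith : 0 ≤ z / 2)]
    · have := Real.rpow_le_rpow_of_exponent_le h (by linarith : z / 2 ≤ 1)
      rw [Real.rpow_one] at this; linarith
  have h3 : (1 + s) ^ 2 ≤ (2 + 16 / K ^ 2) * Real.exp (K / 2 * s) := by
    have h4 := Real.quadratic_le_exp_of_nonneg (x := K / 2 * s) (by positivity)
    calc (1 + s) ^ 2 ≤ 2 + 2 * s ^ 2 := by nlinarith [sq_nonneg (1 - s)]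
      _ ≤ (2 + 16 / K ^ 2) * (1 + K / 2 * s + (K / 2 * s) ^ 2 / 2) := by
        have h5 : (2 + 16 / K ^ 2) * (1 + K / 2 * s + (K / 2 * s) ^ 2 / 2) =
            2 + 2 * s ^ 2 + (16 / K ^ 2 + K * s + K ^ 2 * s ^ 2 / 4 + 8 * s / K) := by
          field_simp; ring
        have h6 : 0 ≤ 16 / K ^ 2 + K * s + K ^ 2 * s ^ 2 / 4 + 8 * s / K := by positivity
        linarith
      _ ≤ _ := by gcongr
  have h4 : Real.exp (-(K * t) * κ ^ 2) = Real.exp (-(K / 2 * t) * κ ^ 2) * Real.exp (-(K / 2 * s)) := by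
    rw [← Real.exp_add, hs]; ring_nf
  have h5 : Real.exp (K / 2 * s) * Real.exp (-(K / 2 * s)) = 1 := by rw [← Real.exp_add]; simp
  rw [h1, h4]
  have ht' : 0 < t ^ (-(z / 2)) := Real.rpow_pos_of_pos ht _
  calc _ ≤ t ^ (-(z / 2)) * (1 + s) * (1 + s) *
        (Real.exp (-(K / 2 * t) * κ ^ 2) * Real.exp (-(K / 2 * s))) := by gcongr
    _ = t ^ (-(z / 2)) * Real.exp (-(K / 2 * t) * κ ^ 2) *
        ((1 + s) ^ 2 * Real.exp (-(K / 2 * s))) := by ring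
    _ ≤ t ^ (-(z / 2)) * Real.exp (-(K / 2 * t) * κ ^ 2) *
        ((2 + 16 / K ^ 2) * Real.exp (K / 2 * s) * Real.exp (-(K / 2 * s))) := by gcongr
    _ = _ := by rw [mul_assoc (2 + 16 / K ^ 2), h5]; ring

/-- Local limit theorem: a uniform bound on the difference of the inner integral and its Gaussian
approximation, better by `t^{-z/2}` than the size of each. -/
lemma norm_torusIntegral_sub_heatKernel_le (d : ℕ) {M K z : ℝ} (hM : 0 < M) (hK : 0 < K) :
    ∃ c > 0, ∀ Q g : (Fin d → ℤ) → ℝ, IsCore M K z Q → MomBound 0 M g → MomBound z M g →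
      ∀ t > 0, ∀ x : Fin d → ℤ,
      ‖torusIntegral Q g t x - latticeFourier g 0 *
        (heatKernel (firstMoment Q) (secondMoment Q) t (vec x) : ℝ)‖ ≤
        c * t ^ (-((d : ℝ) / 2) - z / 2) := by
  refine ⟨(2 * M + 4 * M * M) * (2 + 16 / K ^ 2) * (Real.pi / (K / 2)) ^ ((d : ℝ) / 2),
    by positivity, fun Q g hQ hg hgz t ht x => ?_⟩
  have hz := hQ.z_pos
  have hz1 := hQ.z_le
  have hs := hQ.mom_zero.summable_abs
  have hell := hQ.elliptic
  set η := firstMoment Q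
  set A := secondMoment Q
  set γ : EuclideanSpace ℝ (Fin d) → ℂ := fun k => Complex.exp (-((t : ℂ) *
    (Complex.I * (inner ℝ k η : ℝ) + ((1 / 2 * (k.ofLp ⬝ᵥ A.mulVec k.ofLp) : ℝ) : ℂ)))) with hγ
  have hquad : Continuous fun k : EuclideanSpace ℝ (Fin d) => k.ofLp ⬝ᵥ A.mulVec k.ofLp :=
    (PiLp.continuous_ofLp 2 _).dotProduct
      (Continuous.matrix_mulVec continuous_const (PiLp.continuous_ofLp 2 _))
  have hγc : Continuous γ := by
    have h1 : Continuous fun k : EuclideanSpace ℝ (Fin d) =>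
        ((1 / 2 * (k.ofLp ⬝ᵥ A.mulVec k.ofLp) : ℝ) : ℂ) :=
      Complex.continuous_ofReal.comp (continuous_const.mul hquad)
    rw [hγ]; fun_prop
  have hγre : ∀ k, (-((t : ℂ) * (Complex.I * (inner ℝ k η : ℝ) +
      ((1 / 2 * (k.ofLp ⬝ᵥ A.mulVec k.ofLp) : ℝ) : ℂ)))).re ≤ -(K * t) * ‖k‖ ^ 2 := by
    intro k
    rw [Complex.neg_re, Complex.re_ofReal_mul, Complex.add_re, Complex.ofReal_re,
      mul_comm Complex.I, Complex.re_ofReal_mul, Complex.I_re]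
    nlinarith [hell.lower k]
  have hγb : ∀ k, ‖γ k‖ ≤ Real.exp (-(K * t) * ‖k‖ ^ 2) := fun k => by
    rw [hγ, Complex.norm_exp]; exact Real.exp_le_exp.mpr (hγre k)
  have hg0 : ‖latticeFourier g 0‖ ≤ M :=
    (norm_latticeFourier_le hg.summable_abs 0).trans hg.tsum_abs_le
  set F : EuclideanSpace ℝ (Fin d) → ℂ := fun k => latticeFourier g k * heatSymbol Q t k with hF
  have hFm : Measurable F := ((continuous_latticeFourier hg.summable_abs).mul
    (continuous_heatSymbol hs t)).measurable
  -- the pointwise estimate, inside and outside of the torus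
  have hpt : ∀ k, ‖(torusCube d).indicator F k - latticeFourier g 0 * γ k‖ ≤
      (2 * M + 4 * M * M) * (2 + 16 / K ^ 2) * t ^ (-(z / 2)) *
        Real.exp (-(K / 2 * t) * ‖k‖ ^ 2) := by
    intro k
    have habs := rpow_mul_exp_le hK hz hz1 ht (norm_nonneg k)
    have hE := Real.exp_pos (-(K * t) * ‖k‖ ^ 2)
    have hkz : 0 ≤ ‖k‖ ^ z := by positivity
    have h0 : ‖(torusCube d).indicator F k - latticeFourier g 0 * γ k‖ ≤
        (2 * M + 4 * M * M) * (‖k‖ ^ z * (1 + t * ‖k‖ ^ 2) *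
          Real.exp (-(K * t) * ‖k‖ ^ 2)) := by
      by_cases hk : k ∈ torusCube d
      · rw [Set.indicator_of_mem hk, hF]
        have h1 : latticeFourier g k * heatSymbol Q t k - latticeFourier g 0 * γ k =
            (latticeFourier g k - latticeFourier g 0) * heatSymbol Q t k +
            latticeFourier g 0 * (heatSymbol Q t k - γ k) := by ring
        have h2 := norm_latticeFourier_sub_zero_le hz hz1 hg hgz k
        have h3 := norm_heatSymbol_le hQ ht hk
        have h4 : ‖heatSymbol Q t k - γ k‖ ≤ Real.exp (-(K * t) * ‖k‖ ^ 2) *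
            (t * (4 * M * ‖k‖ ^ (2 + z))) := by
          have h5 : (-(t : ℂ) * (latticeFourier Q 0 - latticeFourier Q k)).re ≤
              -(K * t) * ‖k‖ ^ 2 := by
            rw [neg_mul, Complex.neg_re, Complex.re_ofReal_mul]
            nlinarith [hQ.infrared k hk]
          refine (norm_exp_sub_exp_le h5 (hγre k)).trans ?_
          gcongr
          rw [show -(t : ℂ) * (latticeFourier Q 0 - latticeFourier Q k) -
            -((t : ℂ) * (Complex.I * (inner ℝ k η : ℝ) +
              ((1 / 2 * (k.ofLp ⬝ᵥ A.mulVec k.ofLp) : ℝ) : ℂ))) =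
            -((t : ℂ) * (latticeFourier Q 0 - latticeFourier Q k - Complex.I * (inner ℝ k η : ℝ) -
              ((1 / 2 * (k.ofLp ⬝ᵥ A.mulVec k.ofLp) : ℝ) : ℂ))) by ring, norm_neg, norm_mul,
            Complex.norm_real, Real.norm_of_nonneg ht.le]
          gcongr
          exact norm_symbol_taylor_le hQ k
        have h6 : ‖k‖ ^ (2 + z) = ‖k‖ ^ 2 * ‖k‖ ^ z := by
          rw [Real.rpow_add_of_nonneg (norm_nonneg _) zero_le_two hz.le]
          congr 1; exact_mod_cast Real.rpow_natCast _ 2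
        rw [h1]
        calc _ ≤ ‖latticeFourier g k - latticeFourier g 0‖ * ‖heatSymbol Q t k‖ +
              ‖latticeFourier g 0‖ * ‖heatSymbol Q t k - γ k‖ := by
              rw [← norm_mul, ← norm_mul]; exact norm_add_le _ _
          _ ≤ 2 * M * ‖k‖ ^ z * Real.exp (-(K * t) * ‖k‖ ^ 2) +
              M * (Real.exp (-(K * t) * ‖k‖ ^ 2) * (t * (4 * M * ‖k‖ ^ (2 + z)))) := by gcongr
          _ = (2 * M + 4 * M * M * (t * ‖k‖ ^ 2)) *
              (‖k‖ ^ z * Real.exp (-(K * t) * ‖k‖ ^ 2)) := by rw [h6]; ring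
          _ ≤ ((2 * M + 4 * M * M) * (1 + t * ‖k‖ ^ 2)) *
              (‖k‖ ^ z * Real.exp (-(K * t) * ‖k‖ ^ 2)) := by
              have h7 : 0 ≤ t * ‖k‖ ^ 2 := by positivity
              gcongr
              nlinarith [mul_pos hM hM]
          _ = _ := by ring
      · rw [Set.indicator_of_notMem hk, zero_sub, norm_neg, norm_mul]
        have h1 : 1 ≤ ‖k‖ := by
          by_contra hlt
          push Not at hlt
          exact hk (mem_torusCube_of_norm_le (hlt.le.trans (by linarith [Real.pi_gt_three])))
        have h2 : 1 ≤ ‖k‖ ^ z := Real.one_le_rpow h1 hz.le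
        have h3 : 1 ≤ ‖k‖ ^ z * (1 + t * ‖k‖ ^ 2) := one_le_mul_of_one_le_of_one_le h2
          (by have : 0 ≤ t * ‖k‖ ^ 2 := by positivity
              linarith)
        calc _ ≤ M * Real.exp (-(K * t) * ‖k‖ ^ 2) := by gcongr; exact hγb k
          _ ≤ (2 * M + 4 * M * M) * (1 * Real.exp (-(K * t) * ‖k‖ ^ 2)) := by
              rw [one_mul]; gcongr; nlinarith [mul_pos hM hM]
          _ ≤ _ := by gcongr
    calc _ ≤ _ := h0
      _ ≤ _ := mul_le_mul_of_nonneg_left habs (by positivity)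
      _ = _ := by ring
  have hγi : Integrable fun k => latChar x k * (latticeFourier g 0 * γ k) := by
    refine ((integrable_gaussian (d := d) (b := K * t) (by positivity)).const_mul M).mono'
      ((continuous_latChar x).mul (continuous_const.mul hγc)).aestronglyMeasurable
      (Filter.Eventually.of_forall fun k => ?_)
    rw [norm_mul, norm_latChar, one_mul, norm_mul]
    gcongr
    exact hγb k
  have hFi : IntegrableOn (fun k => latChar x k * F k) (torusCube d) :=
    integrableOn_of_norm_le ((continuous_latChar x).measurable.mul hFm) (B := M * 1) fun k hk => by
      rw [norm_mul, norm_latChar, one_mul, hF, norm_mul]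
      gcongr
      · exact (norm_latticeFourier_le hg.summable_abs k).trans hg.tsum_abs_le
      · exact (norm_heatSymbol_le hQ ht hk).trans (Real.exp_le_one_iff.mpr (by
          nlinarith [mul_pos hK ht, sq_nonneg ‖k‖]))
  have hdiff : torusIntegral Q g t x - latticeFourier g 0 *
      (heatKernel η A t (vec x) : ℝ) =
      (∫ k, latChar x k * ((torusCube d).indicator F k - latticeFourier g 0 * γ k)) /
        ((2 * Real.pi : ℝ) : ℂ) ^ d := by
    have h1 : ∀ k, latChar x k * (latticeFourier g 0 * γ k) = latticeFourier g 0 *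
        Complex.exp (Complex.I * (inner ℝ k (vec x - t • η) : ℝ) -
          ((t / 2 * (k.ofLp ⬝ᵥ A.mulVec k.ofLp) : ℝ) : ℂ)) := by
      intro k
      rw [hγ, latChar, mul_left_comm, ← Complex.exp_add, inner_sub_right, real_inner_smul_right]
      congr 2; push_cast; ring
    have h2 : ∀ k, latChar x k * ((torusCube d).indicator F k - latticeFourier g 0 * γ k) =
        (torusCube d).indicator (fun k => latChar x k * F k) k -
          latChar x k * (latticeFourier g 0 * γ k) := by
      intro k
      by_cases hk : k ∈ torusCube d
      · simp only [Set.indicator_of_mem hk]; ring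
      · simp only [Set.indicator_of_notMem hk]; ring
    simp only [h2]
    rw [integral_sub ((integrable_indicator_iff measurableSet_torusCube).mpr hFi) hγi,
      integral_indicator measurableSet_torusCube, sub_div]
    congr 1
    · rw [torusIntegral_eq, torusCoeff]
    · simp only [h1]
      rw [integral_const_mul, mul_div_assoc,
        heatKernel_eq_integral (by positivity : 0 < 2 * K) hell η (vec x) ht]
  rw [hdiff, norm_div, norm_two_pi_pow]
  refine (div_le_self (norm_nonneg _) one_le_two_pi_pow).trans ?_
  have hbound := norm_integral_le_of_norm_le
    (f := fun k => latChar x k * ((torusCube d).indicator F k - latticeFourier g 0 * γ k))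
    ((integrable_gaussian (d := d) (b := K / 2 * t) (by positivity)).const_mul
    ((2 * M + 4 * M * M) * (2 + 16 / K ^ 2) * t ^ (-(z / 2))))
    (Filter.Eventually.of_forall fun k => by
      rw [norm_mul, norm_latChar, one_mul]
      exact hpt k)
  refine hbound.trans_eq ?_
  rw [integral_const_mul, integral_gaussian_scaled (by positivity) ht, sub_eq_add_neg,
    Real.rpow_add ht]
  ring

/-! ### Time integrals -/

/-- Geometric mean, with weights `1/4` and `3/4`, of the bound from the local limit theorem and the
second moment bound. -/
lemma rpow_interp {e c y t a z : ℝ} (he : 0 ≤ e) (hc : 0 < c) (hy : 0 ≤ y) (ht : 0 < t)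
    (h1 : e ≤ c * t ^ (-a - z / 2)) (h2 : y ^ 2 * e ≤ c * t ^ (1 - a)) :
    y ^ (3 / 2 : ℝ) * e ≤ c * t ^ (3 / 4 - a - z / 8) := by
  have h3 : y ^ (3 / 2 : ℝ) * e = (y ^ 2 * e) ^ (3 / 4 : ℝ) * e ^ (1 / 4 : ℝ) := by
    rw [Real.mul_rpow (by positivity) he, mul_assoc, ← Real.rpow_add_of_nonneg he (by norm_num)
      (by norm_num), ← Real.rpow_natCast, ← Real.rpow_mul hy]
    norm_num
  rw [h3]
  calc _ ≤ (c * t ^ (1 - a)) ^ (3 / 4 : ℝ) * (c * t ^ (-a - z / 2)) ^ (1 / 4 : ℝ) := by gcongr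
    _ = (c ^ (3 / 4 : ℝ) * c ^ (1 / 4 : ℝ)) *
        (t ^ ((1 - a) * (3 / 4)) * t ^ ((-a - z / 2) * (1 / 4))) := by
        rw [Real.mul_rpow hc.le (by positivity), Real.mul_rpow hc.le (by positivity),
          ← Real.rpow_mul ht.le, ← Real.rpow_mul ht.le]
        ring
    _ = _ := by
        rw [← Real.rpow_add hc, ← Real.rpow_add ht]
        congr 1
        · norm_num
        · congr 1; ring

lemma integral_window : ∃ J > 0, ∀ t₀ w : ℝ, 0 < w →
    Integrable (fun t : ℝ => (1 + |(t - t₀) / w|) ^ (-(5 / 4) : ℝ)) ∧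
      ∫ t : ℝ, (1 + |(t - t₀) / w|) ^ (-(5 / 4) : ℝ) ≤ w * J := by
  have h0 : Integrable (fun t : ℝ => (1 + |t|) ^ (-(5 / 4) : ℝ)) := by
    have := integrable_one_add_norm (E := ℝ) (μ := volume) (r := 5 / 4) (by simp; norm_num)
    simpa [Real.norm_eq_abs] using this
  set J := ∫ t : ℝ, (1 + |t|) ^ (-(5 / 4) : ℝ) with hJ
  have hJ0 : 0 ≤ J := integral_nonneg fun t => by positivity
  refine ⟨J + 1, by linarith, fun t₀ w hw => ⟨?_, ?_⟩⟩
  · exact (h0.comp_div hw.ne').comp_sub_right t₀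
  · have h1 : ∫ t : ℝ, (1 + |(t - t₀) / w|) ^ (-(5 / 4) : ℝ) =
        ∫ t : ℝ, (1 + |t / w|) ^ (-(5 / 4) : ℝ) :=
      integral_sub_right_eq_self (fun t : ℝ => (1 + |t / w|) ^ (-(5 / 4) : ℝ)) t₀
    have h2 := Measure.integral_comp_div (fun t : ℝ => (1 + |t|) ^ (-(5 / 4) : ℝ)) w
    rw [h1, h2, abs_of_pos hw, smul_eq_mul]
    gcongr
    linarith

/-- Pointwise bound around and after the time `t₀ = n / h` at which the drift reaches distance `n`,
on the scale `√t₀ / h` of the fluctuations of that time. -/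
lemma late_pointwise {a z s₀ c : ℝ} (ha : 1 / 2 ≤ a) (hz : 0 < z)
    (hs₀ : 0 < s₀) (hc : 0 < c) :
    ∃ A > 0, ∀ e n h t : ℝ, 0 ≤ e → 0 < h → 0 < n → 2 ≤ n / h → s₀ ≤ n * h → n / h / 2 ≤ t →
      e ≤ c * t ^ (-a - z / 2) → |n - t * h| ^ 2 * e ≤ c * t ^ (1 - a) →
      e ≤ A * (n / h) ^ (-a - z / 8) *
        (1 + |(t - n / h) / (Real.sqrt (n / h) / h)|) ^ (-(5 / 4) : ℝ) := by
  set κ := 2 + 1 / Real.sqrt s₀ with hκ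
  have hss : 0 < Real.sqrt s₀ := Real.sqrt_pos.mpr hs₀
  have hκ1 : 1 ≤ κ := by
    have : 0 ≤ 1 / Real.sqrt s₀ := by positivity
    linarith
  set q := a + z / 8 + 1 with hq
  refine ⟨c * (2 ^ (a + z / 2) * 2 ^ (5 / 4 : ℝ)) + c * ((κ + 2 ^ q) * 2 ^ (3 / 2 : ℝ)),
    by positivity, fun e n h t he hh hn ht₀ hs ht h1 h2 => ?_⟩
  set t₀ := n / h with ht₀def
  have ht₀pos : 0 < t₀ := by linarith
  have htpos : 0 < t := by linarith
  set r := Real.sqrt t₀ with hr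
  have hr0 : 0 < r := Real.sqrt_pos.mpr ht₀pos
  have hr2 : r ^ 2 = t₀ := Real.sq_sqrt ht₀pos.le
  have hrh : Real.sqrt s₀ ≤ r * h := by
    refine Real.sqrt_le_iff.mpr ⟨by positivity, ?_⟩
    rw [mul_pow, hr2, ht₀def]
    calc s₀ ≤ n * h := hs
      _ = n / h * h ^ 2 := by field_simp
  set u := |(t - t₀) / (r / h)| with hu
  have hu0 : 0 ≤ u := abs_nonneg _
  have hyu : |n - t * h| = r * u := by
    rw [hu, abs_div, abs_of_pos (by positivity : 0 < r / h)]
    have h3 : n - t * h = -(h * (t - t₀)) := by rw [ht₀def]; field_simp; ring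
    rw [h3, abs_neg, abs_mul, abs_of_pos hh]
    field_simp
  have hone : 0 < 1 + u := by linarith
  have hX : 0 < t₀ ^ (-a - z / 8) := Real.rpow_pos_of_pos ht₀pos _
  have hY : 0 < (1 + u) ^ (-(5 / 4) : ℝ) := Real.rpow_pos_of_pos hone _
  have hA1 : 0 ≤ c * (2 ^ (a + z / 2) * 2 ^ (5 / 4 : ℝ)) := by positivity
  have hA2 : 0 ≤ c * ((κ + 2 ^ q) * 2 ^ (3 / 2 : ℝ)) := by positivity
  rcases le_or_gt u 1 with hu1 | hu1
  · have h3 : t ^ (-a - z / 2) ≤ 2 ^ (a + z / 2) * t₀ ^ (-a - z / 8) := by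
      calc t ^ (-a - z / 2) ≤ (t₀ / 2) ^ (-a - z / 2) :=
            Real.rpow_le_rpow_of_nonpos (by linarith) ht (by linarith)
        _ = 2 ^ (a + z / 2) * t₀ ^ (-a - z / 2) := by
            rw [Real.div_rpow ht₀pos.le zero_le_two, show -a - z / 2 = -(a + z / 2) by ring,
              Real.rpow_neg zero_le_two]
            field_simp
        _ ≤ _ := by gcongr <;> linarith
    have h4 : 1 ≤ 2 ^ (5 / 4 : ℝ) * (1 + u) ^ (-(5 / 4) : ℝ) := by
      rw [Real.rpow_neg hone.le, ← div_eq_mul_inv, one_le_div (by positivity)]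
      gcongr; linarith
    calc e ≤ c * (2 ^ (a + z / 2) * t₀ ^ (-a - z / 8)) * 1 := by
          rw [mul_one]; exact h1.trans (by gcongr)
      _ ≤ c * (2 ^ (a + z / 2) * t₀ ^ (-a - z / 8)) *
          (2 ^ (5 / 4 : ℝ) * (1 + u) ^ (-(5 / 4) : ℝ)) := by gcongr
      _ = (c * (2 ^ (a + z / 2) * 2 ^ (5 / 4 : ℝ))) * t₀ ^ (-a - z / 8) *
          (1 + u) ^ (-(5 / 4) : ℝ) := by ring
      _ ≤ _ := by gcongr; linarith
  · have hint := rpow_interp he hc (abs_nonneg _) htpos h1 h2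
    rw [hyu, Real.mul_rpow hr0.le hu0] at hint
    set p := 3 / 4 - a - z / 8 with hp
    -- `t / t₀` lies between `1 / 2` and `κ (1 + u)`
    have htt : t / t₀ ≤ κ * (1 + u) := by
      have h5 : t - t₀ ≤ r / h * u := by
        have : |t - t₀| = r / h * u := by
          rw [hu, abs_div, abs_of_pos (by positivity : 0 < r / h)]; field_simp
        rw [← this]; exact le_abs_self _
      rw [div_le_iff₀ ht₀pos]
      have h6 : r / h ≤ t₀ / Real.sqrt s₀ := by
        rw [div_le_div_iff₀ hh hss, ← hr2]
        calc r * Real.sqrt s₀ ≤ r * (r * h) := by gcongr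
          _ = _ := by ring
      have h7 : r / h * u ≤ t₀ / Real.sqrt s₀ * u := by gcongr
      have h8 : κ * (1 + u) * t₀ = 2 * t₀ + t₀ / Real.sqrt s₀ + 2 * t₀ * u +
          t₀ / Real.sqrt s₀ * u := by rw [hκ]; ring
      have h9 : 0 ≤ t₀ / Real.sqrt s₀ := by positivity
      have h10 : 0 ≤ t₀ * u := by positivity
      linarith
    have htp : t ^ p ≤ (κ + 2 ^ q) * (1 + u) ^ (1 / 4 : ℝ) * t₀ ^ p := by
      have h5 : t ^ p = (t / t₀) ^ p * t₀ ^ p := by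
        rw [← Real.mul_rpow (by positivity) ht₀pos.le]; field_simp
      rw [h5]
      gcongr
      have h1u : 1 ≤ (1 + u) ^ (1 / 4 : ℝ) := Real.one_le_rpow (by linarith) (by norm_num)
      have hq2 : (0 : ℝ) ≤ 2 ^ q := by positivity
      rcases le_total 0 p with hp0 | hp0
      · calc (t / t₀) ^ p ≤ (κ * (1 + u)) ^ p := by gcongr
          _ = κ ^ p * (1 + u) ^ p := Real.mul_rpow (by linarith) hone.le
          _ ≤ κ ^ (1 : ℝ) * (1 + u) ^ (1 / 4 : ℝ) := by
              gcongr
              · linarith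
              · linarith
              · linarith
          _ ≤ _ := by rw [Real.rpow_one]; gcongr; linarith
      · calc (t / t₀) ^ p ≤ (1 / 2) ^ p := Real.rpow_le_rpow_of_nonpos (by norm_num)
              (by rw [le_div_iff₀ ht₀pos]; linarith) hp0
          _ = 2 ^ (-p) := by rw [one_div, Real.inv_rpow zero_le_two, Real.rpow_neg zero_le_two]
          _ ≤ 2 ^ q := by gcongr <;> linarith
          _ ≤ (κ + 2 ^ q) * 1 := by linarith
          _ ≤ _ := by gcongr
    have hr32 : r ^ (3 / 2 : ℝ) = t₀ ^ (3 / 4 : ℝ) := by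
      rw [hr, Real.sqrt_eq_rpow, ← Real.rpow_mul ht₀pos.le]; norm_num
    have hupos : 0 < u ^ (3 / 2 : ℝ) := Real.rpow_pos_of_pos (by linarith) _
    have hu32 : (1 + u) ^ (3 / 2 : ℝ) ≤ 2 ^ (3 / 2 : ℝ) * u ^ (3 / 2 : ℝ) := by
      rw [← Real.mul_rpow zero_le_two hu0]
      gcongr; linarith
    have hsplit : (1 + u) ^ (1 / 4 : ℝ) = (1 + u) ^ (-(5 / 4) : ℝ) * (1 + u) ^ (3 / 2 : ℝ) := by
      rw [← Real.rpow_add hone]; norm_num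
    have htsplit : t₀ ^ p = t₀ ^ (-a - z / 8) * t₀ ^ (3 / 4 : ℝ) := by
      rw [← Real.rpow_add ht₀pos]; congr 1; rw [hp]; ring
    have h11 : t₀ ^ (3 / 4 : ℝ) * u ^ (3 / 2 : ℝ) * e ≤ t₀ ^ (3 / 4 : ℝ) * u ^ (3 / 2 : ℝ) *
        (c * ((κ + 2 ^ q) * 2 ^ (3 / 2 : ℝ)) * t₀ ^ (-a - z / 8) * (1 + u) ^ (-(5 / 4) : ℝ)) := by
      rw [hr32] at hint
      calc _ ≤ c * t ^ p := hint
        _ ≤ c * ((κ + 2 ^ q) * ((1 + u) ^ (-(5 / 4) : ℝ) *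
            (2 ^ (3 / 2 : ℝ) * u ^ (3 / 2 : ℝ))) * (t₀ ^ (-a - z / 8) * t₀ ^ (3 / 4 : ℝ))) := by
            rw [hsplit, htsplit] at htp
            refine mul_le_mul_of_nonneg_left (htp.trans ?_) hc.le
            gcongr
        _ = _ := by ring
    have h12 := le_of_mul_le_mul_left h11 (by positivity)
    refine h12.trans ?_
    gcongr
    linarith

/-- The contribution of times after half of `t₀ = n / h`. -/
lemma late_integral {a z s₀ c : ℝ} (ha : 1 / 2 ≤ a) (hz : 0 < z)
    (hs₀ : 0 < s₀) (hc : 0 < c) :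
    ∃ A > 0, ∀ (e : ℝ → ℝ) (n h : ℝ), (∀ t > 0, 0 ≤ e t) → 0 < h → 0 < n → 2 ≤ n / h →
      s₀ ≤ n * h → (∀ t ≥ 1, e t ≤ c * t ^ (-a - z / 2)) →
      (∀ t ≥ 1, |n - t * h| ^ 2 * e t ≤ c * t ^ (1 - a)) → IntegrableOn e (Set.Ioi 0) →
      ∫ t in Set.Ioi (n / h / 2), e t ≤
        A * (n / h) ^ (-(z / 8)) * ((n / h) ^ (1 / 2 - a) / h) := by
  obtain ⟨A, hA, hpt⟩ := late_pointwise ha hz hs₀ hc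
  obtain ⟨J, hJ, hwin⟩ := integral_window
  refine ⟨A * J, by positivity, fun e n h he hh hn ht₀ hs h1 h2 hint => ?_⟩
  have ht₀pos : 0 < n / h := by linarith
  have hw : 0 < Real.sqrt (n / h) / h := div_pos (Real.sqrt_pos.mpr ht₀pos) hh
  obtain ⟨w1, w2⟩ := hwin (n / h) _ hw
  have h3 : ∫ t in Set.Ioi (n / h / 2), e t ≤ ∫ t in Set.Ioi (n / h / 2),
      A * (n / h) ^ (-a - z / 8) *
        (1 + |(t - n / h) / (Real.sqrt (n / h) / h)|) ^ (-(5 / 4) : ℝ) := by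
    refine setIntegral_mono_on (hint.mono_set (Set.Ioi_subset_Ioi (by linarith)))
      (w1.const_mul _).integrableOn measurableSet_Ioi fun t ht => ?_
    rw [Set.mem_Ioi] at ht
    exact hpt (e t) n h t (he t (by linarith)) hh hn ht₀ hs ht.le (h1 t (by linarith))
      (h2 t (by linarith))
  refine h3.trans ((setIntegral_le_integral (w1.const_mul _)
    (Filter.Eventually.of_forall fun t => ?_)).trans ?_)
  · have : 0 ≤ (n / h) ^ (-a - z / 8) := by positivity
    simp only [Pi.zero_apply]
    positivity
  · rw [integral_const_mul]
    calc _ ≤ A * (n / h) ^ (-a - z / 8) * (Real.sqrt (n / h) / h * J) := by gcongr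
      _ = A * J * ((n / h) ^ (-a - z / 8) * (n / h) ^ (1 / 2 : ℝ)) / h := by
          rw [Real.sqrt_eq_rpow]; ring
      _ = A * J * ((n / h) ^ (-(z / 8)) * (n / h) ^ (1 / 2 - a)) / h := by
          rw [← Real.rpow_add ht₀pos, ← Real.rpow_add ht₀pos]
          congr 3; ring
      _ = _ := by ring

/-- In dimensions one and two, the contribution of times before half of `t₀ = n / h`. -/
lemma early_integral_low {a z s₀ c : ℝ} (ha1 : a ≤ 1) (hz1 : z ≤ 1)
    (hs₀ : 0 < s₀) (hc : 0 < c) :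
    ∃ A > 0, ∀ (e : ℝ → ℝ) (n h : ℝ), (∀ t > 0, 0 ≤ e t) → 0 < h → 1 ≤ n → 2 ≤ n / h →
      s₀ ≤ n * h → (∀ t ≥ 1, e t ≤ c * t ^ (-a - z / 2)) →
      (∀ t ≥ 1, |n - t * h| ^ 2 * e t ≤ c * t ^ (1 - a)) →
      (∀ t > 0, t ≤ 1 → |n - t * h| ^ 2 * e t ≤ c) → IntegrableOn e (Set.Ioi 0) →
      ∫ t in Set.Ioc 0 (n / h / 2), e t ≤
        A * (n / h) ^ (-(z / 8)) * ((n / h) ^ (1 / 2 - a) / h) := by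
  refine ⟨4 * c + c * 2 ^ (3 / 2 : ℝ) * 2 * s₀ ^ (-(1 / 4) : ℝ), by positivity,
    fun e n h he hh hn ht₀ hs h1 h2 h3 hint => ?_⟩
  set t₀ := n / h with ht₀def
  have ht₀pos : 0 < t₀ := by linarith
  have hn0 : 0 < n := by linarith
  set p := 3 / 4 - a - z / 8 with hp
  have hp1 : -(1 / 2) ≤ p := by linarith
  have hy : ∀ t ≤ t₀ / 2, n / 2 ≤ |n - t * h| := by
    intro t ht
    have : t * h ≤ n / 2 := by
      calc t * h ≤ t₀ / 2 * h := by gcongr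
        _ = n / 2 := by rw [ht₀def]; field_simp
    exact le_trans (by linarith) (le_abs_self _)
  have hsplit : Set.Ioc 0 (t₀ / 2) = Set.Ioc 0 1 ∪ Set.Ioc 1 (t₀ / 2) :=
    (Set.Ioc_union_Ioc_eq_Ioc zero_le_one (by linarith)).symm
  have hi1 : IntegrableOn e (Set.Ioc 0 1) := hint.mono_set fun t ht => ht.1
  have hi2 : IntegrableOn e (Set.Ioc 1 (t₀ / 2)) :=
    hint.mono_set fun t ht => lt_trans zero_lt_one ht.1
  rw [hsplit, setIntegral_union (Set.Ioc_disjoint_Ioc_of_le le_rfl) measurableSet_Ioc hi1 hi2]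
  set L := t₀ ^ (1 / 2 - a) / h with hL
  have hnt : n = t₀ * h := by rw [ht₀def]; field_simp
  have b1 : ∫ t in Set.Ioc 0 1, e t ≤ 4 * c * (t₀ ^ (-(z / 8)) * L) := by
    have h4 : ∫ t in Set.Ioc (0 : ℝ) 1, e t ≤ ∫ _t in Set.Ioc (0 : ℝ) 1, 4 * c / n ^ 2 := by
      refine setIntegral_mono_on hi1 (by simp) measurableSet_Ioc
        fun t ht => ?_
      have h5 := h3 t ht.1 ht.2
      have h6 := hy t (by linarith [ht.2])
      rw [le_div_iff₀ (by positivity)]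
      have h7 : (n / 2) ^ 2 * e t ≤ |n - t * h| ^ 2 * e t :=
        mul_le_mul_of_nonneg_right (pow_le_pow_left₀ (by positivity) h6 2) (he t ht.1)
      linarith
    rw [setIntegral_const] at h4
    simp only [Real.volume_real_Ioc, sub_zero, zero_le_one, max_eq_left, smul_eq_mul, one_mul] at h4
    refine h4.trans ?_
    rw [div_eq_mul_inv]
    gcongr
    -- `t₀^{-z/8} L ≥ t₀^{-1} / h = 1 / n`
    have h8 : t₀ ^ (-(z / 8)) * L = t₀ ^ (1 / 2 - a - z / 8) / h := by
      rw [hL, ← mul_div_assoc, ← Real.rpow_add ht₀pos]; congr 2; ring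
    have h9 : t₀ ^ (-1 : ℝ) ≤ t₀ ^ (1 / 2 - a - z / 8) :=
      Real.rpow_le_rpow_of_exponent_le (by linarith) (by linarith)
    rw [h8]
    calc (n ^ 2)⁻¹ ≤ n⁻¹ := inv_anti₀ hn0 (le_self_pow₀ hn two_ne_zero)
      _ = t₀ ^ (-1 : ℝ) / h := by rw [Real.rpow_neg_one, hnt]; field_simp
      _ ≤ _ := by gcongr
  have b2 : ∫ t in Set.Ioc 1 (t₀ / 2), e t ≤
      c * 2 ^ (3 / 2 : ℝ) * 2 * s₀ ^ (-(1 / 4) : ℝ) * (t₀ ^ (-(z / 8)) * L) := by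
    have hpi : IntervalIntegrable (fun t : ℝ => t ^ p) volume 0 (t₀ / 2) :=
      intervalIntegral.intervalIntegrable_rpow' (by linarith)
    have hpo : IntegrableOn (fun t : ℝ => t ^ p) (Set.Ioc 0 (t₀ / 2)) :=
      (intervalIntegrable_iff_integrableOn_Ioc_of_le (by linarith)).mp hpi
    have h4 : ∫ t in Set.Ioc 1 (t₀ / 2), e t ≤
        ∫ t in Set.Ioc 1 (t₀ / 2), c * 2 ^ (3 / 2 : ℝ) * n ^ (-(3 / 2) : ℝ) * t ^ p := by
      refine setIntegral_mono_on hi2 ((hpo.mono_set (Set.Ioc_subset_Ioc_left zero_le_one)).const_mul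
        _) measurableSet_Ioc fun t ht => ?_
      have ht0 : 0 < t := by linarith [ht.1]
      have h5 := rpow_interp (he t ht0) hc (abs_nonneg _) ht0 (h1 t ht.1.le) (h2 t ht.1.le)
      have h6 : (n / 2) ^ (3 / 2 : ℝ) * e t ≤ c * t ^ p :=
        (mul_le_mul_of_nonneg_right (Real.rpow_le_rpow (by positivity) (hy t ht.2) (by norm_num))
          (he t ht0)).trans h5
      rw [Real.div_rpow hn0.le zero_le_two, div_mul_eq_mul_div, div_le_iff₀ (by positivity)] at h6
      rw [Real.rpow_neg hn0.le]
      calc e t = (n ^ (3 / 2 : ℝ))⁻¹ * (n ^ (3 / 2 : ℝ) * e t) := by field_simp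
        _ ≤ (n ^ (3 / 2 : ℝ))⁻¹ * (c * t ^ p * 2 ^ (3 / 2 : ℝ)) := by gcongr
        _ = _ := by ring
    have h5 : ∫ t in Set.Ioc 1 (t₀ / 2), t ^ p ≤ ∫ t in Set.Ioc 0 (t₀ / 2), t ^ p :=
      setIntegral_mono_set hpo
        ((ae_restrict_iff' measurableSet_Ioc).mpr (Filter.Eventually.of_forall fun t ht =>
          Real.rpow_nonneg ht.1.le _))
        (Set.Ioc_subset_Ioc_left zero_le_one).eventuallyLE
    have h6 : ∫ t in Set.Ioc 0 (t₀ / 2), t ^ p ≤ 2 * t₀ ^ (p + 1) := by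
      rw [← intervalIntegral.integral_of_le (by linarith), integral_rpow (Or.inl (by linarith)),
        Real.zero_rpow (by linarith), sub_zero, div_le_iff₀ (by linarith)]
      have h7 : (t₀ / 2) ^ (p + 1) ≤ t₀ ^ (p + 1) := by
        gcongr <;> linarith
      have h8 : 0 ≤ t₀ ^ (p + 1) := by positivity
      nlinarith
    rw [integral_const_mul] at h4
    calc _ ≤ c * 2 ^ (3 / 2 : ℝ) * n ^ (-(3 / 2) : ℝ) * (2 * t₀ ^ (p + 1)) :=
          h4.trans (by gcongr; exact h5.trans h6)
      _ = c * 2 ^ (3 / 2 : ℝ) * 2 * ((n * h) ^ (-(1 / 4) : ℝ) * (t₀ ^ (-(z / 8)) * L)) := by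
          have e1 : n ^ (-(3 / 2) : ℝ) * t₀ ^ (p + 1) =
              (n * h) ^ (-(1 / 4) : ℝ) * (t₀ ^ (-(z / 8)) * L) := by
            have e2 : n * h = t₀ * h ^ (2 : ℝ) := by
              rw [hnt, show h ^ (2 : ℝ) = h ^ 2 by exact_mod_cast Real.rpow_natCast h 2]; ring
            have e3 : L = t₀ ^ (1 / 2 - a) * h ^ (-1 : ℝ) := by
              rw [hL, Real.rpow_neg_one, div_eq_mul_inv]
            rw [e2, e3, hnt, Real.mul_rpow ht₀pos.le hh.le,
              Real.mul_rpow ht₀pos.le (by positivity), ← Real.rpow_mul hh.le]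
            calc _ = t₀ ^ (-(3 / 2) + (p + 1)) * h ^ (-(3 / 2) : ℝ) := by
                  rw [Real.rpow_add ht₀pos (-(3 / 2)) (p + 1)]; ring
              _ = t₀ ^ (-(1 / 4) + (-(z / 8) + (1 / 2 - a))) * h ^ (2 * -(1 / 4) + -1 : ℝ) := by
                  congr 2
                  · rw [hp]; ring
                  · norm_num
              _ = _ := by
                  rw [Real.rpow_add ht₀pos, Real.rpow_add ht₀pos, Real.rpow_add hh]; ring
          rw [← e1]; ring
      _ ≤ c * 2 ^ (3 / 2 : ℝ) * 2 * (s₀ ^ (-(1 / 4) : ℝ) * (t₀ ^ (-(z / 8)) * L)) := by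
          have e4 : (n * h) ^ (-(1 / 4) : ℝ) ≤ s₀ ^ (-(1 / 4) : ℝ) :=
            Real.rpow_le_rpow_of_nonpos hs₀ hs (by norm_num)
          have e5 : 0 ≤ t₀ ^ (-(z / 8)) * L := by positivity
          gcongr
      _ = _ := by ring
  calc _ ≤ _ := add_le_add b1 b2
    _ = _ := by ring

/-- In dimension at least three, all times except those in `(0, T]` at which the drift has covered
more than half of the distance; here `T = n^{2 - δ}` with `δ = z / (d + z)`. -/
lemma early_integral_high (hd : 3 ≤ d) {z c : ℝ} (hz : 0 < z) (hc : 0 < c) :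
    ∃ A > 0, ∀ (e : ℝ → ℝ) (n h : ℝ), (∀ t > 0, 0 ≤ e t) → 0 ≤ h → 1 ≤ n →
      (∀ t > 0, e t ≤ c * t ^ (-((d : ℝ) / 2) - z / 2)) →
      (∀ t > 0, |n - t * h| ^ (d - 1) * e t ≤ c * t ^ (-(1 / 2) : ℝ)) →
      IntegrableOn e (Set.Ioi 0) →
      (∫ t in Set.Ioc 0 (n ^ (2 - z / (d + z))) ∩ {t | t * h ≤ n / 2}, e t) +
        ∫ t in Set.Ioi (n ^ (2 - z / (d + z))), e t ≤
        A * n ^ (2 - (d : ℝ) - z / (d + z) / 2) := by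
  have hd3 : (3 : ℝ) ≤ d := by exact_mod_cast hd
  refine ⟨c * 2 ^ d + 2 * c, by positivity, fun e n h he hh hn h1 h2 hint => ?_⟩
  set δ := z / (d + z) with hδ
  have hδ0 : 0 < δ := by positivity
  have hδz : δ * (d + z) = z := by rw [hδ]; field_simp
  set T := n ^ (2 - δ) with hT
  have hn0 : 0 < n := by linarith
  have hT0 : 0 < T := Real.rpow_pos_of_pos hn0 _
  have hsub : Set.Ioc 0 T ∩ {t | t * h ≤ n / 2} ⊆ Set.Ioc 0 T := Set.inter_subset_left
  have hmeas : MeasurableSet (Set.Ioc 0 T ∩ {t | t * h ≤ n / 2}) :=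
    measurableSet_Ioc.inter (measurableSet_le (by fun_prop) measurable_const)
  have b1 : ∫ t in Set.Ioc 0 T ∩ {t | t * h ≤ n / 2}, e t ≤
      c * 2 ^ d * n ^ (2 - (d : ℝ) - δ / 2) := by
    have hpi : IntegrableOn (fun t : ℝ => t ^ (-(1 / 2) : ℝ)) (Set.Ioc 0 T) :=
      (intervalIntegrable_iff_integrableOn_Ioc_of_le hT0.le).mp
        (intervalIntegral.intervalIntegrable_rpow' (by norm_num))
    have h4 : ∫ t in Set.Ioc 0 T ∩ {t | t * h ≤ n / 2}, e t ≤
        ∫ t in Set.Ioc 0 T ∩ {t | t * h ≤ n / 2},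
          c * (2 / n) ^ (d - 1) * t ^ (-(1 / 2) : ℝ) := by
      refine setIntegral_mono_on (hint.mono_set fun t ht => ht.1.1)
        ((hpi.mono_set hsub).const_mul _) hmeas fun t ht => ?_
      have ht0 : 0 < t := ht.1.1
      have h5 : n / 2 ≤ |n - t * h| := by
        have : t * h ≤ n / 2 := ht.2
        exact le_trans (by linarith) (le_abs_self _)
      have h6 : (n / 2) ^ (d - 1) * e t ≤ c * t ^ (-(1 / 2) : ℝ) :=
        (mul_le_mul_of_nonneg_right (pow_le_pow_left₀ (by positivity) h5 _) (he t ht0)).trans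
          (h2 t ht0)
      calc e t = (2 / n) ^ (d - 1) * ((n / 2) ^ (d - 1) * e t) := by
            rw [← mul_assoc, ← mul_pow]; field_simp; simp
        _ ≤ (2 / n) ^ (d - 1) * (c * t ^ (-(1 / 2) : ℝ)) := by gcongr
        _ = _ := by ring
    have h5 : ∫ t in Set.Ioc 0 T ∩ {t | t * h ≤ n / 2}, t ^ (-(1 / 2) : ℝ) ≤
        ∫ t in Set.Ioc 0 T, t ^ (-(1 / 2) : ℝ) :=
      setIntegral_mono_set hpi
        ((ae_restrict_iff' measurableSet_Ioc).mpr (Filter.Eventually.of_forall fun t ht =>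
          Real.rpow_nonneg ht.1.le _)) hsub.eventuallyLE
    have h6 : ∫ t in Set.Ioc 0 T, t ^ (-(1 / 2) : ℝ) = 2 * T ^ (1 / 2 : ℝ) := by
      rw [← intervalIntegral.integral_of_le hT0.le, integral_rpow (Or.inl (by norm_num)),
        Real.zero_rpow (by norm_num), sub_zero]
      norm_num; ring
    rw [integral_const_mul] at h4
    have h7 : (2 / n) ^ (d - 1) * (2 * T ^ (1 / 2 : ℝ)) =
        2 ^ d * n ^ (2 - (d : ℝ) - δ / 2) := by
      have e1 : (2 : ℝ) ^ d = 2 ^ (d - 1) * 2 := by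
        rw [← pow_succ]; congr 1; omega
      have e2 : n ^ (2 - (d : ℝ) - δ / 2) = (n ^ (d - 1))⁻¹ * T ^ (1 / 2 : ℝ) := by
        rw [hT, ← Real.rpow_mul hn0.le, ← Real.rpow_natCast, ← Real.rpow_neg hn0.le,
          ← Real.rpow_add hn0, Nat.cast_sub (by omega)]
        congr 1; push_cast; ring
      rw [e1, e2, div_pow]; ring
    calc _ ≤ c * (2 / n) ^ (d - 1) * (2 * T ^ (1 / 2 : ℝ)) :=
          h4.trans (by gcongr; exact h5.trans_eq h6)
      _ = c * ((2 / n) ^ (d - 1) * (2 * T ^ (1 / 2 : ℝ))) := by ring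
      _ = _ := by rw [h7]; ring
  have b2 : ∫ t in Set.Ioi T, e t ≤ 2 * c * n ^ (2 - (d : ℝ) - δ / 2) := by
    have hq : -((d : ℝ) / 2) - z / 2 < -1 := by linarith
    have h4 : ∫ t in Set.Ioi T, e t ≤
        ∫ t in Set.Ioi T, c * t ^ (-((d : ℝ) / 2) - z / 2) :=
      setIntegral_mono_on (hint.mono_set (Set.Ioi_subset_Ioi hT0.le))
        ((integrableOn_Ioi_rpow_of_lt hq hT0).const_mul _) measurableSet_Ioi
        fun t ht => h1 t (hT0.trans ht)
    rw [integral_const_mul, integral_Ioi_rpow_of_lt hq hT0] at h4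
    have h5 : -T ^ (-((d : ℝ) / 2) - z / 2 + 1) / (-((d : ℝ) / 2) - z / 2 + 1) ≤
        2 * n ^ (2 - (d : ℝ) - δ / 2) := by
      rw [neg_div, ← div_neg, div_le_iff₀ (by linarith)]
      have e1 : T ^ (-((d : ℝ) / 2) - z / 2 + 1) ≤ n ^ (2 - (d : ℝ) - δ / 2) := by
        rw [hT, ← Real.rpow_mul hn0.le]
        refine Real.rpow_le_rpow_of_exponent_le hn ?_
        nlinarith
      have e2 : 0 ≤ n ^ (2 - (d : ℝ) - δ / 2) := by positivity
      nlinarith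
    calc _ ≤ _ := h4
      _ ≤ c * (2 * n ^ (2 - (d : ℝ) - δ / 2)) := by gcongr
      _ = _ := by ring
  calc _ ≤ _ := add_le_add b1 b2
    _ = _ := by ring

/-- Absolute convergence of a time integral, from a uniform bound and from decay at infinity: by the
dimension if `d ≥ 3`, by the drift if `h > 0`. -/
lemma integrableOn_time {E : Type*} [NormedAddCommGroup E] (hd : 1 ≤ d) {f : ℝ → E}
    (hf : AEStronglyMeasurable f (volume.restrict (Set.Ioi 0))) {B c n h : ℝ}
    (hB : ∀ t > 0, ‖f t‖ ≤ B)
    (h1 : ∀ t ≥ 1, ‖f t‖ ≤ c * t ^ (-((d : ℝ) / 2)))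
    (h2 : ∀ t ≥ 1, |n - t * h| ^ 2 * ‖f t‖ ≤ c * t ^ (1 - (d : ℝ) / 2))
    (hdh : 3 ≤ d ∨ 0 < h) : IntegrableOn f (Set.Ioi 0) := by
  have key : ∃ T q C : ℝ, 0 < T ∧ q < -1 ∧ ∀ t > T, ‖f t‖ ≤ C * t ^ q := by
    rcases hdh with hd3 | hh
    · have hd3' : (3 : ℝ) ≤ d := by exact_mod_cast hd3
      exact ⟨1, -((d : ℝ) / 2), c, one_pos, by linarith, fun t ht => h1 t ht.le⟩
    · have hd1 : (1 : ℝ) ≤ d := by exact_mod_cast hd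
      refine ⟨max 1 (2 * n / h), -1 - (d : ℝ) / 2, 4 * c / h ^ 2,
        lt_max_of_lt_left one_pos, by linarith, fun t ht => ?_⟩
      have ht1 : 1 < t := (le_max_left _ _).trans_lt ht
      have ht0 : 0 < t := by linarith
      have ht2 : 2 * n < t * h := (div_lt_iff₀ hh).mp ((le_max_right _ _).trans_lt ht)
      have h3 : t * h / 2 ≤ |n - t * h| := by
        rw [abs_sub_comm]
        exact le_trans (by linarith) (le_abs_self _)
      have h4 : (t * h / 2) ^ 2 * ‖f t‖ ≤ c * t ^ (1 - (d : ℝ) / 2) :=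
        (mul_le_mul_of_nonneg_right (pow_le_pow_left₀ (by positivity) h3 2)
          (norm_nonneg _)).trans (h2 t ht1.le)
      have h5 : t ^ (1 - (d : ℝ) / 2) = t ^ (-1 - (d : ℝ) / 2) * t ^ 2 := by
        rw [← Real.rpow_natCast, ← Real.rpow_add ht0]; congr 1; push_cast; ring
      rw [h5] at h4
      have h6 : t ^ 2 * (h ^ 2 * ‖f t‖) ≤ t ^ 2 * (4 * c * t ^ (-1 - (d : ℝ) / 2)) := by
        nlinarith
      have h7 := le_of_mul_le_mul_left h6 (by positivity)
      rw [div_mul_eq_mul_div, le_div_iff₀ (by positivity)]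
      linarith
  obtain ⟨T, q, C, hT, hq, hC⟩ := key
  have hsplit : Set.Ioi (0 : ℝ) = Set.Ioc 0 T ∪ Set.Ioi T :=
    (Set.Ioc_union_Ioi_eq_Ioi hT.le).symm
  rw [hsplit]
  refine IntegrableOn.union ?_ ?_
  · exact (integrable_const B).mono'
      (hf.mono_set fun t ht => ht.1)
      ((ae_restrict_iff' measurableSet_Ioc).mpr (Filter.Eventually.of_forall fun t ht => hB t ht.1))
  · exact ((integrableOn_Ioi_rpow_of_lt hq hT).const_mul C).mono'
      (hf.mono_set (Set.Ioi_subset_Ioi hT.le))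
      ((ae_restrict_iff' measurableSet_Ioi).mpr (Filter.Eventually.of_forall fun t ht => hC t ht))

/-! ### Comparison of the Green functions -/

lemma pow_mul_exp_le (N : ℕ) {b : ℝ} (hb : 0 < b) :
    ∃ c > 0, ∀ y ≥ 0, ∀ t > 0, y ^ N * Real.exp (-(y ^ 2 / (2 * b * t))) ≤
      c * t ^ ((N : ℝ) / 2) := by
  refine ⟨(2 * b) ^ ((N : ℝ) / 2) * (1 + N.factorial), by positivity, fun y hy t ht => ?_⟩
  set s := y ^ 2 / (2 * b * t) with hs
  have hs0 : 0 ≤ s := by positivity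
  have h1 : y ^ N = (2 * b) ^ ((N : ℝ) / 2) * t ^ ((N : ℝ) / 2) * s ^ ((N : ℝ) / 2) := by
    rw [← Real.mul_rpow (by positivity) ht.le, ← Real.mul_rpow (by positivity) hs0,
      show 2 * b * t * s = y ^ (2 : ℝ) by
        rw [hs, show y ^ (2 : ℝ) = y ^ 2 by exact_mod_cast Real.rpow_natCast y 2]; field_simp,
      ← Real.rpow_mul hy, ← Real.rpow_natCast]
    congr 1; ring
  have h2 : s ^ ((N : ℝ) / 2) ≤ 1 + s ^ N := by
    rcases le_total s 1 with h | h
    · have := Real.rpow_le_one hs0 h (by positivity : 0 ≤ (N : ℝ) / 2)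
      have h3 : 0 ≤ s ^ N := by positivity
      linarith
    · have := Real.rpow_le_rpow_of_exponent_le h
        (by linarith [(Nat.cast_nonneg N : (0 : ℝ) ≤ N)] : (N : ℝ) / 2 ≤ N)
      rw [Real.rpow_natCast] at this; linarith
  have h3 : s ^ N ≤ N.factorial * Real.exp s := by
    have := Real.pow_div_factorial_le_exp s hs0 N
    rwa [div_le_iff₀' (by positivity)] at this
  have h4 : s ^ ((N : ℝ) / 2) ≤ (1 + N.factorial) * Real.exp s := by
    have := Real.one_le_exp hs0
    calc _ ≤ 1 + s ^ N := h2
      _ ≤ Real.exp s + N.factorial * Real.exp s := add_le_add this h3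
      _ = _ := by ring
  rw [h1, Real.exp_neg]
  calc _ ≤ (2 * b) ^ ((N : ℝ) / 2) * t ^ ((N : ℝ) / 2) * ((1 + N.factorial) * Real.exp s) *
        (Real.exp s)⁻¹ := by gcongr
    _ = (2 * b) ^ ((N : ℝ) / 2) * (1 + N.factorial) * t ^ ((N : ℝ) / 2) := by
        have := (Real.exp_pos s).ne'
        field_simp

lemma heatKernel_moment (d N : ℕ) {a b : ℝ} (ha : 0 < a) (hb : 0 < b) :
    ∃ c > 0, ∀ A : Matrix (Fin d) (Fin d) ℝ, IsElliptic a b A → ∀ η x, ∀ t > 0,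
      ‖x - t • η‖ ^ N * heatKernel η A t x ≤ c * t ^ ((N : ℝ) / 2 - (d : ℝ) / 2) := by
  obtain ⟨c₁, hc₁, h₁⟩ := heatKernel_le d ha hb
  obtain ⟨c₂, hc₂, h₂⟩ := pow_mul_exp_le N hb
  refine ⟨c₁ * c₂, by positivity, fun A hA η x t ht => ?_⟩
  calc _ ≤ ‖x - t • η‖ ^ N * (c₁ * t ^ (-((d : ℝ) / 2)) *
        Real.exp (-(‖x - t • η‖ ^ 2 / (2 * b * t)))) := by
        gcongr; exact h₁ A hA η x t ht
    _ = c₁ * t ^ (-((d : ℝ) / 2)) * (‖x - t • η‖ ^ N *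
        Real.exp (-(‖x - t • η‖ ^ 2 / (2 * b * t)))) := by ring
    _ ≤ c₁ * t ^ (-((d : ℝ) / 2)) * (c₂ * t ^ ((N : ℝ) / 2)) := by
        exact mul_le_mul_of_nonneg_left (h₂ ‖x - t • η‖ (norm_nonneg (x - t • η)) t ht)
          (by positivity)
    _ = _ := by rw [sub_eq_add_neg, Real.rpow_add ht]; ring

lemma norm_sub_smul_of_aligned {x : Fin d → ℤ} (hx : x ≠ 0) {η : EuclideanSpace ℝ (Fin d)}
    (hη : η = ‖η‖ • (‖vec x‖⁻¹ • vec x)) (t : ℝ) :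
    ‖vec x - t • η‖ = |‖vec x‖ - t * ‖η‖| := by
  have hn : 0 < ‖vec x‖ := lt_of_lt_of_le one_pos (one_le_norm_vec hx)
  have h1 : vec x - t • η = ((‖vec x‖ - t * ‖η‖) * ‖vec x‖⁻¹) • vec x := by
    have h2 : t • η = (t * ‖η‖ * ‖vec x‖⁻¹) • vec x := by
      conv_lhs => rw [hη]
      rw [smul_smul, smul_smul]
    rw [h2, sub_mul, sub_smul, mul_inv_cancel₀ hn.ne', one_smul]
  rw [h1, norm_smul, norm_mul, norm_inv, norm_norm, Real.norm_eq_abs]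
  field_simp

lemma measurable_torusIntegral {M K z : ℝ} {Q g : (Fin d → ℤ) → ℝ} (hQ : IsCore M K z Q)
    (hg : MomBound 0 M g) (x : Fin d → ℤ) : Measurable fun t => torusIntegral Q g t x := by
  have h1 := continuous_latticeFourier hQ.mom_zero.summable_abs
  have h2 := continuous_latticeFourier hg.summable_abs
  refine StronglyMeasurable.measurable (StronglyMeasurable.integral_prod_right
    (ν := volume.restrict (torusCube d)) (f := fun (t : ℝ) k =>
      Complex.exp (Complex.I * ((inner ℝ k (vec x) : ℝ) : ℂ)) * latticeFourier g k *
      Complex.exp (-(t : ℂ) * (latticeFourier Q 0 - latticeFourier Q k)) /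
        ((2 * Real.pi : ℝ) : ℂ) ^ d) ?_)
  apply Continuous.stronglyMeasurable
  simp only [Function.uncurry_def]
  fun_prop

lemma measurable_heatKernel (η x : EuclideanSpace ℝ (Fin d)) (A : Matrix (Fin d) (Fin d) ℝ) :
    Measurable fun t => heatKernel η A t x := by
  have h1 : Continuous fun t : ℝ => (x - t • η).ofLp :=
    (PiLp.continuous_ofLp 2 _).comp (by fun_prop)
  have h2 : Measurable fun t : ℝ => (x - t • η).ofLp ⬝ᵥ A⁻¹.mulVec (x - t • η).ofLp :=
    (h1.dotProduct (Continuous.matrix_mulVec continuous_const h1)).measurable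
  unfold heatKernel
  fun_prop

lemma integrableOn_torusIntegral (hd : 1 ≤ d) {M K ζ : ℝ} (hM : 0 < M) (hK : 0 < K)
    (hζ : 0 < ζ) {Q g : (Fin d → ℤ) → ℝ} (h : IsClassQ d M K ζ Q g) {x : Fin d → ℤ} (hx : x ≠ 0)
    (hη : firstMoment Q = ‖firstMoment Q‖ • (‖vec x‖⁻¹ • vec x))
    (hdh : 3 ≤ d ∨ 0 < ‖firstMoment Q‖) :
    IntegrableOn (fun t => torusIntegral Q g t x) (Set.Ioi 0) := by
  have hQ := h.isCore hM hζ
  obtain ⟨c₁, hc₁, h₁⟩ := norm_torusIntegral_le d hM hK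
  obtain ⟨c₂, hc₂, h₂⟩ := torusIntegral_second_moment hd hM hK hζ
  refine integrableOn_time (n := ‖vec x‖) (h := ‖firstMoment Q‖) (B := c₁) (c := max c₁ c₂) hd
    (measurable_torusIntegral hQ (h.g_mom_zero hM) x).aestronglyMeasurable
    (fun t ht => ?_) (fun t ht => ?_) (fun t ht => ?_) hdh
  · refine (h₁ _ Q g hQ (h.g_mom_zero hM) t ht x).trans (mul_le_of_le_one_right hc₁.le ?_)
    exact Real.rpow_le_one_of_one_le_of_nonpos (le_max_right _ _)
      (neg_nonpos.mpr (by positivity))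
  · have := h₁ _ Q g hQ (h.g_mom_zero hM) t (by linarith) x
    rw [max_eq_left ht] at this
    refine this.trans ?_
    gcongr
    exact le_max_left _ _
  · have := h₂ Q g h t (by linarith) x
    rw [max_eq_left ht, norm_sub_smul_of_aligned hx hη] at this
    refine this.trans ?_
    gcongr
    exact le_max_right _ _

lemma integrableOn_heatKernel (hd : 1 ≤ d) {M K z : ℝ} (hM : 0 < M) (hK : 0 < K)
    {Q : (Fin d → ℤ) → ℝ} (hQ : IsCore M K z Q) {x : Fin d → ℤ} (hx : x ≠ 0)
    (hη : firstMoment Q = ‖firstMoment Q‖ • (‖vec x‖⁻¹ • vec x))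
    (hdh : 3 ≤ d ∨ 0 < ‖firstMoment Q‖) :
    IntegrableOn (fun t => heatKernel (firstMoment Q) (secondMoment Q) t (vec x))
      (Set.Ioi 0) := by
  have hell := hQ.elliptic
  have hK2 : 0 < 2 * K := by positivity
  obtain ⟨c₀, hc₀, h₀⟩ := heatKernel_moment d 0 hK2 hM
  obtain ⟨c₂, hc₂, h₂⟩ := heatKernel_moment d 2 hK2 hM
  obtain ⟨c₃, hc₃, h₃⟩ := heatKernel_moment d d hK2 hM
  set n := ‖vec x‖ with hn
  set h := ‖firstMoment Q‖ with hh
  have hn0 : 0 < n := lt_of_lt_of_le one_pos (one_le_norm_vec hx)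
  have hh0 : 0 ≤ h := norm_nonneg _
  set a := n / (2 * (h + 1)) with ha
  have ha0 : 0 < a := by positivity
  have hnorm : ∀ t > 0, ‖heatKernel (firstMoment Q) (secondMoment Q) t (vec x)‖ =
      heatKernel (firstMoment Q) (secondMoment Q) t (vec x) := fun t ht =>
    Real.norm_of_nonneg (heatKernel_nonneg _ _ ht _)
  have hsup : ∀ t > 0, heatKernel (firstMoment Q) (secondMoment Q) t (vec x) ≤
      c₀ * t ^ (-((d : ℝ) / 2)) := fun t ht => by
    have := h₀ _ hell (firstMoment Q) (vec x) t ht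
    simpa using this
  refine integrableOn_time (n := n) (h := h)
    (B := c₃ * (2 / n) ^ d + c₀ * a ^ (-((d : ℝ) / 2))) (c := max c₀ c₂) hd
    (measurable_heatKernel _ _ _).aestronglyMeasurable
    (fun t ht => ?_) (fun t ht => ?_) (fun t ht => ?_) hdh
  · rw [hnorm t ht]
    rcases le_total t a with hta | hta
    · have h4 := h₃ _ hell (firstMoment Q) (vec x) t ht
      rw [norm_sub_smul_of_aligned hx hη, sub_self, Real.rpow_zero, mul_one] at h4
      have h5 : n / 2 ≤ |n - t * h| := by
        have : t * h ≤ n / 2 := by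
          calc t * h ≤ a * (h + 1) := by gcongr; linarith
            _ = n / 2 := by rw [ha]; field_simp
        exact le_trans (by linarith) (le_abs_self _)
      have h6 : (n / 2) ^ d * heatKernel (firstMoment Q) (secondMoment Q) t (vec x) ≤ c₃ :=
        (mul_le_mul_of_nonneg_right (pow_le_pow_left₀ (by positivity) h5 _)
          (heatKernel_nonneg _ _ ht _)).trans h4
      have h7 : 0 ≤ c₀ * a ^ (-((d : ℝ) / 2)) := by positivity
      have h8 : (2 / n) ^ d * (n / 2) ^ d = 1 := by
        rw [← mul_pow, show 2 / n * (n / 2) = 1 by field_simp, one_pow]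
      calc _ = (2 / n) ^ d * ((n / 2) ^ d *
            heatKernel (firstMoment Q) (secondMoment Q) t (vec x)) := by
            rw [← mul_assoc, h8, one_mul]
        _ ≤ (2 / n) ^ d * c₃ := by gcongr
        _ ≤ _ := by linarith
    · have h7 : 0 ≤ c₃ * (2 / n) ^ d := by positivity
      have h8 : t ^ (-((d : ℝ) / 2)) ≤ a ^ (-((d : ℝ) / 2)) :=
        Real.rpow_le_rpow_of_nonpos ha0 hta (neg_nonpos.mpr (by positivity))
      have h9 := hsup t ht
      have h10 : c₀ * t ^ (-((d : ℝ) / 2)) ≤ c₀ * a ^ (-((d : ℝ) / 2)) := by gcongr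
      linarith
  · have ht0 : 0 < t := by linarith
    rw [hnorm t ht0]
    refine (hsup t ht0).trans ?_
    gcongr
    exact le_max_left _ _
  · have ht0 : 0 < t := by linarith
    rw [hnorm t ht0]
    have := h₂ _ hell (firstMoment Q) (vec x) t ht0
    rw [norm_sub_smul_of_aligned hx hη, Nat.cast_ofNat,
      show (2 : ℝ) / 2 = 1 by norm_num] at this
    refine this.trans ?_
    gcongr
    exact le_max_right _ _

/-- The four bounds on the integrand of the error: the local limit theorem, the second moment for
large and for small times, and the moment of order `d - 1`. -/
lemma error_bounds (hd : 1 ≤ d) {M K ζ : ℝ} (hM : 0 < M) (hK : 0 < K) (hζ : 0 < ζ) :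
    ∃ c > 0, ∀ Q g : (Fin d → ℤ) → ℝ, IsClassQ d M K ζ Q g → ∀ x : Fin d → ℤ, x ≠ 0 →
      firstMoment Q = ‖firstMoment Q‖ • (‖vec x‖⁻¹ • vec x) → ∀ e : ℝ → ℝ,
      (∀ t, e t = ‖torusIntegral Q g t x - latticeFourier g 0 *
        (heatKernel (firstMoment Q) (secondMoment Q) t (vec x) : ℝ)‖) →
      (∀ t > 0, e t ≤ c * t ^ (-((d : ℝ) / 2) - min ζ 1 / 2)) ∧
      (∀ t ≥ 1, |‖vec x‖ - t * ‖firstMoment Q‖| ^ 2 * e t ≤ c * t ^ (1 - (d : ℝ) / 2)) ∧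
      (d ≤ 2 → ∀ t > 0, t ≤ 1 → |‖vec x‖ - t * ‖firstMoment Q‖| ^ 2 * e t ≤ c) ∧
      (3 ≤ d → ∀ t > 0,
        |‖vec x‖ - t * ‖firstMoment Q‖| ^ (d - 1) * e t ≤ c * t ^ (-(1 / 2) : ℝ)) := by
  have hK2 : 0 < 2 * K := by positivity
  obtain ⟨c₁, hc₁, h₁⟩ := norm_torusIntegral_sub_heatKernel_le d (z := min ζ 1) hM hK
  obtain ⟨c₂, hc₂, h₂⟩ := torusIntegral_second_moment hd hM hK hζ
  obtain ⟨c₃, hc₃, h₃⟩ := heatKernel_moment d 2 hK2 hM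
  obtain ⟨c₄, hc₄, h₄⟩ := heatKernel_moment d (d - 1) hK2 hM
  have hhigh : ∃ c > 0, 3 ≤ d → ∀ Q g : (Fin d → ℤ) → ℝ, IsClassQ d M K ζ Q g → ∀ t > 0,
      ∀ x : Fin d → ℤ, ‖vec x - t • firstMoment Q‖ ^ (d - 1) * ‖torusIntegral Q g t x‖ ≤
        c * max t 1 ^ (-(1 / 2) : ℝ) := by
    by_cases hd3 : 3 ≤ d
    · obtain ⟨c, hc, h⟩ := torusIntegral_high_moment hd3 hM hK hζ
      exact ⟨c, hc, fun _ => h⟩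
    · exact ⟨1, one_pos, fun h => absurd h hd3⟩
  obtain ⟨c₅, hc₅, h₅⟩ := hhigh
  refine ⟨c₁ + (c₂ + M * c₃) + (c₅ + M * c₄), by positivity, fun Q g h x hx hη e he => ?_⟩
  have hQ := h.isCore hM hζ
  have hg := h.g_mom_zero hM
  have hell := hQ.elliptic
  have hg0 : ‖latticeFourier g 0‖ ≤ M :=
    (norm_latticeFourier_le hg.summable_abs 0).trans hg.tsum_abs_le
  have htri : ∀ t > 0, e t ≤ ‖torusIntegral Q g t x‖ +
      M * heatKernel (firstMoment Q) (secondMoment Q) t (vec x) := by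
    intro t ht
    have hk := heatKernel_nonneg (firstMoment Q) (secondMoment Q) ht (vec x)
    rw [he t]
    refine (norm_sub_le _ _).trans ?_
    rw [norm_mul, Complex.norm_real, Real.norm_of_nonneg hk]
    gcongr
  have hMc : 0 < M * c₃ := by positivity
  have hMc' : 0 < M * c₄ := by positivity
  have hmom : ∀ N : ℕ, ∀ t > 0, |‖vec x‖ - t * ‖firstMoment Q‖| ^ N * e t ≤
      ‖vec x - t • firstMoment Q‖ ^ N * ‖torusIntegral Q g t x‖ +
      M * (‖vec x - t • firstMoment Q‖ ^ N *
        heatKernel (firstMoment Q) (secondMoment Q) t (vec x)) := by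
    intro N t ht
    rw [← norm_sub_smul_of_aligned hx hη]
    calc _ ≤ ‖vec x - t • firstMoment Q‖ ^ N * (‖torusIntegral Q g t x‖ +
          M * heatKernel (firstMoment Q) (secondMoment Q) t (vec x)) := by
          gcongr; exact htri t ht
      _ = _ := by ring
  have hmom2 : ∀ t > 0, |‖vec x‖ - t * ‖firstMoment Q‖| ^ 2 * e t ≤
      c₂ * max t 1 ^ (1 - (d : ℝ) / 2) + M * (c₃ * t ^ (1 - (d : ℝ) / 2)) := by
    intro t ht
    refine (hmom 2 t ht).trans (add_le_add (h₂ Q g h t ht x) ?_)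
    have := h₃ _ hell (firstMoment Q) (vec x) t ht
    rw [Nat.cast_ofNat, show (2 : ℝ) / 2 = 1 by norm_num] at this
    gcongr
  refine ⟨fun t ht => ?_, fun t ht => ?_, fun hd2 t ht ht1 => ?_, fun hd3 t ht => ?_⟩
  · rw [he t]
    refine (h₁ Q g hQ hg (h.g_mom hM hζ) t ht x).trans ?_
    gcongr; linarith
  · have ht0 : 0 < t := by linarith
    have := hmom2 t ht0
    rw [max_eq_left ht] at this
    have hp : 0 ≤ t ^ (1 - (d : ℝ) / 2) := by positivity
    calc _ ≤ _ := this
      _ = (c₂ + M * c₃) * t ^ (1 - (d : ℝ) / 2) := by ring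
      _ ≤ _ := mul_le_mul_of_nonneg_right (by linarith) hp
  · have := hmom2 t ht
    rw [max_eq_right ht1, Real.one_rpow, mul_one] at this
    have hd2' : (d : ℝ) ≤ 2 := by exact_mod_cast hd2
    have hp : t ^ (1 - (d : ℝ) / 2) ≤ 1 := Real.rpow_le_one ht.le ht1 (by linarith)
    have h6 : M * (c₃ * t ^ (1 - (d : ℝ) / 2)) ≤ M * c₃ := by
      rw [← mul_assoc]; exact mul_le_of_le_one_right hMc.le hp
    linarith
  · have h6 := h₅ hd3 Q g h t ht x
    have h7 := h₄ _ hell (firstMoment Q) (vec x) t ht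
    have e1 : ((d - 1 : ℕ) : ℝ) / 2 - (d : ℝ) / 2 = -(1 / 2) := by
      rw [Nat.cast_sub hd]; push_cast; ring
    rw [e1] at h7
    have h8 : max t 1 ^ (-(1 / 2) : ℝ) ≤ t ^ (-(1 / 2) : ℝ) :=
      Real.rpow_le_rpow_of_nonpos ht (le_max_left _ _) (by norm_num)
    have hp : 0 ≤ t ^ (-(1 / 2) : ℝ) := by positivity
    calc _ ≤ c₅ * max t 1 ^ (-(1 / 2) : ℝ) + M * (c₄ * t ^ (-(1 / 2) : ℝ)) := by
          refine (hmom (d - 1) t ht).trans (add_le_add h6 ?_)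
          gcongr
      _ ≤ c₅ * t ^ (-(1 / 2) : ℝ) + M * (c₄ * t ^ (-(1 / 2) : ℝ)) := by gcongr
      _ = (c₅ + M * c₄) * t ^ (-(1 / 2) : ℝ) := by ring
      _ ≤ _ := mul_le_mul_of_nonneg_right (by linarith) hp

lemma mul_le_setIntegral_Ioi {f : ℝ → ℝ} (hf : IntegrableOn f (Set.Ioi 0))
    (h0 : ∀ t > 0, 0 ≤ f t) {a b m : ℝ} (ha : 0 < a) (hab : a ≤ b)
    (hm : ∀ t ∈ Set.Icc a b, m ≤ f t) : (b - a) * m ≤ ∫ t in Set.Ioi 0, f t := by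
  have hsub : Set.Icc a b ⊆ Set.Ioi 0 := fun t ht => lt_of_lt_of_le ha ht.1
  have h1 : ∫ _t in Set.Icc a b, m ≤ ∫ t in Set.Icc a b, f t :=
    setIntegral_mono_on (by simp) (hf.mono_set hsub) measurableSet_Icc hm
  rw [setIntegral_const, Real.volume_real_Icc_of_le hab, smul_eq_mul] at h1
  exact h1.trans (setIntegral_mono_set hf
    ((ae_restrict_iff' measurableSet_Ioi).mpr (Filter.Eventually.of_forall h0)) hsub.eventuallyLE)

/-- Lower bounds for the Brownian Green function, from the time interval of length `√t₀ / h` after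
`t₀ = n / h` if the drift dominates, and from times of order `n²` otherwise. -/
lemma le_brownianGreen (d : ℕ) {M K s₀ : ℝ} (hM : 0 < M) (hK : 0 < K) (hs₀ : 0 < s₀) :
    ∃ c > 0, ∀ z, ∀ Q : (Fin d → ℤ) → ℝ, IsCore M K z Q → ∀ x : Fin d → ℤ, x ≠ 0 →
      firstMoment Q = ‖firstMoment Q‖ • (‖vec x‖⁻¹ • vec x) →
      IntegrableOn (fun t => heatKernel (firstMoment Q) (secondMoment Q) t (vec x))
        (Set.Ioi 0) → ∀ n h : ℝ, n = ‖vec x‖ → h = ‖firstMoment Q‖ →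
      (0 < h → s₀ ≤ n * h → c * ((n / h) ^ (1 / 2 - (d : ℝ) / 2) / h) ≤
        brownianGreen (vec x) (firstMoment Q) (secondMoment Q)) ∧
      (n * h ≤ s₀ → c * n ^ (2 - (d : ℝ)) ≤
        brownianGreen (vec x) (firstMoment Q) (secondMoment Q)) := by
  obtain ⟨c, hc, hlow⟩ := le_heatKernel d (a := 2 * K) (by positivity) hM
  set κ := 1 + 1 / Real.sqrt s₀ with hκ
  have hss : 0 < Real.sqrt s₀ := Real.sqrt_pos.mpr hs₀
  have hκ0 : 0 < κ := by positivity
  set c₁ := c * κ ^ (-((d : ℝ) / 2)) * Real.exp (-(1 / (2 * (2 * K)))) with hc₁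
  set c₂ := c * 2 ^ (-((d : ℝ) / 2)) * Real.exp (-((1 + 2 * s₀) ^ 2 / (2 * (2 * K)))) with hc₂
  have hc₁0 : 0 < c₁ := by positivity
  have hc₂0 : 0 < c₂ := by positivity
  refine ⟨min c₁ c₂, lt_min hc₁0 hc₂0, fun z Q hQ x hx hη hint n h hn hh => ?_⟩
  have hell := hQ.elliptic
  have hn0 : 0 < n := hn ▸ lt_of_lt_of_le one_pos (one_le_norm_vec hx)
  have hh0 : 0 ≤ h := hh ▸ norm_nonneg _
  have hkey : ∀ t > 0, c * t ^ (-((d : ℝ) / 2)) *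
      Real.exp (-(|n - t * h| ^ 2 / (2 * (2 * K) * t))) ≤
      heatKernel (firstMoment Q) (secondMoment Q) t (vec x) := by
    intro t ht
    have := hlow _ hell (firstMoment Q) (vec x) t ht
    rwa [norm_sub_smul_of_aligned hx hη, ← hn, ← hh] at this
  have hd2 : -((d : ℝ) / 2) ≤ 0 := neg_nonpos.mpr (by positivity)
  constructor
  · intro hh1 hs
    set t₀ := n / h with ht₀
    have ht₀0 : 0 < t₀ := by positivity
    set r := Real.sqrt t₀ with hr
    have hr0 : 0 < r := Real.sqrt_pos.mpr ht₀0
    have hr2 : r ^ 2 = t₀ := Real.sq_sqrt ht₀0.le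
    have hrh : Real.sqrt s₀ ≤ r * h := by
      refine Real.sqrt_le_iff.mpr ⟨by positivity, ?_⟩
      rw [mul_pow, hr2, ht₀]
      calc s₀ ≤ n * h := hs
        _ = n / h * h ^ 2 := by field_simp
    have hw : r / h ≤ t₀ / Real.sqrt s₀ := by
      rw [div_le_div_iff₀ hh1 hss, ← hr2]
      calc r * Real.sqrt s₀ ≤ r * (r * h) := by gcongr
        _ = _ := by ring
    have h1 := mul_le_setIntegral_Ioi hint (fun t ht => heatKernel_nonneg _ _ ht _)
      (a := t₀) (b := t₀ + r / h) (m := c₁ * t₀ ^ (-((d : ℝ) / 2))) ht₀0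
      (by have : 0 < r / h := by positivity
          linarith) (fun t ht => ?_)
    · rw [brownianGreen]
      refine le_trans ?_ h1
      have h2 : t₀ ^ (1 / 2 - (d : ℝ) / 2) = r * t₀ ^ (-((d : ℝ) / 2)) := by
        rw [hr, Real.sqrt_eq_rpow, ← Real.rpow_add ht₀0]; ring_nf
      rw [h2, add_sub_cancel_left]
      calc _ ≤ c₁ * (r * t₀ ^ (-((d : ℝ) / 2)) / h) := by gcongr; exact min_le_left _ _
        _ = _ := by ring
    · have ht0 : 0 < t := lt_of_lt_of_le ht₀0 ht.1
      refine le_trans ?_ (hkey t ht0)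
      have h2 : |n - t * h| ≤ r := by
        have h3 : n - t * h = -(h * (t - t₀)) := by rw [ht₀]; field_simp; ring
        rw [h3, abs_neg, abs_of_nonneg (mul_nonneg hh0 (by linarith [ht.1]))]
        calc h * (t - t₀) ≤ h * (r / h) := by gcongr; linarith [ht.2]
          _ = r := by field_simp
      have h4 : |n - t * h| ^ 2 / (2 * (2 * K) * t) ≤ 1 / (2 * (2 * K)) := by
        rw [div_le_div_iff₀ (by positivity) (by positivity), one_mul, mul_comm]
        gcongr
        calc |n - t * h| ^ 2 ≤ r ^ 2 := by gcongr
          _ ≤ t := hr2.trans_le ht.1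
      have h5 : (κ * t₀) ^ (-((d : ℝ) / 2)) ≤ t ^ (-((d : ℝ) / 2)) := by
        refine Real.rpow_le_rpow_of_nonpos ht0 ?_ hd2
        calc t ≤ t₀ + r / h := ht.2
          _ ≤ t₀ + t₀ / Real.sqrt s₀ := by gcongr
          _ = κ * t₀ := by rw [hκ]; ring
      rw [Real.mul_rpow hκ0.le ht₀0.le] at h5
      calc c₁ * t₀ ^ (-((d : ℝ) / 2)) = c * (κ ^ (-((d : ℝ) / 2)) * t₀ ^ (-((d : ℝ) / 2))) *
            Real.exp (-(1 / (2 * (2 * K)))) := by rw [hc₁]; ring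
        _ ≤ _ := by gcongr
  · intro hs
    have h1 := mul_le_setIntegral_Ioi hint (fun t ht => heatKernel_nonneg _ _ ht _)
      (a := n ^ 2) (b := 2 * n ^ 2) (m := c₂ * (n ^ 2) ^ (-((d : ℝ) / 2))) (by positivity)
      (by nlinarith) (fun t ht => ?_)
    · rw [brownianGreen]
      refine le_trans ?_ h1
      have h2 : n ^ (2 - (d : ℝ)) = n ^ 2 * (n ^ 2) ^ (-((d : ℝ) / 2)) := by
        rw [← Real.rpow_natCast n 2, ← Real.rpow_mul hn0.le, ← Real.rpow_add hn0]
        congr 1; push_cast; ring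
      rw [h2]
      calc _ ≤ c₂ * (n ^ 2 * (n ^ 2) ^ (-((d : ℝ) / 2))) := by gcongr; exact min_le_right _ _
        _ = _ := by ring
    · have ht0 : 0 < t := lt_of_lt_of_le (by positivity) ht.1
      refine le_trans ?_ (hkey t ht0)
      have h2 : |n - t * h| ≤ (1 + 2 * s₀) * n := by
        have h3 : t * h ≤ 2 * s₀ * n := by
          calc t * h ≤ 2 * n ^ 2 * h := by gcongr; exact ht.2
            _ = 2 * (n * h) * n := by ring
            _ ≤ _ := by gcongr
        have h4 : 0 ≤ t * h := by positivity
        have h5 : 0 ≤ s₀ * n := by positivity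
        rw [abs_le]
        constructor <;> linarith
      have h4 : |n - t * h| ^ 2 / (2 * (2 * K) * t) ≤ (1 + 2 * s₀) ^ 2 / (2 * (2 * K)) := by
        rw [div_le_div_iff₀ (by positivity) (by positivity)]
        calc |n - t * h| ^ 2 * (2 * (2 * K)) ≤ ((1 + 2 * s₀) * n) ^ 2 * (2 * (2 * K)) := by gcongr
          _ = (1 + 2 * s₀) ^ 2 * (2 * (2 * K) * n ^ 2) := by ring
          _ ≤ _ := by gcongr; exact ht.1
      have h5 : (2 * n ^ 2) ^ (-((d : ℝ) / 2)) ≤ t ^ (-((d : ℝ) / 2)) :=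
        Real.rpow_le_rpow_of_nonpos ht0 ht.2 hd2
      rw [Real.mul_rpow zero_le_two (by positivity)] at h5
      calc _ = c * (2 ^ (-((d : ℝ) / 2)) * (n ^ 2) ^ (-((d : ℝ) / 2))) *
            Real.exp (-((1 + 2 * s₀) ^ 2 / (2 * (2 * K)))) := by rw [hc₂]; ring
        _ ≤ _ := by gcongr

/-! ### The relative error of the Gaussian approximation -/

/-- The error integral is smaller than the Brownian Green function by a power of the distance, for
`d ≤ 2`, where the drift is bounded below by a multiple of `1 / n`. -/
lemma error_le_low (hd : 1 ≤ d) (hd2 : d ≤ 2) {M K ζ s₀ : ℝ} (hM : 0 < M) (hK : 0 < K)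
    (hζ : 0 < ζ) (hs₀ : 0 < s₀) :
    ∃ ε > (0 : ℝ), ∃ A > (0 : ℝ), ∃ R > (0 : ℝ), ∀ Q g : (Fin d → ℤ) → ℝ, IsClassQ d M K ζ Q g →
      ∀ x : Fin d → ℤ, x ≠ 0 → firstMoment Q = ‖firstMoment Q‖ • (‖vec x‖⁻¹ • vec x) →
      s₀ ≤ ‖vec x‖ * ‖firstMoment Q‖ → ∀ e : ℝ → ℝ,
      (∀ t, e t = ‖torusIntegral Q g t x - latticeFourier g 0 *
        (heatKernel (firstMoment Q) (secondMoment Q) t (vec x) : ℝ)‖) →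
      IntegrableOn e (Set.Ioi 0) →
      IntegrableOn (fun t => heatKernel (firstMoment Q) (secondMoment Q) t (vec x))
        (Set.Ioi 0) → R ≤ ‖vec x‖ →
      ∫ t in Set.Ioi 0, e t ≤ A * ‖vec x‖ ^ (-ε) *
        brownianGreen (vec x) (firstMoment Q) (secondMoment Q) := by
  obtain ⟨c, hc, hb⟩ := error_bounds hd hM hK hζ
  have hz : 0 < min ζ 1 := lt_min hζ one_pos
  have ha : 1 / 2 ≤ (d : ℝ) / 2 := by
    have : (1 : ℝ) ≤ d := by exact_mod_cast hd
    linarith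
  have ha1 : (d : ℝ) / 2 ≤ 1 := by
    have : (d : ℝ) ≤ 2 := by exact_mod_cast hd2
    linarith
  obtain ⟨A₁, hA₁, hlate⟩ := late_integral ha hz hs₀ hc
  obtain ⟨A₂, hA₂, hearly⟩ := early_integral_low ha1 (min_le_right ζ 1) hs₀ hc
  obtain ⟨c₀, hc₀, hgreen⟩ := le_brownianGreen d hM hK hs₀
  set z := min ζ 1 with hzdef
  refine ⟨z / 8, by positivity, (A₁ + A₂) * M ^ (z / 8) / c₀, by positivity, max 1 (2 * M),
    by positivity, fun Q g h x hx hη hs e he hint hint' hR => ?_⟩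
  obtain ⟨b1, b2, b3, -⟩ := hb Q g h x hx hη e he
  have hQ := h.isCore hM hζ
  have hhM : ‖firstMoment Q‖ ≤ M := norm_firstMoment_le hM.le hQ.mom_one
  have hgr := (hgreen _ Q hQ x hx hη hint' _ _ rfl rfl).1
  set n := ‖vec x‖ with hn
  set η := ‖firstMoment Q‖ with hηdef
  have hn1 : 1 ≤ n := (le_max_left _ _).trans hR
  have hn0 : 0 < n := by linarith
  have hη0 : 0 < η := pos_of_mul_pos_right (hs₀.trans_le hs) hn0.le
  have hnM : n / M ≤ n / η := by gcongr
  have ht₀ : 2 ≤ n / η := le_trans (by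
    rw [le_div_iff₀ hM]; exact (le_max_right _ _).trans hR) hnM
  have he0 : ∀ t > 0, 0 ≤ e t := fun t _ => by rw [he t]; exact norm_nonneg _
  have hb1 : ∀ t ≥ 1, e t ≤ c * t ^ (-((d : ℝ) / 2) - z / 2) := fun t ht => b1 t (by linarith)
  have hE := hearly e n η he0 hη0 hn1 ht₀ hs hb1 b2 (b3 hd2) hint
  have hL := hlate e n η he0 hη0 hn0 ht₀ hs hb1 b2 hint
  have hcut : 0 ≤ n / η / 2 := by linarith
  have hsplit : ∫ t in Set.Ioi 0, e t =
      (∫ t in Set.Ioc 0 (n / η / 2), e t) + ∫ t in Set.Ioi (n / η / 2), e t := by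
    rw [← Set.Ioc_union_Ioi_eq_Ioi hcut] at hint ⊢
    exact setIntegral_union (Set.Ioc_disjoint_Ioi le_rfl) measurableSet_Ioi
      (hint.mono_set Set.subset_union_left) (hint.mono_set Set.subset_union_right)
  set L := (n / η) ^ (1 / 2 - (d : ℝ) / 2) / η with hLdef
  have hL0 : 0 < L := by positivity
  have hLC : L ≤ brownianGreen (vec x) (firstMoment Q) (secondMoment Q) / c₀ := by
    rw [le_div_iff₀' hc₀]; exact hgr hη0 hs
  have hpow : (n / η) ^ (-(z / 8)) ≤ M ^ (z / 8) * n ^ (-(z / 8)) := by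
    calc (n / η) ^ (-(z / 8)) ≤ (n / M) ^ (-(z / 8)) :=
          Real.rpow_le_rpow_of_nonpos (by positivity) hnM (neg_nonpos.mpr (by positivity))
      _ = M ^ (z / 8) * n ^ (-(z / 8)) := by
          rw [Real.div_rpow hn0.le hM.le, Real.rpow_neg hM.le, div_inv_eq_mul, mul_comm]
  rw [hsplit]
  calc _ ≤ A₂ * (n / η) ^ (-(z / 8)) * L + A₁ * (n / η) ^ (-(z / 8)) * L := add_le_add hE hL
    _ = (A₁ + A₂) * (n / η) ^ (-(z / 8)) * L := by ring
    _ ≤ (A₁ + A₂) * (M ^ (z / 8) * n ^ (-(z / 8))) *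
        (brownianGreen (vec x) (firstMoment Q) (secondMoment Q) / c₀) := by gcongr
    _ = _ := by ring

/-- The error integral is smaller than the Brownian Green function by a power of the distance, for
`d ≥ 3`. The times with `|n - t h|` small compared with `n` enter only if `n h` is at least a
constant. -/
lemma error_le_high (hd : 3 ≤ d) {M K ζ : ℝ} (hM : 0 < M) (hK : 0 < K) (hζ : 0 < ζ) :
    ∃ ε > (0 : ℝ), ∃ A > (0 : ℝ), ∃ R > (0 : ℝ), ∀ Q g : (Fin d → ℤ) → ℝ, IsClassQ d M K ζ Q g →
      ∀ x : Fin d → ℤ, x ≠ 0 → firstMoment Q = ‖firstMoment Q‖ • (‖vec x‖⁻¹ • vec x) →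
      ∀ e : ℝ → ℝ,
      (∀ t, e t = ‖torusIntegral Q g t x - latticeFourier g 0 *
        (heatKernel (firstMoment Q) (secondMoment Q) t (vec x) : ℝ)‖) →
      IntegrableOn e (Set.Ioi 0) →
      IntegrableOn (fun t => heatKernel (firstMoment Q) (secondMoment Q) t (vec x))
        (Set.Ioi 0) → R ≤ ‖vec x‖ →
      ∫ t in Set.Ioi 0, e t ≤ A * ‖vec x‖ ^ (-ε) *
        brownianGreen (vec x) (firstMoment Q) (secondMoment Q) := by
  obtain ⟨c, hc, hb⟩ := error_bounds (by omega : 1 ≤ d) hM hK hζ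
  have hz : 0 < min ζ 1 := lt_min hζ one_pos
  have hd3 : (3 : ℝ) ≤ d := by exact_mod_cast hd
  obtain ⟨A₁, hA₁, hlate⟩ := late_integral (a := (d : ℝ) / 2) (by linarith) hz one_pos hc
  obtain ⟨A₂, hA₂, hearly⟩ := early_integral_high hd hz hc
  obtain ⟨c₀, hc₀, hgreen⟩ := le_brownianGreen d hM hK one_pos
  set z := min ζ 1 with hzdef
  set δ := z / (d + z) with hδ
  have hδ0 : 0 < δ := by positivity
  refine ⟨min (z / 8) (δ / 2), by positivity, A₁ * M ^ (z / 8) / c₀ + A₂ / c₀, by positivity,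
    max (max 1 (2 * M)) (2 ^ (1 / δ) + 1), by positivity,
    fun Q g h x hx hη e he hint hint' hR => ?_⟩
  obtain ⟨b1, b2, -, b4⟩ := hb Q g h x hx hη e he
  have hQ := h.isCore hM hζ
  have hhM : ‖firstMoment Q‖ ≤ M := norm_firstMoment_le hM.le hQ.mom_one
  obtain ⟨hgr, hgr'⟩ := hgreen _ Q hQ x hx hη hint' _ _ rfl rfl
  set G := brownianGreen (vec x) (firstMoment Q) (secondMoment Q) with hG
  set n := ‖vec x‖ with hn
  set η := ‖firstMoment Q‖ with hηdef
  have hR1 := (le_max_left _ _).trans hR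
  have hn1 : 1 ≤ n := (le_max_left _ _).trans hR1
  have hn2 : 2 ^ (1 / δ) < n := by linarith [(le_max_right _ _).trans hR]
  have hn0 : 0 < n := by linarith
  have hη0 : 0 ≤ η := norm_nonneg _
  have he0 : ∀ t > 0, 0 ≤ e t := fun t _ => by rw [he t]; exact norm_nonneg _
  have hE := hearly e n η he0 hη0 hn1 b1 (b4 hd) hint
  set T := n ^ (2 - δ) with hT
  have hT0 : 0 < T := Real.rpow_pos_of_pos hn0 _
  set S := {t : ℝ | t * η ≤ n / 2} with hS
  have hSm : MeasurableSet S := measurableSet_le (by fun_prop) (by fun_prop)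
  have hsplit : ∫ t in Set.Ioi 0, e t = (∫ t in Set.Ioc 0 T ∩ S, e t) +
      (∫ t in Set.Ioc 0 T \ S, e t) + ∫ t in Set.Ioi T, e t := by
    have h1 : IntegrableOn e (Set.Ioc 0 T) := hint.mono_set Set.Ioc_subset_Ioi_self
    rw [integral_inter_add_sdiff hSm h1, ← setIntegral_union (Set.Ioc_disjoint_Ioi le_rfl)
      measurableSet_Ioi h1 (hint.mono_set (Set.Ioi_subset_Ioi hT0.le)),
      Set.Ioc_union_Ioi_eq_Ioi hT0.le]
  have hlow : n ^ (2 - (d : ℝ)) ≤ G / c₀ := by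
    rw [le_div_iff₀' hc₀]
    rcases le_total (n * η) 1 with h1 | h1
    · exact hgr' h1
    · have hη1 : 0 < η := pos_of_mul_pos_right (one_pos.trans_le h1) hn0.le
      refine le_trans ?_ (hgr hη1 h1)
      gcongr
      -- `(n / η) ^ (1 / 2 - d / 2) / η = n ^ (2 - d) * (n * η) ^ ((d - 3) / 2)`
      have h2 : (n / η) ^ (1 / 2 - (d : ℝ) / 2) / η =
          n ^ (2 - (d : ℝ)) * (n * η) ^ (((d : ℝ) - 3) / 2) := by
        rw [Real.div_rpow hn0.le hη0, Real.mul_rpow hn0.le hη0, ← mul_assoc,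
          ← Real.rpow_add hn0, div_div, ← Real.rpow_add_one hη1.ne', div_eq_mul_inv,
          ← Real.rpow_neg hη0]
        congr 2 <;> ring
      rw [h2]
      exact le_mul_of_one_le_right (by positivity)
        (Real.one_le_rpow h1 (by linarith))
  have hG0 : 0 < G := by
    have h1 : 0 < n ^ (2 - (d : ℝ)) := by positivity
    exact (div_pos_iff_of_pos_right hc₀).mp (h1.trans_le hlow)
  have hdiff : ∫ t in Set.Ioc 0 T \ S, e t ≤ A₁ * M ^ (z / 8) / c₀ * n ^ (-(z / 8)) * G := by
    rcases le_total 1 (n * η) with h1 | h1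
    · have hη1 : 0 < η := pos_of_mul_pos_right (one_pos.trans_le h1) hn0.le
      have hnM : n / M ≤ n / η := by gcongr
      have ht₀ : 2 ≤ n / η := le_trans (by
        rw [le_div_iff₀ hM]; exact (le_max_right _ _).trans hR1) hnM
      have hL := hlate e n η he0 hη1 hn0 ht₀ h1 (fun t ht => b1 t (by linarith)) b2 hint
      have hpow : (n / η) ^ (-(z / 8)) ≤ M ^ (z / 8) * n ^ (-(z / 8)) := by
        calc (n / η) ^ (-(z / 8)) ≤ (n / M) ^ (-(z / 8)) :=
              Real.rpow_le_rpow_of_nonpos (by positivity) hnM (neg_nonpos.mpr (by positivity))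
          _ = M ^ (z / 8) * n ^ (-(z / 8)) := by
              rw [Real.div_rpow hn0.le hM.le, Real.rpow_neg hM.le, div_inv_eq_mul, mul_comm]
      have hLC : (n / η) ^ (1 / 2 - (d : ℝ) / 2) / η ≤ G / c₀ := by
        rw [le_div_iff₀' hc₀]; exact hgr hη1 h1
      have hcut : 0 < n / η / 2 := by linarith
      have hsub : Set.Ioc 0 T \ S ⊆ Set.Ioi (n / η / 2) := by
        intro t ht
        have h2 : n / 2 < t * η := not_le.mp ht.2
        have h3 : n / η / 2 = n / 2 / η := by ring
        rw [Set.mem_Ioi, h3, div_lt_iff₀ hη1]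
        exact h2
      calc _ ≤ ∫ t in Set.Ioi (n / η / 2), e t :=
            setIntegral_mono_set (hint.mono_set (Set.Ioi_subset_Ioi hcut.le))
              ((ae_restrict_iff' measurableSet_Ioi).mpr
                (Filter.Eventually.of_forall fun t ht => he0 t (hcut.trans ht)))
              hsub.eventuallyLE
        _ ≤ A₁ * (n / η) ^ (-(z / 8)) * ((n / η) ^ (1 / 2 - (d : ℝ) / 2) / η) := hL
        _ ≤ A₁ * (M ^ (z / 8) * n ^ (-(z / 8))) * (G / c₀) := by gcongr
        _ = _ := by ring
    · -- for `n * η ≤ 1` all times up to `n ^ (2 - δ)` have `t * η ≤ n ^ (1 - δ) ≤ n / 2`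
      have hempty : Set.Ioc 0 T \ S = ∅ := by
        rw [Set.sdiff_eq_empty]
        intro t ht
        have h2 : 2 ≤ n ^ δ := by
          calc (2 : ℝ) = (2 ^ (1 / δ)) ^ δ := by
                rw [← Real.rpow_mul zero_le_two, one_div_mul_cancel hδ0.ne', Real.rpow_one]
            _ ≤ n ^ δ := Real.rpow_le_rpow (by positivity) hn2.le hδ0.le
        have h3 : T * n ^ δ = n * n := by
          rw [hT, ← Real.rpow_add hn0, sub_add_cancel, Real.rpow_two, sq]
        have h4 : T * 2 ≤ n * n := by rw [← h3]; gcongr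
        have h5 : T * η * 2 ≤ n := by
          calc T * η * 2 = T * 2 * η := by ring
            _ ≤ n * n * η := by gcongr
            _ = n * (n * η) := by ring
            _ ≤ n := mul_le_of_le_one_right hn0.le h1
        have h6 : t * η ≤ T * η := by gcongr; exact ht.2
        change t * η ≤ n / 2
        linarith
      rw [hempty, setIntegral_empty]
      positivity
  have hz1 : n ^ (-(z / 8)) ≤ n ^ (-min (z / 8) (δ / 2)) :=
    Real.rpow_le_rpow_of_exponent_le hn1 (neg_le_neg (min_le_left _ _))
  have hz2 : n ^ (-(δ / 2)) ≤ n ^ (-min (z / 8) (δ / 2)) :=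
    Real.rpow_le_rpow_of_exponent_le hn1 (neg_le_neg (min_le_right _ _))
  have hsum : (∫ t in Set.Ioc 0 T ∩ S, e t) + ∫ t in Set.Ioi T, e t ≤
      A₂ / c₀ * n ^ (-(δ / 2)) * G := by
    refine hE.trans ?_
    rw [sub_eq_add_neg (2 - (d : ℝ)), Real.rpow_add hn0]
    calc _ ≤ A₂ * (G / c₀ * n ^ (-(δ / 2))) := by gcongr
      _ = _ := by ring
  rw [hsplit]
  calc _ ≤ A₁ * M ^ (z / 8) / c₀ * n ^ (-(z / 8)) * G + A₂ / c₀ * n ^ (-(δ / 2)) * G := by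
        linarith
    _ ≤ A₁ * M ^ (z / 8) / c₀ * n ^ (-min (z / 8) (δ / 2)) * G +
        A₂ / c₀ * n ^ (-min (z / 8) (δ / 2)) * G := by gcongr
    _ = _ := by ring

lemma brownianGreen_pos {M K s₀ z : ℝ} (hM : 0 < M) (hK : 0 < K) (hs₀ : 0 < s₀)
    {Q : (Fin d → ℤ) → ℝ} (hQ : IsCore M K z Q) {x : Fin d → ℤ} (hx : x ≠ 0)
    (hη : firstMoment Q = ‖firstMoment Q‖ • (‖vec x‖⁻¹ • vec x))
    (hint : IntegrableOn (fun t => heatKernel (firstMoment Q) (secondMoment Q) t (vec x))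
      (Set.Ioi 0)) : 0 < brownianGreen (vec x) (firstMoment Q) (secondMoment Q) := by
  obtain ⟨c, hc, hgreen⟩ := le_brownianGreen d hM hK hs₀
  obtain ⟨h1, h2⟩ := hgreen _ Q hQ x hx hη hint _ _ rfl rfl
  have hn0 : 0 < ‖vec x‖ := lt_of_lt_of_le one_pos (one_le_norm_vec hx)
  rcases le_total (‖vec x‖ * ‖firstMoment Q‖) s₀ with h | h
  · exact lt_of_lt_of_le (by positivity) (h2 h)
  · have hη0 := pos_of_mul_pos_right (hs₀.trans_le h) hn0.le
    exact lt_of_lt_of_le (by positivity) (h1 hη0 h)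

end GaussianLemma

theorem theorem1p7 (d : ℕ) (hd : 1 ≤ d) (M K ζ s₀ : ℝ)
    (hM : 0 < M) (hK : 0 < K) (hζ : 0 < ζ) (hs₀ : 0 < s₀) :
    ∃ ε > (0 : ℝ), ∃ A > (0 : ℝ), ∃ R > (0 : ℝ),
      ∀ Q g : (Fin d → ℤ) → ℝ, GaussianLemma.IsClassQ d M K ζ Q g →
      ∀ x : Fin d → ℤ, x ≠ 0 →
        GaussianLemma.firstMoment Q =
          ‖GaussianLemma.firstMoment Q‖ •
            (‖GaussianLemma.vec x‖⁻¹ • GaussianLemma.vec x) →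
        (d ≤ 2 → s₀ ≤ ‖GaussianLemma.vec x‖ * ‖GaussianLemma.firstMoment Q‖) →
        -- both time integrals converge absolutely
        MeasureTheory.IntegrableOn (fun t : ℝ => GaussianLemma.torusIntegral Q g t x)
            (Set.Ioi 0) ∧
        MeasureTheory.IntegrableOn
            (fun t : ℝ => GaussianLemma.heatKernel (GaussianLemma.firstMoment Q)
              (GaussianLemma.secondMoment Q) t (GaussianLemma.vec x))
            (Set.Ioi 0) ∧
        (R ≤ ‖GaussianLemma.vec x‖ →
          ∃ r : ℂ, ‖r‖ ≤ A * ‖GaussianLemma.vec x‖ ^ (-ε) ∧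
            GaussianLemma.latticeGreen Q g x =
              (GaussianLemma.brownianGreen (GaussianLemma.vec x)
                  (GaussianLemma.firstMoment Q) (GaussianLemma.secondMoment Q) : ℂ) *
                (GaussianLemma.latticeFourier g 0 + r)) := by
  open GaussianLemma in
  have herr : ∃ ε > (0 : ℝ), ∃ A > (0 : ℝ), ∃ R > (0 : ℝ), ∀ Q g : (Fin d → ℤ) → ℝ,
      IsClassQ d M K ζ Q g → ∀ x : Fin d → ℤ, x ≠ 0 →
      firstMoment Q = ‖firstMoment Q‖ • (‖vec x‖⁻¹ • vec x) →
      (d ≤ 2 → s₀ ≤ ‖vec x‖ * ‖firstMoment Q‖) → ∀ e : ℝ → ℝ,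
      (∀ t, e t = ‖torusIntegral Q g t x - latticeFourier g 0 *
        (heatKernel (firstMoment Q) (secondMoment Q) t (vec x) : ℝ)‖) →
      IntegrableOn e (Set.Ioi 0) →
      IntegrableOn (fun t => heatKernel (firstMoment Q) (secondMoment Q) t (vec x))
        (Set.Ioi 0) → R ≤ ‖vec x‖ →
      ∫ t in Set.Ioi 0, e t ≤ A * ‖vec x‖ ^ (-ε) *
        brownianGreen (vec x) (firstMoment Q) (secondMoment Q) := by
    rcases le_or_gt d 2 with hd2 | hd2
    · obtain ⟨ε, hε, A, hA, R, hR, h⟩ := error_le_low hd hd2 hM hK hζ hs₀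
      exact ⟨ε, hε, A, hA, R, hR, fun Q g hQ x hx hη hs => h Q g hQ x hx hη (hs hd2)⟩
    · obtain ⟨ε, hε, A, hA, R, hR, h⟩ := error_le_high hd2 hM hK hζ
      exact ⟨ε, hε, A, hA, R, hR, fun Q g hQ x hx hη _ => h Q g hQ x hx hη⟩
  obtain ⟨ε, hε, A, hA, R, hR, herr⟩ := herr
  refine ⟨ε, hε, A, hA, R, hR, fun Q g h x hx hη hs => ?_⟩
  have hQ := h.isCore hM hζ
  have hdh : 3 ≤ d ∨ 0 < ‖GaussianLemma.firstMoment Q‖ := by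
    rcases le_or_gt d 2 with hd2 | hd2
    · exact Or.inr (pos_of_mul_pos_right (hs₀.trans_le (hs hd2)) (norm_nonneg _))
    · exact Or.inl hd2
  have hI := GaussianLemma.integrableOn_torusIntegral hd hM hK hζ h hx hη hdh
  have hρ := GaussianLemma.integrableOn_heatKernel hd hM hK hQ hx hη hdh
  refine ⟨hI, hρ, fun hRx => ?_⟩
  have hG := GaussianLemma.brownianGreen_pos hM hK hs₀ hQ hx hη hρ
  have hρ' : IntegrableOn (fun t => GaussianLemma.latticeFourier g 0 *
      (GaussianLemma.heatKernel (GaussianLemma.firstMoment Q) (GaussianLemma.secondMoment Q) t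
        (GaussianLemma.vec x) : ℂ)) (Set.Ioi 0) := hρ.ofReal.const_mul _
  have hbound := herr Q g h x hx hη hs _ (fun t => rfl) (hI.sub hρ').norm hρ hRx
  have hdiff : GaussianLemma.latticeGreen Q g x - GaussianLemma.latticeFourier g 0 *
      (GaussianLemma.brownianGreen (GaussianLemma.vec x)
        (GaussianLemma.firstMoment Q) (GaussianLemma.secondMoment Q) : ℂ) =
      ∫ t in Set.Ioi (0 : ℝ), (GaussianLemma.torusIntegral Q g t x -
        GaussianLemma.latticeFourier g 0 * (GaussianLemma.heatKernel
          (GaussianLemma.firstMoment Q) (GaussianLemma.secondMoment Q) t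
          (GaussianLemma.vec x) : ℂ)) := by
    rw [integral_sub hI hρ', integral_const_mul, integral_complex_ofReal,
      GaussianLemma.latticeGreen, GaussianLemma.brownianGreen]
  set G := GaussianLemma.brownianGreen (GaussianLemma.vec x) (GaussianLemma.firstMoment Q)
    (GaussianLemma.secondMoment Q)
  have hGC : (G : ℂ) ≠ 0 := Complex.ofReal_ne_zero.mpr hG.ne'
  refine ⟨GaussianLemma.latticeGreen Q g x / G - GaussianLemma.latticeFourier g 0, ?_, ?_⟩
  · rw [div_sub' hGC, norm_div, Complex.norm_real, Real.norm_of_nonneg hG.le, div_le_iff₀ hG,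
      mul_comm (G : ℂ), hdiff]
    exact (norm_integral_le_integral_norm _).trans hbound
  · rw [add_sub_cancel, mul_div_cancel₀ _ hGC]
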